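/- **Setting.** Let $0\le \mathcal O<P$ and $1\le k\le P$ be integers. For each sample size $n>P$ let $Y=X\theta+u$, where $X=X_n$ is a non-stochastic $n\times P$ matrix of rank $P$, $u\sim N(0,\sigma^2I_n)$, $\sigma>0$, $\theta\in\mathbb R^P$; write $P_{n,\theta,\sigma}$ for the corresponding probability. Assume that $X'X/n\to Q$ as $n\to\infty$ with $Q$ non-singular. Let $A$ be a non-stochastic $k\times P$ matrix of rank $k$. For a matrix $D$ with $P$ columns, $D[p]$ and $D[\neg p]$ denote its first $p$ and its last $P-p$ columns; $x[\neg p]$ denotes the last $P-p$ coordinates of $x\in\mathbb R^P$; $Q[p:p]$ is the leading $p\times p$ block of $Q$ and $Q[p:\neg p]$ the block of its first $p$ rows and last $P-p$ columns. Inequalities between vectors are coordinatewise. *Estimators and model selection.* For $0\le p\le P$ let $\tilde\theta(p)\in\mathbb R^P$ be the restricted least-squares estimator with first $p$ coordinates $(X[p]'X[p])^{-1}X[p]'Y$ and last $P-p$ coordinates zero. Let $\hat\sigma^2=(n-P)^{-1}\|Y-X\tilde\theta(P)\|^2$, $\xi_{n,p}=\big([(X[p]'X[p]/n)^{-1}]_{p,p}\big)^{1/2}$,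 $T_0=T_0^*=0$, and for $0<p\le P$ $$T_p=\frac{\sqrt n\,\tilde\theta_p(p)}{\hat\sigma\,\xi_{n,p}},\qquad T_p^*=\frac{\sqrt n\,\tilde\theta_p(p)}{\sigma\,\xi_{n,p}} .$$ The critical values do not depend on $n$ and satisfy $c_{\mathcal O}=0$ and $0<c_p<\infty$ for $\mathcal O<p\le P$; for $p<\mathcal O$ the values $c_p$ are arbitrary (they play no role). Put $\hat p=\max\{p:|T_p|\ge c_p,\ 0\le p\le P\}$, $\hat p^*=\max\{p:|T^*_p|\ge c_p,\ 0\le p\le P\}$, $\tilde\theta=\tilde\theta(\hat p)$, $\tilde\theta^*=\tilde\theta(\hat p^*)$, and for $\mathcal O\le p\le P$, $t\in\mathbb R^k$, $$\pi_{n,\theta,\sigma}(p)=P_{n,\theta,\sigma}(\hat p=p),\qquad G_{n,\theta,\sigma}(t|p)=P_{n,\theta,\sigma}\big(\sqrt nA(\tilde\theta-\theta)\le t\,\big|\,\hat p=p\big),$$ and define $\pi^*_{n,\theta,\sigma}(p)$, $G^*_{n,\theta,\sigma}(t|p)$ in the same way with $\hat p^*,\tilde\theta^*$ in place of $\hat p,\tilde\theta$.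 *Limit quantities.* Let $\theta^{(n)}\in\mathbb R^P$ and $\sigma^{(n)}>0$ be such that $\sqrt n\,\theta^{(n)}\to\psi\in(\mathbb R\cup\{-\infty,\infty\})^P$ coordinatewise and $\sigma^{(n)}\to\sigma$ with $0<\sigma<\infty$. Let $p_*$ be the largest index $p$ with $\mathcal O<p\le P$ and $|\psi_p|=\infty$, and $p_*=\mathcal O$ if there is none. For $p_*\le p\le P$ let $$\delta^{(p)}=\begin{pmatrix}Q[p:p]^{-1}Q[p:\neg p]\\-I_{P-p}\end{pmatrix}\psi[\neg p]$$ ($\delta^{(P)}=0$, $\delta^{(0)}=-\psi$). Let $\Phi_{\infty,p}$ be the centered Gaussian law on $\mathbb R^k$ with covariance matrix $\sigma^2A[p]Q[p:p]^{-1}A[p]'$ (point mass at $0$ if $p=0$). For $p>0$ let $\xi_{\infty,p}^2=(Q[p:p]^{-1})_{p,p}$, $C^{(p)}_\infty=A[p]Q[p:p]^{-1}e_p$ with $e_p$ the last standard basis vector of $\mathbb R^p$, $b_{\infty,p}=C_\infty^{(p)\prime}(A[p]Q[p:p]^{-1}A[p]')^-$ and $\zeta_{\infty,p}^2=\xi_{\infty,p}^2-b_{\infty,p}C_\infty^{(p)}$,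 where $M^-$ is any matrix with $MM^-M=M$. Let $\Delta_s(a,b)=P(|M-a|<b)$ for $M\sim N(0,s^2)$ ($M=0$ if $s=0$). Put $$L_{p_*}(t)=\Phi_{\infty,p_*}(t-A\delta^{(p_*)})\prod_{q=p_*+1}^P\Delta_{\sigma\xi_{\infty,q}}\big(\delta^{(q)}_q+\psi_q,\;c_q\sigma\xi_{\infty,q}\big),$$ and for $p_*<p\le P$ $$L_p(t)=\int_{z\le t-A\delta^{(p)}}\Big(1-\Delta_{\sigma\zeta_{\infty,p}}\big(\delta^{(p)}_p+\psi_p+b_{\infty,p}z,\;c_p\sigma\xi_{\infty,p}\big)\Big)\Phi_{\infty,p}(dz)\;\prod_{q=p+1}^P\Delta_{\sigma\xi_{\infty,q}}\big(\delta^{(q)}_q+\psi_q,\;c_q\sigma\xi_{\infty,q}\big).$$ *Convergence.* Not necessarily normalized cdfs $H_n$ on $\mathbb R^k$ converge weakly to $H$ if $H_n(t)\to H(t)$ at each continuity point $t$ of $H$ and the total masses converge, $H_n(\mathbb R^k)\to H(\mathbb R^k)$. They converge in total variation if $\sup_B|H_n(B)-H(B)|\to0$, the supremum being over Borel sets $B\subseteq\mathbb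 R^k$ and the cdfs being identified with the finite measures they define. **Corollary 5.3.** Fix $p$ with $\mathcal O\le p\le P$, and let $H_n(t)$ be either $G_{n,\theta^{(n)},\sigma^{(n)}}(t|p)\,\pi_{n,\theta^{(n)},\sigma^{(n)}}(p)$ or $G^*_{n,\theta^{(n)},\sigma^{(n)}}(t|p)\,\pi^*_{n,\theta^{(n)},\sigma^{(n)}}(p)$. 1. If $p=p_*$, then $H_n$ converges weakly to $L_{p_*}$. 2. If $p>p_*$, then $H_n$ converges weakly to $L_p$. 3. If $p<p_*$, then $H_n$ converges to zero in total variation. 4. The convergence in 1 and 2 holds in total variation if $p>0$ and $A[p]$ has rank $k$, and also if $p<P$ and $\sqrt n\,A[\neg p]\,\theta^{(n)}[\neg p]$ is constant in $n$. 5. If $p>0$ and $A[p]$ has rank $k$, then $H_n$ has a density with respect to Lebesgue measure on $\mathbb R^k$, for each $n>P$. -/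

import Mathlib

open MeasureTheory ProbabilityTheory Filter Topology Matrix

noncomputable section

namespace PostModelSelection

/-! Conventions: `P` is the number of regressors, and model orders `p`, `q` are natural numbers between
`0` and `P`. Orders and coordinates are counted from `1` as in the text, while `Fin P` is
counted from `0`; so the first `p` coordinates are the `i : Fin P` with `i < p`, and coordinate
number `p` is `⟨p - 1, _⟩`. -/

/-- Indices of the first `p` of `P` coordinates. -/
abbrev Head (P p : ℕ) : Type := {i : Fin P // (i : ℕ) < p}

/-- Indices of the last `P - p` of `P` coordinates. -/
abbrev Tail (P p : ℕ) : Type := {i : Fin P // p ≤ (i : ℕ)}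

/-- `D[p]`: the first `p` columns of `D`. -/
def headCols {m : Type*} {P : ℕ} (D : Matrix m (Fin P) ℝ) (p : ℕ) : Matrix m (Head P p) ℝ :=
  D.submatrix id Subtype.val

/-- `D[¬p]`: the last `P - p` columns of `D`. -/
def tailCols {m : Type*} {P : ℕ} (D : Matrix m (Fin P) ℝ) (p : ℕ) : Matrix m (Tail P p) ℝ :=
  D.submatrix id Subtype.val

/-- `x[¬p]`: the last `P - p` coordinates of `x`. -/
def tailVec {P : ℕ} (x : Fin P → ℝ) (p : ℕ) : Tail P p → ℝ := fun i => x i.val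

/-- The coordinate `x_p`, counted from one; by convention `x_0 = 0`. -/
def coord {P : ℕ} (x : Fin P → ℝ) (p : ℕ) : ℝ :=
  if h : 1 ≤ p ∧ p ≤ P then x ⟨p - 1, by omega⟩ else 0

/-- The `p`-th standard basis vector (counted from one) in the space of the first `p`
coordinates. -/
def lastBasisVec (P p : ℕ) : Head P p → ℝ := fun i => if (i.val : ℕ) + 1 = p then 1 else 0

/-- The leading block `S[p : p]`. -/
def leadBlock {P : ℕ} (S : Matrix (Fin P) (Fin P) ℝ) (p : ℕ) : Matrix (Head P p) (Head P p) ℝ :=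
  S.submatrix Subtype.val Subtype.val

/-- The block `S[p : ¬p]`: first `p` rows and last `P - p` columns. -/
def offBlock {P : ℕ} (S : Matrix (Fin P) (Fin P) ℝ) (p : ℕ) : Matrix (Head P p) (Tail P p) ℝ :=
  S.submatrix Subtype.val Subtype.val

/-- `X'X / n`. -/
def gram {n P : ℕ} (X : Matrix (Fin n) (Fin P) ℝ) : Matrix (Fin P) (Fin P) ℝ :=
  (n : ℝ)⁻¹ • (Xᵀ * X)

/-- `ξ_p = ((S[p : p]⁻¹)_{p,p})^{1/2}`; with `S = X'X / n` this is `ξ_{n,p}`, with `S = Q` it is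
`ξ_{∞,p}`. -/
def xi {P : ℕ} (S : Matrix (Fin P) (Fin P) ℝ) (p : ℕ) : ℝ :=
  √(lastBasisVec P p ⬝ᵥ ((leadBlock S p)⁻¹ *ᵥ lastBasisVec P p))

/-! ### The regression model, the estimators and the selection procedures -/

/-- The distribution `P_{n,θ,σ}` of `Y = Xθ + u`, `u ∼ N(0, σ² I_n)`: the observations are
independent and `Y_i ∼ N((Xθ)_i, σ²)`. -/
def dataLaw {n P : ℕ} (X : Matrix (Fin n) (Fin P) ℝ) (θ : Fin P → ℝ) (σ : ℝ) :
    Measure (Fin n → ℝ) :=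
  Measure.pi fun i => gaussianReal ((X *ᵥ θ) i) (σ ^ 2).toNNReal

/-- The restricted least-squares estimator `θ̃(p)` under the restriction `θ[¬p] = 0`: its first `p`
coordinates are `(X[p]'X[p])⁻¹ X[p]'Y`, the others vanish. -/
def restrictedLS {n P : ℕ} (X : Matrix (Fin n) (Fin P) ℝ) (p : ℕ) (Y : Fin n → ℝ) : Fin P → ℝ :=
  fun i => if h : (i : ℕ) < p then
    (((headCols X p)ᵀ * headCols X p)⁻¹ *ᵥ ((headCols X p)ᵀ *ᵥ Y)) ⟨i, h⟩ else 0

/-- `σ̂`, where `σ̂² = (n - P)⁻¹ (Y - Xθ̃(P))'(Y - Xθ̃(P))`. -/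
def sigmaHat {n P : ℕ} (X : Matrix (Fin n) (Fin P) ℝ) (Y : Fin n → ℝ) : ℝ :=
  √(((n : ℝ) - (P : ℝ))⁻¹ *
    ((Y - X *ᵥ restrictedLS X P Y) ⬝ᵥ (Y - X *ᵥ restrictedLS X P Y)))

/-- The test statistic `√n θ̃_p(p) / (s ξ_{n,p})`, and `0` for `p = 0`. With `s = σ̂` it is `T_p`,
with `s = σ` it is `T_p*`. -/
def tStat {n P : ℕ} (X : Matrix (Fin n) (Fin P) ℝ) (s : ℝ) (p : ℕ) (Y : Fin n → ℝ) : ℝ :=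
  √(n : ℝ) * coord (restrictedLS X p Y) p / (s * xi (gram X) p)

/-- The selected order `max {p : |T_p| ≥ c_p, 0 ≤ p ≤ P}`, where the scale in the test statistics
is `s Y`. -/
def selected {n P : ℕ} (X : Matrix (Fin n) (Fin P) ℝ) (c : ℕ → ℝ) (s : (Fin n → ℝ) → ℝ)
    (Y : Fin n → ℝ) : ℕ :=
  ((Finset.range (P + 1)).filter fun p => c p ≤ |tStat X (s Y) p Y|).sup id

/-- The post-model-selection estimator: `θ̃(p)` on the event that order `p` is selected. -/
def postEstimator {n P : ℕ} (X : Matrix (Fin n) (Fin P) ℝ) (c : ℕ → ℝ) (s : (Fin n → ℝ) → ℝ)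
    (Y : Fin n → ℝ) : Fin P → ℝ :=
  restrictedLS X (selected X c s Y) Y

/-- The measure on `ℝ^k` with distribution function `G(t|p) π(p)`: the conditional
law of `√n A(θ̃ - θ)` given that order `p` is selected, times the probability of selecting `p`. Here
`s` is the scale used in the test statistics. -/
def weightedCondLaw {n P k : ℕ} (A : Matrix (Fin k) (Fin P) ℝ) (X : Matrix (Fin n) (Fin P) ℝ)
    (c : ℕ → ℝ) (θ : Fin P → ℝ) (σ : ℝ) (s : (Fin n → ℝ) → ℝ) (p : ℕ) : Measure (Fin k → ℝ) :=
  dataLaw X θ σ {Y | selected X c s Y = p} •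
    (ProbabilityTheory.cond (dataLaw X θ σ) {Y | selected X c s Y = p}).map
      fun Y => √(n : ℝ) • (A *ᵥ (postEstimator X c s Y - θ))

/-- Unknown-variance case: the measure with distribution function
`G_{n,θ,σ}(t|p) π_{n,θ,σ}(p)`. -/
def weightedCond {n P k : ℕ} (A : Matrix (Fin k) (Fin P) ℝ) (X : Matrix (Fin n) (Fin P) ℝ)
    (c : ℕ → ℝ) (θ : Fin P → ℝ) (σ : ℝ) (p : ℕ) : Measure (Fin k → ℝ) :=
  weightedCondLaw A X c θ σ (sigmaHat X) p

/-- Known-variance case: the measure with distribution function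
`G*_{n,θ,σ}(t|p) π*_{n,θ,σ}(p)`. -/
def weightedCondStar {n P k : ℕ} (A : Matrix (Fin k) (Fin P) ℝ) (X : Matrix (Fin n) (Fin P) ℝ)
    (c : ℕ → ℝ) (θ : Fin P → ℝ) (σ : ℝ) (p : ℕ) : Measure (Fin k → ℝ) :=
  weightedCondLaw A X c θ σ (fun _ => σ) p

/-! ### Modes of convergence for finite measures on `ℝ^k`

`Fin k → ℝ` carries the coordinatewise order, so `Set.Iic t = {z | z ≤ t}`. -/

/-- The (not necessarily normalized) distribution function of a finite measure. -/
def cdfOf {k : ℕ} (μ : Measure (Fin k → ℝ)) (t : Fin k → ℝ) : ℝ := μ.real (Set.Iic t)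

/-- Weak convergence of not necessarily normalized distribution functions: convergence at every
continuity point of the limit, and convergence of the total mass. -/
def WeakConv {k : ℕ} (μ : ℕ → Measure (Fin k → ℝ)) (ν : Measure (Fin k → ℝ)) : Prop :=
  (∀ t, ContinuousAt (cdfOf ν) t → Tendsto (fun n => cdfOf (μ n) t) atTop (𝓝 (cdfOf ν t))) ∧
    Tendsto (fun n => (μ n).real Set.univ) atTop (𝓝 (ν.real Set.univ))

/-- Total variation distance of finite measures: `sup_B |μ(B) - ν(B)|` over measurable `B`. -/
def tvDist {k : ℕ} (μ ν : Measure (Fin k → ℝ)) : ℝ :=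
  ⨆ B : {B : Set (Fin k → ℝ) // MeasurableSet B}, |μ.real B.val - ν.real B.val|

/-- Convergence in total variation. -/
def TVConv {k : ℕ} (μ : ℕ → Measure (Fin k → ℝ)) (ν : Measure (Fin k → ℝ)) : Prop :=
  Tendsto (fun n => tvDist (μ n) ν) atTop (𝓝 0)

/-- The measure has a density with respect to Lebesgue measure on `ℝ^k`. -/
def HasLebesgueDensity {k : ℕ} (μ : Measure (Fin k → ℝ)) : Prop :=
  ∃ f : (Fin k → ℝ) → ENNReal, Measurable f ∧ μ = (volume : Measure (Fin k → ℝ)).withDensity f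

/-! ### The limit -/

/-- `G` is a generalized inverse of `M`. -/
def IsGenInverse {k : ℕ} (M G : Matrix (Fin k) (Fin k) ℝ) : Prop := M * G * M = M

/-- `Δ_s(a, b) = P(|M - a| < b)` for `M ∼ N(0, s²)` (and `M = 0` if `s = 0`). -/
def Delta (s a b : ℝ) : ℝ := (gaussianReal 0 (s ^ 2).toNNReal).real {x | |x - a| < b}

/-- `p_*`: the largest `p` with `O < p ≤ P` and `|ψ_p| = ∞`, and `O` if there is none. -/
def pStar {P : ℕ} (O : ℕ) (ψ : Fin P → EReal) : ℕ :=
  max O ((Finset.univ.filter fun i : Fin P => O < (i : ℕ) + 1 ∧ (ψ i = ⊤ ∨ ψ i = ⊥)).sup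
    fun i => (i : ℕ) + 1)

/-- The real parts of the coordinates of `ψ`. In the limit below only the coordinates `ψ_q` with
`q > p_*` enter; these are finite. -/
def realPart {P : ℕ} (ψ : Fin P → EReal) : Fin P → ℝ := fun i => (ψ i).toReal

/-- `δ^{(p)}`: first `p` coordinates `Q[p : p]⁻¹ Q[p : ¬p] ψ[¬p]`, last `P - p` coordinates
`-ψ[¬p]`. -/
def delta {P : ℕ} (Q : Matrix (Fin P) (Fin P) ℝ) (ψ : Fin P → ℝ) (p : ℕ) : Fin P → ℝ :=
  fun i => if h : (i : ℕ) < p then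
    ((leadBlock Q p)⁻¹ *ᵥ (offBlock Q p *ᵥ tailVec ψ p)) ⟨i, h⟩ else -ψ i

/-- `A[p] Q[p : p]⁻¹ A[p]'` (the zero matrix for `p = 0`). -/
def asympCov {P k : ℕ} (A : Matrix (Fin k) (Fin P) ℝ) (Q : Matrix (Fin P) (Fin P) ℝ) (p : ℕ) :
    Matrix (Fin k) (Fin k) ℝ :=
  headCols A p * (leadBlock Q p)⁻¹ * (headCols A p)ᵀ

/-- `C_∞^{(p)} = A[p] Q[p : p]⁻¹ e_p`. -/
def Cinf {P k : ℕ} (A : Matrix (Fin k) (Fin P) ℝ) (Q : Matrix (Fin P) (Fin P) ℝ) (p : ℕ) :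
    Fin k → ℝ :=
  headCols A p *ᵥ ((leadBlock Q p)⁻¹ *ᵥ lastBasisVec P p)

/-- `b_{∞,p} z = C_∞^{(p)}' G z`, where `G` is a generalized inverse of `A[p] Q[p : p]⁻¹ A[p]'`. -/
def bInf {P k : ℕ} (A : Matrix (Fin k) (Fin P) ℝ) (Q : Matrix (Fin P) (Fin P) ℝ)
    (G : Matrix (Fin k) (Fin k) ℝ) (p : ℕ) (z : Fin k → ℝ) : ℝ :=
  Cinf A Q p ⬝ᵥ (G *ᵥ z)

/-- `ζ_{∞,p}`, where `ζ_{∞,p}² = ξ_{∞,p}² - C_∞^{(p)}' G C_∞^{(p)}`. -/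
def zetaInf {P k : ℕ} (A : Matrix (Fin k) (Fin P) ℝ) (Q : Matrix (Fin P) (Fin P) ℝ)
    (G : Matrix (Fin k) (Fin k) ℝ) (p : ℕ) : ℝ :=
  √(xi Q p ^ 2 - Cinf A Q p ⬝ᵥ (G *ᵥ Cinf A Q p))

/-- The centered Gaussian law `Φ_{∞,p}` on `ℝ^k` with covariance matrix
`σ² A[p] Q[p : p]⁻¹ A[p]'`; for `p = 0` this is point mass at zero. -/
def PhiInf {P k : ℕ} (A : Matrix (Fin k) (Fin P) ℝ) (Q : Matrix (Fin P) (Fin P) ℝ) (σ : ℝ)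
    (p : ℕ) : Measure (Fin k → ℝ) :=
  (multivariateGaussian 0 (σ ^ 2 • asympCov A Q p)).map WithLp.ofLp

/-- `∏_{q = p+1}^P Δ_{σ ξ_{∞,q}}(δ_q^{(q)} + ψ_q, c_q σ ξ_{∞,q})`. -/
def tailProd {P : ℕ} (Q : Matrix (Fin P) (Fin P) ℝ) (c : ℕ → ℝ) (ψ : Fin P → ℝ) (σ : ℝ)
    (p : ℕ) : ℝ :=
  ∏ q ∈ Finset.Icc (p + 1) P,
    Delta (σ * xi Q q) (coord (delta Q ψ q) q + coord ψ q) (c q * σ * xi Q q)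

/-- The measure with distribution function
`Φ_{∞,p}(t - Aδ^{(p)}) ∏_{q = p+1}^P Δ_{σ ξ_{∞,q}}(δ_q^{(q)} + ψ_q, c_q σ ξ_{∞,q})`. -/
def leadingTerm {P k : ℕ} (A : Matrix (Fin k) (Fin P) ℝ) (Q : Matrix (Fin P) (Fin P) ℝ)
    (c : ℕ → ℝ) (ψ : Fin P → ℝ) (σ : ℝ) (p : ℕ) : Measure (Fin k → ℝ) :=
  ENNReal.ofReal (tailProd Q c ψ σ p) •
    (PhiInf A Q σ p).map fun z => z + A *ᵥ delta Q ψ p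

/-- The measure with distribution function
`∫_{z ≤ t - Aδ^{(p)}} (1 - Δ_{σ ζ_{∞,p}}(δ_p^{(p)} + ψ_p + b_{∞,p} z, c_p σ ξ_{∞,p})) Φ_{∞,p}(dz)`
times `∏_{q = p+1}^P Δ_{σ ξ_{∞,q}}(δ_q^{(q)} + ψ_q, c_q σ ξ_{∞,q})`. -/
def sumTerm {P k : ℕ} (A : Matrix (Fin k) (Fin P) ℝ) (Q : Matrix (Fin P) (Fin P) ℝ)
    (G : Matrix (Fin k) (Fin k) ℝ) (c : ℕ → ℝ) (ψ : Fin P → ℝ) (σ : ℝ) (p : ℕ) :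
    Measure (Fin k → ℝ) :=
  ENNReal.ofReal (tailProd Q c ψ σ p) •
    ((PhiInf A Q σ p).withDensity fun z => ENNReal.ofReal
      (1 - Delta (σ * zetaInf A Q G p) (coord (delta Q ψ p) p + coord ψ p + bInf A Q G p z)
        (c p * σ * xi Q p))).map fun z => z + A *ᵥ delta Q ψ p

end PostModelSelection

end

/-!
Gram-Schmidt orthonormalization turns the regression into statements about `P` independent standard
normal scores. Let `W` be the upper triangular matrix with `S[p:p]⁻¹ = W[p:p] W[p:p]'` for all `p`
(`whitening`, `leadBlock_inv_eq`), where `S = X'X / n`, and let `z = W'X'(Y - Xθ) / (√n σ)`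
(`scores`, `map_scores`). Then the test statistic of order `q` depends on the score `z_q` only
(`tStat_succ`), and `√n A(θ̃(p) - θ)` is an affine function `F_n` of the first `p` scores
(`sqrt_smul_mulVec_eq_estMap`). The coefficients of `F_n`, for `p ≥ p_*`, and of the test statistics of
orders `q > p_*` are continuous functions of `S`, `σ` and the coordinates of `√n θ` after the
`p_*`-th, hence converge.

The scale of the tests is `σ` or `σ̂`, and `σ̂` is consistent (`exists_sigmaHat_deviation`). Since the
event that order `p` is selected is monotone in the scales, it can be squeezed between events with
deterministic scales. These tend almost surely to a fixed event `E` in terms of the scores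
(`ae_eventually_mem_selRegion_iff`), which is empty if `p < p_*`, where the test of order `p_*`
eventually rejects. Therefore `H_n(B)` differs from `γ(E ∩ F_n⁻¹ B)`, with `γ` the standard normal
law, by a null sequence that does not depend on the Borel set `B` (`exists_uniform_approximation`).

If `p ≥ p_*`, then `F_n` converges pointwise to an affine map `F`, which gives weak convergence to
the image of `γ` restricted to `E` under `F` (`weakConv_of_approximation`). For total variation, the
two conditions in the theorem ensure that eventually the range of `F_n` lies in that of `F`; then
`F_n = F ∘ T_n` with affine maps `T_n` tending to the identity (`exists_reparametrization`), and
Scheffé's lemma applies to the images under `T_n` of the density of `γ` restricted to `E`, which is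
continuous almost everywhere (`exists_uniform_bound_of_reparametrization`).

It remains to recognize the limit. The tests of the orders above `p` involve the scores after the
`p`-th, which are independent of `F` and yield the product of the `Δ`. For `p > p_*` the test of
order `p` must also reject. The linear form of the scores in that test is regressed on the linear
part of `F`, and the conditional probability of rejection is the weight `1 - Δ` in `L_p`
(`stdNormal_regression`, `stdNormal_head_eq_lintegral`).
-/

noncomputable section

namespace PostModelSelection

/-! ### The standard normal law -/

/-- The law of a vector of independent standard normal coordinates. -/
abbrev stdNormal (ι : Type*) [Fintype ι] : Measure (ι → ℝ) :=
  Measure.pi fun _ => gaussianReal 0 1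

lemma continuous_mulVec {ι a : Type*} [Fintype a] (K : Matrix ι a ℝ) :
    Continuous fun z : a → ℝ => K *ᵥ z :=
  continuous_const.matrix_mulVec continuous_id

lemma measurable_mulVec {ι a : Type*} [Fintype a] [Fintype ι] (K : Matrix ι a ℝ) :
    Measurable fun z : a → ℝ => K *ᵥ z :=
  (continuous_mulVec K).measurable

lemma charFun_stdNormal_map_mulVec {ι d : Type*} [Fintype ι] [Fintype d] (K : Matrix ι d ℝ)
    (t : EuclideanSpace ℝ ι) :
    charFun (((stdNormal d).map (fun z => K *ᵥ z)).map (WithLp.toLp 2)) t =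
      Complex.exp (-((WithLp.ofLp t ⬝ᵥ (K * Kᵀ) *ᵥ WithLp.ofLp t : ℝ) : ℂ) / 2) := by
  rw [charFun_apply, integral_map (by fun_prop) (by fun_prop),
    integral_map (measurable_mulVec K).aemeasurable (by fun_prop)]
  have h1 : ∀ z : d → ℝ, Complex.exp ((inner ℝ (WithLp.toLp 2 (K *ᵥ z)) t : ℝ) * Complex.I) =
      ∏ i, Complex.exp ((((Kᵀ *ᵥ WithLp.ofLp t) i : ℝ) : ℂ) * (z i : ℂ) * Complex.I) := by
    intro z
    rw [← Complex.exp_sum]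
    congr 1
    rw [← Finset.sum_mul]
    congr 1
    rw [EuclideanSpace.inner_eq_star_dotProduct]
    simp only [star_trivial]
    rw [dotProduct_mulVec, ← mulVec_transpose]
    simp [dotProduct]
  simp_rw [h1]
  rw [integral_fintype_prod_eq_prod (E := fun _ : d => ℝ)
    (f := fun i x => Complex.exp ((((Kᵀ *ᵥ WithLp.ofLp t) i : ℝ) : ℂ) * (x : ℂ) * Complex.I))]
  simp_rw [← charFun_apply_real, charFun_gaussianReal]
  rw [← Complex.exp_sum]
  congr 1
  rw [← mulVec_mulVec, dotProduct_mulVec, ← mulVec_transpose]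
  simp only [dotProduct, Complex.ofReal_sum, Finset.sum_div, ← Finset.sum_neg_distrib]
  refine Finset.sum_congr rfl fun i _ => ?_
  push_cast
  ring

lemma map_ofLp_map_toLp {ι : Type*} [Fintype ι] (μ : Measure (ι → ℝ)) :
    (μ.map (WithLp.toLp 2 : _ → EuclideanSpace ℝ ι)).map WithLp.ofLp = μ := by
  rw [Measure.map_map (by fun_prop) (by fun_prop)]
  exact Measure.map_id

/-- The law of a linear image `M z` of a standard normal vector `z` depends on `M` only through
the covariance matrix `M M'`. -/
lemma stdNormal_map_mulVec_eq {ι a b : Type*} [Fintype ι] [Fintype a] [Fintype b]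
    (M : Matrix ι a ℝ) (N : Matrix ι b ℝ) (h : M * Mᵀ = N * Nᵀ) :
    (stdNormal a).map (fun z => M *ᵥ z) = (stdNormal b).map (fun z => N *ᵥ z) := by
  have := Measure.isProbabilityMeasure_map (μ := stdNormal a) (measurable_mulVec M).aemeasurable
  have := Measure.isProbabilityMeasure_map (μ := stdNormal b) (measurable_mulVec N).aemeasurable
  rw [← map_ofLp_map_toLp (Measure.map _ (stdNormal a)),
    ← map_ofLp_map_toLp (Measure.map _ (stdNormal b))]
  congr 1
  apply Measure.ext_of_charFun (E := EuclideanSpace ℝ ι)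
  ext t
  rw [charFun_stdNormal_map_mulVec, charFun_stdNormal_map_mulVec, h]

lemma multivariateGaussian_map_ofLp_eq {ι b : Type*} [Fintype ι] [DecidableEq ι] [Fintype b]
    (S : Matrix ι ι ℝ) (N : Matrix ι b ℝ) (h : S = N * Nᵀ) :
    (multivariateGaussian 0 S).map WithLp.ofLp = (stdNormal b).map (fun z => N *ᵥ z) := by
  classical
  have hS : S.PosSemidef := by
    rw [h]; simpa using posSemidef_self_mul_conjTranspose N
  have := Measure.isProbabilityMeasure_map (μ := stdNormal b) (measurable_mulVec N).aemeasurable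
  rw [← map_ofLp_map_toLp (Measure.map _ (stdNormal b))]
  congr 1
  apply Measure.ext_of_charFun (E := EuclideanSpace ℝ ι)
  ext t
  rw [charFun_multivariateGaussian hS, charFun_stdNormal_map_mulVec, h]
  simp [neg_div]

lemma stdNormal_eval_eq_zero {ι : Type*} [Fintype ι] (i : ι) {s : Set ℝ} (hs : s.Finite) :
    stdNormal ι {z | z i ∈ s} = 0 := by
  have h := (measurePreserving_eval (fun _ : ι => gaussianReal 0 1) i)
  have h0 : gaussianReal 0 1 s = 0 := by
    have : NullSingletonClass (gaussianReal 0 1) :=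
      nullSingletonClass_gaussianReal (by simp)
    exact hs.measure_zero _
  rw [← h.measure_preimage hs.measurableSet.nullMeasurableSet] at h0
  exact h0

/-- The density of the standard normal law with respect to Lebesgue measure. -/
def stdNormalPDF (ι : Type*) [Fintype ι] (z : ι → ℝ) : ℝ := ∏ i, gaussianPDFReal 0 1 (z i)

lemma continuous_stdNormalPDF (ι : Type*) [Fintype ι] : Continuous (stdNormalPDF ι) := by
  unfold stdNormalPDF gaussianPDFReal
  fun_prop

lemma stdNormalPDF_nonneg {ι : Type*} [Fintype ι] (z : ι → ℝ) : 0 ≤ stdNormalPDF ι z :=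
  Finset.prod_nonneg fun _ _ => gaussianPDFReal_nonneg _ _ _

lemma stdNormal_eq_withDensity (ι : Type*) [Fintype ι] :
    stdNormal ι = volume.withDensity fun z => ENNReal.ofReal (stdNormalPDF ι z) := by
  refine Measure.pi_eq fun s hs => ?_
  have hint : ∀ i, Integrable ((s i).indicator (gaussianPDFReal 0 1)) :=
    fun i => (integrable_gaussianPDFReal 0 1).indicator (hs i)
  have hnn : ∀ i x, 0 ≤ (s i).indicator (gaussianPDFReal 0 1) x := fun i x =>
    Set.indicator_nonneg (fun _ _ => gaussianPDFReal_nonneg _ _ _) _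
  have hind : ∀ z : ι → ℝ,
      (Set.univ.pi s).indicator (fun z => ENNReal.ofReal (stdNormalPDF ι z)) z =
      ENNReal.ofReal (∏ i, (s i).indicator (gaussianPDFReal 0 1) (z i)) := by
    intro z
    by_cases hz : z ∈ Set.univ.pi s
    · rw [Set.indicator_of_mem hz, stdNormalPDF]
      congr 1
      refine Finset.prod_congr rfl fun i _ => ?_
      rw [Set.indicator_of_mem (hz i trivial)]
    · rw [Set.indicator_of_notMem hz]
      simp only [Set.mem_pi, Set.mem_univ, true_implies, not_forall] at hz
      obtain ⟨i, hi⟩ := hz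
      rw [Finset.prod_eq_zero (Finset.mem_univ i) (Set.indicator_of_notMem hi _),
        ENNReal.ofReal_zero]
  rw [withDensity_apply _ (MeasurableSet.univ_pi hs),
    ← lintegral_indicator (MeasurableSet.univ_pi hs)]
  simp_rw [hind]
  rw [volume_pi, ← ofReal_integral_eq_lintegral_ofReal (Integrable.fintype_prod hint)
    (ae_of_all _ fun z => Finset.prod_nonneg fun i _ => hnn i _), integral_fintype_prod_eq_prod,
    ENNReal.ofReal_prod_of_nonneg fun i _ => integral_nonneg (hnn i)]
  refine Finset.prod_congr rfl fun i _ => ?_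
  rw [integral_indicator (hs i), gaussianReal_apply_eq_integral _ (by simp)]

lemma stdNormal_absolutelyContinuous (ι : Type*) [Fintype ι] : stdNormal ι ≪ volume := by
  rw [stdNormal_eq_withDensity]
  exact withDensity_absolutelyContinuous _ _

/-! ### Whitening the regressors one at a time -/

lemma sum_eq_sum_head {P : ℕ} {M : Type*} [AddCommMonoid M] (p : ℕ) (f : Fin P → M)
    (hf : ∀ a : Fin P, p ≤ (a : ℕ) → f a = 0) : ∑ a, f a = ∑ a : Head P p, f a := by
  classical
  rw [← Finset.sum_subtype (Finset.univ.filter fun a : Fin P => (a : ℕ) < p) (by simp) f,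
    Finset.sum_filter_of_ne]
  intro a _ ha
  by_contra h
  exact ha (hf a (not_lt.mp h))

lemma sum_head_add_sum_tail {P : ℕ} {M : Type*} [AddCommMonoid M] (p : ℕ) (f : Fin P → M) :
    ∑ a, f a = ∑ a : Head P p, f a + ∑ a : Tail P p, f a := by
  classical
  rw [← Finset.sum_subtype (Finset.univ.filter fun a : Fin P => (a : ℕ) < p) (by simp) f,
    ← Finset.sum_subtype (Finset.univ.filter fun a : Fin P => ¬ (a : ℕ) < p) (by simp) f,
    Finset.sum_filter_add_sum_filter_not]

/-- The upper triangular matrix `W` whose column for the `q`-th regressor is `S[q:q]⁻¹ e_q / ξ_q`,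
padded with zeros. It results from Gram-Schmidt orthonormalization of the standard basis with
respect to the inner product with matrix `S`. -/
def whitening {P : ℕ} (S : Matrix (Fin P) (Fin P) ℝ) : Matrix (Fin P) (Fin P) ℝ :=
  Matrix.of fun j i => if h : (j : ℕ) < i + 1 then
    ((leadBlock S (i + 1))⁻¹ *ᵥ lastBasisVec P (i + 1)) ⟨j, h⟩ / xi S (i + 1) else 0

section
variable {P : ℕ} {S : Matrix (Fin P) (Fin P) ℝ}

lemma posDef_leadBlock (hS : S.PosDef) (p : ℕ) : (leadBlock S p).PosDef :=
  hS.submatrix Subtype.val_injective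

lemma isUnit_det_leadBlock (hS : S.PosDef) (p : ℕ) : IsUnit (leadBlock S p).det :=
  (isUnit_iff_isUnit_det _).mp (posDef_leadBlock hS p).isUnit

lemma xi_arg_pos (hS : S.PosDef) (i : Fin P) :
    0 < lastBasisVec P (i + 1) ⬝ᵥ ((leadBlock S (i + 1))⁻¹ *ᵥ lastBasisVec P (i + 1)) := by
  have h := (posDef_leadBlock hS (i + 1)).inv.dotProduct_mulVec_pos
    (x := lastBasisVec P (i + 1)) ?_
  · simpa using h
  · intro h
    have := congrFun h ⟨i, Nat.lt_succ_self _⟩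
    simp [lastBasisVec] at this

lemma xi_pos (hS : S.PosDef) (i : Fin P) : 0 < xi S (i + 1) :=
  Real.sqrt_pos.mpr (xi_arg_pos hS i)

lemma dotProduct_lastBasisVec (i : Fin P) (v : Head P (i + 1) → ℝ) :
    lastBasisVec P (i + 1) ⬝ᵥ v = v ⟨i, Nat.lt_succ_self _⟩ := by
  rw [dotProduct, Finset.sum_eq_single ⟨i, Nat.lt_succ_self _⟩]
  · simp [lastBasisVec]
  · intro b _ hb
    have : (b.val : ℕ) ≠ i := fun h => hb (Subtype.ext (Fin.ext h))
    simp [lastBasisVec, this]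
  · simp

lemma whitening_of_lt {i j : Fin P} (h : i < j) : whitening S j i = 0 := by
  have : ¬ (j : ℕ) < i + 1 := by have := Fin.lt_def.mp h; omega
  rw [whitening, Matrix.of_apply, dif_neg this]

lemma headCols_whitening_mulVec_of_le (S : Matrix (Fin P) (Fin P) ℝ) (p : ℕ) (x : Head P p → ℝ)
    {j : Fin P} (hj : p ≤ (j : ℕ)) : (headCols (whitening S) p *ᵥ x) j = 0 := by
  rw [mulVec, dotProduct]
  refine Finset.sum_eq_zero fun a _ => ?_
  have : (a.val : Fin P) < j := Fin.lt_def.mpr (a.2.trans_le hj)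
  simp [headCols, whitening_of_lt this]

lemma whitening_diag (i : Fin P) : whitening S i i = xi S (i + 1) := by
  have h := dotProduct_lastBasisVec i ((leadBlock S (i + 1))⁻¹ *ᵥ lastBasisVec P (i + 1))
  have h2 : whitening S i i =
      ((leadBlock S (i + 1))⁻¹ *ᵥ lastBasisVec P (i + 1)) ⟨i, Nat.lt_succ_self _⟩ /
        xi S (i + 1) := by simp [whitening]
  rw [h2, ← h, xi, Real.div_sqrt]

lemma mul_whitening_apply_of_le (hS : S.PosDef) {j i : Fin P} (hji : j ≤ i) :
    (S * whitening S) j i = if j = i then (xi S (i + 1))⁻¹ else 0 := by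
  have hj : (j : ℕ) < i + 1 := Nat.lt_succ_of_le hji
  have h1 : (S * whitening S) j i =
      (leadBlock S (i + 1) *ᵥ ((leadBlock S (i + 1))⁻¹ *ᵥ lastBasisVec P (i + 1))) ⟨j, hj⟩ /
        xi S (i + 1) := by
    rw [mul_apply, sum_eq_sum_head (i + 1), mulVec, dotProduct, Finset.sum_div]
    · refine Finset.sum_congr rfl fun a _ => ?_
      rw [whitening, Matrix.of_apply, dif_pos a.2, mul_div_assoc]
      rfl
    · intro a ha
      rw [whitening_of_lt (Fin.lt_def.mpr ha), mul_zero]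
  rw [h1, mulVec_mulVec, mul_nonsing_inv _ (isUnit_det_leadBlock hS _), one_mulVec]
  by_cases h : j = i
  · simp [h, lastBasisVec]
  · have : (j : ℕ) ≠ i := fun h' => h (Fin.ext h')
    simp [h, this, lastBasisVec]

lemma whitening_transpose_mul_mul (hS : S.PosDef) :
    (whitening S)ᵀ * S * whitening S = 1 := by
  have key : ∀ i j : Fin P, i ≤ j → ((whitening S)ᵀ * S * whitening S) i j =
      (1 : Matrix (Fin P) (Fin P) ℝ) i j := by
    intro i j hij
    rw [Matrix.mul_assoc, mul_apply, Finset.sum_eq_single j]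
    · rw [mul_whitening_apply_of_le hS le_rfl, transpose_apply]
      rcases hij.eq_or_lt with rfl | h
      · rw [whitening_diag]
        simp [(xi_pos hS i).ne']
      · rw [whitening_of_lt h, zero_mul, one_apply_ne h.ne]
    · intro a _ haj
      rcases le_or_gt a i with h | h
      · rw [mul_whitening_apply_of_le hS (h.trans hij), if_neg haj, mul_zero]
      · rw [transpose_apply, whitening_of_lt h, zero_mul]
    · simp
  have hsymm : ((whitening S)ᵀ * S * whitening S)ᵀ = (whitening S)ᵀ * S * whitening S := by
    have hS' : Sᵀ = S := (isHermitian_iff_isSymm.mp hS.1)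
    simp [transpose_mul, hS', Matrix.mul_assoc]
  ext i j
  rcases le_total i j with h | h
  · exact key i j h
  · rw [← hsymm, transpose_apply, key j i h, one_apply, one_apply]
    simp [eq_comm]

lemma leadBlock_whitening_transpose_mul_mul (hS : S.PosDef) (p : ℕ) :
    (leadBlock (whitening S) p)ᵀ * leadBlock S p * leadBlock (whitening S) p = 1 := by
  ext i j
  have h := congrFun (congrFun (whitening_transpose_mul_mul hS) i.val) j.val
  have h1 : (1 : Matrix (Fin P) (Fin P) ℝ) i.val j.val = (1 : Matrix (Head P p) (Head P p) ℝ) i j := by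
    simp [one_apply, Subtype.ext_iff]
  rw [← h1, ← h, mul_apply, mul_apply, sum_eq_sum_head p]
  · refine Finset.sum_congr rfl fun a _ => ?_
    rw [mul_apply, mul_apply, sum_eq_sum_head p]
    · rfl
    · intro b hb
      rw [transpose_apply, whitening_of_lt (Fin.lt_def.mpr (i.2.trans_le hb)), zero_mul]
  · intro b hb
    rw [whitening_of_lt (Fin.lt_def.mpr (j.2.trans_le hb)), mul_zero]

/-- The Cholesky-type factorization `S[p:p]⁻¹ = W[p:p] W[p:p]'`, simultaneously for all `p`. -/
lemma leadBlock_inv_eq (hS : S.PosDef) (p : ℕ) :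
    (leadBlock S p)⁻¹ = leadBlock (whitening S) p * (leadBlock (whitening S) p)ᵀ := by
  have h := leadBlock_whitening_transpose_mul_mul hS p
  rw [Matrix.mul_assoc, mul_eq_one_comm, Matrix.mul_assoc] at h
  exact inv_eq_right_inv h

lemma isUnit_det_leadBlock_whitening (hS : S.PosDef) (p : ℕ) :
    IsUnit (leadBlock (whitening S) p).det := by
  have h := leadBlock_whitening_transpose_mul_mul hS p
  exact isUnit_det_of_left_inverse h

end

lemma continuousAt_matrix_inv_of_isUnit {ι : Type*} [Fintype ι] [DecidableEq ι]
    {M : Matrix ι ι ℝ} (h : IsUnit M.det) : ContinuousAt Inv.inv M := by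
  apply continuousAt_matrix_inv
  obtain ⟨u, hu⟩ := h
  rw [← hu]
  exact NormedRing.inverse_continuousAt u

section limits
variable {P : ℕ} {S : ℕ → Matrix (Fin P) (Fin P) ℝ} {Q : Matrix (Fin P) (Fin P) ℝ}

lemma tendsto_leadBlock (h : Tendsto S atTop (𝓝 Q)) (p : ℕ) :
    Tendsto (fun n => leadBlock (S n) p) atTop (𝓝 (leadBlock Q p)) := by
  have : Continuous fun M : Matrix (Fin P) (Fin P) ℝ => leadBlock M p :=
    continuous_id.matrix_submatrix _ _
  exact (this.tendsto Q).comp h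

lemma tendsto_leadBlock_inv (h : Tendsto S atTop (𝓝 Q)) (hQ : Q.PosDef) (p : ℕ) :
    Tendsto (fun n => (leadBlock (S n) p)⁻¹) atTop (𝓝 (leadBlock Q p)⁻¹) :=
  (continuousAt_matrix_inv_of_isUnit (isUnit_det_leadBlock hQ p)).tendsto.comp
    (tendsto_leadBlock h p)

lemma tendsto_mulVec {ι κ : Type*} [Fintype κ] {M : ℕ → Matrix ι κ ℝ} {N : Matrix ι κ ℝ}
    {v : ℕ → κ → ℝ} {w : κ → ℝ} (hM : Tendsto M atTop (𝓝 N)) (hv : Tendsto v atTop (𝓝 w)) :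
    Tendsto (fun n => M n *ᵥ v n) atTop (𝓝 (N *ᵥ w)) := by
  have : Continuous fun x : Matrix ι κ ℝ × (κ → ℝ) => x.1 *ᵥ x.2 :=
    continuous_fst.matrix_mulVec continuous_snd
  exact (this.tendsto (N, w)).comp (hM.prodMk_nhds hv)

lemma tendsto_xi (h : Tendsto S atTop (𝓝 Q)) (hQ : Q.PosDef) (p : ℕ) :
    Tendsto (fun n => xi (S n) p) atTop (𝓝 (xi Q p)) := by
  have h1 := tendsto_mulVec (tendsto_leadBlock_inv h hQ p)
    (tendsto_const_nhds (x := lastBasisVec P p))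
  have h2 : Continuous fun v : Head P p → ℝ => √(lastBasisVec P p ⬝ᵥ v) := by
    exact (continuous_const.dotProduct continuous_id).sqrt
  exact (h2.tendsto _).comp h1

lemma tendsto_whitening (h : Tendsto S atTop (𝓝 Q)) (hQ : Q.PosDef) :
    Tendsto (fun n => whitening (S n)) atTop (𝓝 (whitening Q)) := by
  refine tendsto_pi_nhds.mpr fun j => tendsto_pi_nhds.mpr fun i => ?_
  by_cases hji : (j : ℕ) < i + 1
  · have h1 := tendsto_mulVec (tendsto_leadBlock_inv h hQ (i + 1))
      (tendsto_const_nhds (x := lastBasisVec P (i + 1)))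
    simp only [whitening, hji, Matrix.of_apply, dif_pos]
    exact (tendsto_pi_nhds.mp h1 _).div (tendsto_xi h hQ _) (xi_pos hQ i).ne'
  · simp only [whitening, hji, Matrix.of_apply, dif_neg, not_false_eq_true]
    exact tendsto_const_nhds

lemma tendsto_delta (h : Tendsto S atTop (𝓝 Q)) (hQ : Q.PosDef) (p : ℕ)
    {ψn : ℕ → Fin P → ℝ} {ψ : Fin P → ℝ}
    (hψ : ∀ i : Fin P, p ≤ (i : ℕ) → Tendsto (fun n => ψn n i) atTop (𝓝 (ψ i))) :
    Tendsto (fun n => delta (S n) (ψn n) p) atTop (𝓝 (delta Q ψ p)) := by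
  refine tendsto_pi_nhds.mpr fun i => ?_
  by_cases hi : (i : ℕ) < p
  · have h1 : Tendsto (fun n => tailVec (ψn n) p) atTop (𝓝 (tailVec ψ p)) :=
      tendsto_pi_nhds.mpr fun j => hψ j.val j.2
    have h2 : Tendsto (fun n => offBlock (S n) p) atTop (𝓝 (offBlock Q p)) := by
      have : Continuous fun M : Matrix (Fin P) (Fin P) ℝ => offBlock M p :=
        continuous_id.matrix_submatrix _ _
      exact (this.tendsto Q).comp h
    have h3 := tendsto_mulVec (tendsto_leadBlock_inv h hQ p) (tendsto_mulVec h2 h1)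
    simp only [delta, hi, dif_pos]
    exact tendsto_pi_nhds.mp h3 _
  · simp only [delta, hi, dif_neg, not_false_eq_true]
    exact (hψ i (not_lt.mp hi)).neg

end limits

lemma posSemidef_gram {n P : ℕ} (X : Matrix (Fin n) (Fin P) ℝ) : (gram X).PosSemidef := by
  have h : (Xᵀ * X).PosSemidef := by simpa using posSemidef_conjTranspose_mul_self X
  exact h.smul (by positivity)

lemma posDef_gram {n P : ℕ} (hn : P < n) {X : Matrix (Fin n) (Fin P) ℝ} (hX : X.rank = P) :
    (gram X).PosDef := by
  rw [(posSemidef_gram X).posDef_iff_isUnit]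
  have hn' : (n : ℝ)⁻¹ ≠ 0 := by
    have : n ≠ 0 := by omega
    positivity
  have h1 : IsUnit (Xᵀ * X) := by
    rw [← mulVec_surjective_iff_isUnit]
    have h2 : (Xᵀ * X).rank = P := by rw [rank_transpose_mul_self, hX]
    have h3 := Submodule.eq_top_of_finrank_eq (S := (Xᵀ * X).mulVecLin.range)
      (by simpa [Matrix.rank] using h2)
    exact LinearMap.range_eq_top.mp h3
  have := h1.smul (Units.mk0 _ hn')
  exact this

lemma posDef_of_tendsto {P : ℕ} {S : ℕ → Matrix (Fin P) (Fin P) ℝ} {Q : Matrix (Fin P) (Fin P) ℝ}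
    (hS : ∀ n, (S n).PosSemidef) (h : Tendsto S atTop (𝓝 Q)) (hQ : IsUnit Q.det) : Q.PosDef := by
  have h1 : Q.PosSemidef := by
    refine PosSemidef.of_dotProduct_mulVec_nonneg ?_ fun x => ?_
    · have h2 : Tendsto (fun n => (S n)ᴴ) atTop (𝓝 Qᴴ) :=
        (continuous_id.matrix_conjTranspose.tendsto Q).comp h
      have h3 : (fun n => (S n)ᴴ) = S := funext fun n => (hS n).1
      rw [h3] at h2
      exact tendsto_nhds_unique h2 h
    · have h2 : Tendsto (fun n => star x ⬝ᵥ (S n *ᵥ x)) atTop (𝓝 (star x ⬝ᵥ (Q *ᵥ x))) := by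
        have : Continuous fun v : Fin P → ℝ => star x ⬝ᵥ v :=
          continuous_const.dotProduct continuous_id
        exact (this.tendsto _).comp (tendsto_mulVec h tendsto_const_nhds)
      exact ge_of_tendsto' h2 fun n => (hS n).dotProduct_mulVec_nonneg x
  exact h1.posDef_iff_isUnit.mpr ((isUnit_iff_isUnit_det _).mpr hQ)

/-! ### The estimators in terms of independent standard normal scores -/

/-- The first `p` coordinates of a vector. -/
def headVec {P : ℕ} (x : Fin P → ℝ) (p : ℕ) : Head P p → ℝ := fun i => x i.val

lemma coord_succ {P : ℕ} (x : Fin P → ℝ) (i : Fin P) : coord x (i + 1) = x i := by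
  have h : 1 ≤ (i : ℕ) + 1 ∧ (i : ℕ) + 1 ≤ P := ⟨by omega, i.2⟩
  simp [coord, h]

section
variable {n P : ℕ} (X : Matrix (Fin n) (Fin P) ℝ) (θ : Fin P → ℝ) (σ : ℝ)

/-- The vector of normalized, orthogonalized scores `W' X' (Y - Xθ) / (√n σ)`. Its coordinates are
independent standard normal, and its `q`-th coordinate is the centered statistic `T_q*`. -/
def scores (Y : Fin n → ℝ) : Fin P → ℝ :=
  (√(n : ℝ) * σ)⁻¹ • ((whitening (gram X))ᵀ *ᵥ (Xᵀ *ᵥ (Y - X *ᵥ θ)))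

/-- For `S = X'X / n` and `ψ = √n θ`, this is `σ` times the mean of `T_q*`, where `q = i + 1`. -/
def drift {P : ℕ} (S : Matrix (Fin P) (Fin P) ℝ) (ψ : Fin P → ℝ) (i : Fin P) : ℝ :=
  (delta S ψ (i + 1) i + ψ i) / xi S (i + 1)

lemma measurable_scores : Measurable (scores X θ σ) := by
  unfold scores
  have h1 := measurable_mulVec (whitening (gram X))ᵀ
  have h2 := measurable_mulVec Xᵀ
  have h3 : Measurable fun Y : Fin n → ℝ => Y - X *ᵥ θ := measurable_id.sub_const _
  exact (h1.comp (h2.comp h3)).const_smul (√(n : ℝ) * σ)⁻¹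

instance : IsProbabilityMeasure (dataLaw X θ σ) := by unfold dataLaw; infer_instance

lemma dataLaw_eq_map :
    dataLaw X θ σ = (stdNormal (Fin n)).map fun u => X *ᵥ θ + σ • u := by
  have h := Measure.pi_map_pi (μ := fun _ : Fin n => gaussianReal 0 1)
    (f := fun i x => (X *ᵥ θ) i + σ * x) (fun i => by fun_prop)
  rw [dataLaw]
  have h2 : (fun u : Fin n → ℝ => X *ᵥ θ + σ • u) = fun u i => (X *ᵥ θ) i + σ * u i := rfl
  rw [h2, h]
  congr 1
  funext i
  have h3 : (fun x : ℝ => (X *ᵥ θ) i + σ * x) = (fun x => (X *ᵥ θ) i + x) ∘ (fun x => σ * x) := rfl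
  rw [h3, ← Measure.map_map (by fun_prop) (by fun_prop), gaussianReal_map_const_mul,
    gaussianReal_map_const_add]
  simp only [mul_zero, zero_add, mul_one]
  congr 1
  ext
  simp [sq_nonneg]

variable {X σ}

lemma gram_eq (X : Matrix (Fin n) (Fin P) ℝ) (hn : 0 < n) : Xᵀ * X = (n : ℝ) • gram X := by
  have : (n : ℝ) ≠ 0 := by positivity
  rw [gram, smul_smul, mul_inv_cancel₀ this, one_smul]

/-- The scores are independent standard normal, as `W'SW = 1`. -/
lemma map_scores (hn : 0 < n) (hS : (gram X).PosDef) (hσ : 0 < σ) :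
    (dataLaw X θ σ).map (scores X θ σ) = stdNormal (Fin P) := by
  have hn' : (0 : ℝ) < n := by positivity
  rw [dataLaw_eq_map X θ σ, Measure.map_map (measurable_scores X θ σ) (by fun_prop)]
  have h1 : scores X θ σ ∘ (fun u => X *ᵥ θ + σ • u) =
      fun u => ((√(n : ℝ))⁻¹ • ((whitening (gram X))ᵀ * Xᵀ)) *ᵥ u := by
    funext u
    simp only [scores, Function.comp_apply, add_sub_cancel_left, mulVec_smul, smul_smul, smul_mulVec,
      mulVec_mulVec]
    congr 1
    field_simp
  rw [h1, stdNormal_map_mulVec_eq _ (1 : Matrix (Fin P) (Fin P) ℝ)]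
  · simp [Measure.map_id']
  · have h2 := whitening_transpose_mul_mul hS
    simp only [transpose_smul, transpose_mul, transpose_transpose, transpose_one, Matrix.mul_one,
      smul_mul, Matrix.mul_smul, smul_smul]
    have h3 : (whitening (gram X))ᵀ * Xᵀ * (X * whitening (gram X)) =
        (n : ℝ) • (1 : Matrix (Fin P) (Fin P) ℝ) := by
      rw [← h2, Matrix.mul_assoc, ← Matrix.mul_assoc Xᵀ, gram_eq X hn, smul_mul, Matrix.mul_smul,
        Matrix.mul_assoc]
    rw [h3, smul_smul, ← mul_inv, Real.mul_self_sqrt hn'.le, inv_mul_cancel₀ hn'.ne', one_smul]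

/-- The restricted least-squares estimator, centered at `θ`, is the sum of its bias, which has the
same form as `δ^{(p)}`, and of a linear function of the first `p` scores. -/
lemma sqrt_smul_restrictedLS_sub (hn : 0 < n) (hS : (gram X).PosDef) (hσ : 0 < σ) (p : ℕ)
    (Y : Fin n → ℝ) :
    √(n : ℝ) • (restrictedLS X p Y - θ) =
      σ • (headCols (whitening (gram X)) p *ᵥ headVec (scores X θ σ Y) p) +
        delta (gram X) (√(n : ℝ) • θ) p := by
  have hn' : (0 : ℝ) < n := by positivity
  have hsn : 0 < √(n : ℝ) := Real.sqrt_pos.mpr hn'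
  have hss : √(n : ℝ) * √(n : ℝ) = n := Real.mul_self_sqrt hn'.le
  funext j
  by_cases hj : (j : ℕ) < p
  swap
  -- outside the first `p` coordinates, both sides are `-√n θ_j`
  · have h0 : (headCols (whitening (gram X)) p *ᵥ headVec (scores X θ σ Y) p) j = 0 :=
      headCols_whitening_mulVec_of_le _ p _ (not_lt.mp hj)
    simp only [Pi.smul_apply, Pi.add_apply, h0, delta, hj, dif_neg,
      not_false_eq_true, Pi.sub_apply, restrictedLS, smul_eq_mul]
    ring
  set S := gram X with hSdef
  set B := headCols X p with hB
  set G := leadBlock (whitening S) p with hG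
  have hBB : Bᵀ * B = (n : ℝ) • leadBlock S p := by
    ext a b
    have := congrFun (congrFun (gram_eq X hn) a.val) b.val
    simpa [mul_apply, hB, headCols, leadBlock] using this
  have hinv : (Bᵀ * B)⁻¹ = (n : ℝ)⁻¹ • (leadBlock S p)⁻¹ := by
    apply inv_eq_right_inv
    rw [hBB, smul_mul, Matrix.mul_smul, smul_smul, mul_inv_cancel₀ hn'.ne', one_smul,
      mul_nonsing_inv _ (isUnit_det_leadBlock hS p)]
  set e := Y - X *ᵥ θ with he
  have hY : Y = X *ᵥ θ + e := by rw [he]; abel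
  have hBX : Bᵀ *ᵥ (X *ᵥ θ) = (n : ℝ) • (leadBlock S p *ᵥ headVec θ p +
      offBlock S p *ᵥ tailVec θ p) := by
    funext a
    have h1 : (Bᵀ *ᵥ (X *ᵥ θ)) a = ((Xᵀ * X) *ᵥ θ) a.val := by
      rw [← mulVec_mulVec]; rfl
    rw [h1, gram_eq X hn, smul_mulVec]
    simp only [Pi.smul_apply, Pi.add_apply]
    congr 1
    exact sum_head_add_sum_tail p _
  have hBe : Gᵀ *ᵥ (Bᵀ *ᵥ e) = (√(n : ℝ) * σ) • headVec (scores X θ σ Y) p := by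
    funext a
    have h1 : ((whitening S)ᵀ *ᵥ (Xᵀ *ᵥ e)) a.val = (Gᵀ *ᵥ (Bᵀ *ᵥ e)) a := by
      refine sum_eq_sum_head p _ fun b hb => ?_
      have : (a.val : Fin P) < b := Fin.lt_def.mpr (a.2.trans_le hb)
      simp [whitening_of_lt this]
    have h2 : √(n : ℝ) * σ ≠ 0 := by positivity
    simp only [Pi.smul_apply, headVec, scores, smul_eq_mul]
    rw [← hSdef, ← he, h1, mul_inv_cancel_left₀ h2]
  -- regression of `Y = X[p]θ[p] + X[¬p]θ[¬p] + e` on the first `p` regressors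
  have hr : (Bᵀ * B)⁻¹ *ᵥ (Bᵀ *ᵥ Y) = headVec θ p + (leadBlock S p)⁻¹ *ᵥ (offBlock S p *ᵥ tailVec θ p)
      + (√(n : ℝ))⁻¹ • σ • (G *ᵥ headVec (scores X θ σ Y) p) := by
    rw [hinv, hY, mulVec_add, hBX, ← hY, smul_mulVec, mulVec_add, mulVec_smul, mulVec_add,
      mulVec_mulVec, nonsing_inv_mul _ (isUnit_det_leadBlock hS p), one_mulVec, smul_add, smul_smul,
      inv_mul_cancel₀ hn'.ne', one_smul]
    congr 1
    rw [leadBlock_inv_eq hS, ← mulVec_mulVec, hBe, mulVec_smul, smul_smul, smul_smul]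
    congr 1
    field_simp
    rw [Real.sq_sqrt hn'.le]
  have h1 : restrictedLS X p Y j = ((Bᵀ * B)⁻¹ *ᵥ (Bᵀ *ᵥ Y)) ⟨j, hj⟩ := by
    simp [restrictedLS, hj, hB]
  have h2 : tailVec (√(n : ℝ) • θ) p = √(n : ℝ) • tailVec θ p := rfl
  have h3 : (headCols (whitening S) p *ᵥ headVec (scores X θ σ Y) p) j =
      (G *ᵥ headVec (scores X θ σ Y) p) ⟨j, hj⟩ := rfl
  simp only [Pi.smul_apply, Pi.add_apply, Pi.sub_apply, delta, hj, dif_pos, h1, hr, smul_eq_mul, h2,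
    mulVec_smul, h3, headVec]
  field_simp
  ring

/-- The test statistic of order `q` depends on the `q`-th score only, as `W` is triangular. -/
lemma tStat_succ (hn : 0 < n) (hS : (gram X).PosDef) (hσ : 0 < σ) (s : ℝ) (i : Fin P)
    (Y : Fin n → ℝ) :
    tStat X s (i + 1) Y =
      (σ * scores X θ σ Y i + drift (gram X) (√(n : ℝ) • θ) i) / s := by
  have h := congrFun (sqrt_smul_restrictedLS_sub θ hn hS hσ (i + 1) Y) i
  have h0 : (headCols (whitening (gram X)) (i + 1) *ᵥ headVec (scores X θ σ Y) (i + 1)) i =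
      xi (gram X) (i + 1) * scores X θ σ Y i := by
    rw [mulVec, dotProduct, Finset.sum_eq_single ⟨i, Nat.lt_succ_self _⟩]
    · simp [headCols, headVec, whitening_diag]
    · intro b _ hb
      have hb' : (b.val : ℕ) ≠ i := fun h => hb (Subtype.ext (Fin.ext h))
      have : b.val < i := Fin.lt_def.mpr (lt_of_le_of_ne (Nat.lt_succ_iff.mp b.2) hb')
      simp [headCols, whitening_of_lt this]
    · simp
  simp only [Pi.smul_apply, Pi.add_apply, Pi.sub_apply, smul_eq_mul, h0] at h
  have hxi := xi_pos hS i
  have h1 : √(n : ℝ) * restrictedLS X (i + 1) Y i =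
      σ * (xi (gram X) (i + 1) * scores X θ σ Y i) + (delta (gram X) (√(n : ℝ) • θ) (i + 1) i
        + √(n : ℝ) * θ i) := by linarith
  rw [tStat, coord_succ, h1, drift]
  simp only [Pi.smul_apply, smul_eq_mul]
  rw [mul_comm s, ← div_div]
  congr 1
  field_simp

end

/-! ### The selected order -/

section
variable {n P : ℕ} (X : Matrix (Fin n) (Fin P) ℝ) (c : ℕ → ℝ) (s : (Fin n → ℝ) → ℝ)

/-- As `c_𝒪 = 0`, the maximum in the definition of the selected order is over a nonempty set, and
orders below `𝒪` are never selected. -/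
lemma selected_eq_iff {O p : ℕ} (hcO : c O = 0) (hOp : O ≤ p) (hpP : p ≤ P) (Y : Fin n → ℝ) :
    selected X c s Y = p ↔ c p ≤ |tStat X (s Y) p Y| ∧
      ∀ q, p < q → q ≤ P → |tStat X (s Y) q Y| < c q := by
  set F := (Finset.range (P + 1)).filter fun p => c p ≤ |tStat X (s Y) p Y| with hF
  have hmem : ∀ q, q ∈ F ↔ q ≤ P ∧ c q ≤ |tStat X (s Y) q Y| := by
    intro q; simp [hF]
  have hO : O ∈ F := (hmem O).2 ⟨hOp.trans hpP, by rw [hcO]; positivity⟩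
  have hsel : selected X c s Y = F.sup id := rfl
  rw [hsel]
  constructor
  · intro h
    refine ⟨?_, fun q hq hqP => ?_⟩
    · obtain ⟨q, hq, hq2⟩ := Finset.exists_mem_eq_sup F ⟨O, hO⟩ id
      rw [h] at hq2
      rw [show p = q from hq2]
      exact ((hmem q).1 hq).2
    · by_contra hcon
      have : q ≤ F.sup id := Finset.le_sup (f := id) ((hmem q).2 ⟨hqP, not_lt.mp hcon⟩)
      omega
  · rintro ⟨h1, h2⟩
    apply le_antisymm
    · refine Finset.sup_le fun q hq => ?_
      by_contra hcon
      obtain ⟨hq1, hq2⟩ := (hmem q).1 hq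
      exact absurd (h2 q (not_le.mp hcon) hq1) (not_lt.mpr hq2)
    · exact Finset.le_sup (f := id) ((hmem p).2 ⟨hpP, h1⟩)

lemma continuous_restrictedLS (p : ℕ) : Continuous fun Y => restrictedLS X p Y := by
  refine continuous_pi fun i => ?_
  by_cases h : (i : ℕ) < p
  · simp only [restrictedLS, h, dif_pos]
    have h1 := (continuous_mulVec ((headCols X p)ᵀ * headCols X p)⁻¹).comp
      (continuous_mulVec (headCols X p)ᵀ)
    exact (continuous_apply (⟨i, h⟩ : Head P p)).comp h1
  · simp only [restrictedLS, h, dif_neg, not_false_eq_true]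
    exact continuous_const

lemma measurable_sigmaHat : Measurable (sigmaHat X) := by
  unfold sigmaHat
  have h : Continuous fun Y => Y - X *ᵥ restrictedLS X P Y :=
    continuous_id.sub ((continuous_mulVec X).comp (continuous_restrictedLS X P))
  exact (continuous_const.mul (h.dotProduct h)).sqrt.measurable

variable {s} in
lemma measurable_tStat (hs : Measurable s) (p : ℕ) : Measurable fun Y => tStat X (s Y) p Y := by
  have h : Measurable fun Y => coord (restrictedLS X p Y) p := by
    by_cases hp : 1 ≤ p ∧ p ≤ P
    · simp only [coord, hp, and_self, dif_pos]
      exact ((continuous_apply _).comp (continuous_restrictedLS X p)).measurable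
    · simp only [coord, hp, dif_neg, not_false_eq_true]
      exact measurable_const
  unfold tStat
  fun_prop

variable {s} in
lemma measurableSet_selected_eq (hs : Measurable s) {O p : ℕ} (hcO : c O = 0) (hOp : O ≤ p)
    (hpP : p ≤ P) : MeasurableSet {Y | selected X c s Y = p} := by
  have h : {Y | selected X c s Y = p} = {Y | c p ≤ |tStat X (s Y) p Y|} ∩
      ⋂ q, ⋂ (_ : p < q), ⋂ (_ : q ≤ P), {Y | |tStat X (s Y) q Y| < c q} := by
    ext Y
    simp [selected_eq_iff X c s hcO hOp hpP]
  rw [h]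
  refine MeasurableSet.inter (measurableSet_le measurable_const (measurable_tStat X hs p).norm) ?_
  refine MeasurableSet.iInter fun q => MeasurableSet.iInter fun _ => MeasurableSet.iInter fun _ => ?_
  exact measurableSet_lt (measurable_tStat X hs q).norm measurable_const

variable {s} in
/-- The weighted conditional law is the joint law of the estimator restricted to the event that
order `p` is selected. -/
lemma weightedCondLaw_eq {k : ℕ} (A : Matrix (Fin k) (Fin P) ℝ) (θ : Fin P → ℝ) (σ : ℝ)
    (hs : Measurable s) {O p : ℕ} (hcO : c O = 0) (hOp : O ≤ p) (hpP : p ≤ P) :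
    weightedCondLaw A X c θ σ s p =
      ((dataLaw X θ σ).restrict {Y | selected X c s Y = p}).map
        fun Y => √(n : ℝ) • (A *ᵥ (restrictedLS X p Y - θ)) := by
  set E := {Y | selected X c s Y = p} with hE
  have hEm : MeasurableSet E := measurableSet_selected_eq X c hs hcO hOp hpP
  rw [weightedCondLaw, ← hE]
  -- true also if the event has probability zero, where `cond` is the zero measure
  have h1 : (dataLaw X θ σ E) • ProbabilityTheory.cond (dataLaw X θ σ) E =
      (dataLaw X θ σ).restrict E := by
    rw [ProbabilityTheory.cond, smul_smul]
    by_cases h0 : dataLaw X θ σ E = 0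
    · rw [h0, zero_mul, zero_smul, Measure.restrict_eq_zero.mpr h0]
    · rw [ENNReal.mul_inv_cancel h0 (measure_ne_top _ _), one_smul]
  rw [← Measure.map_smul, h1]
  refine Measure.map_congr ?_
  filter_upwards [ae_restrict_mem hEm] with Y hY
  have : selected X c s Y = p := hY
  simp only [postEstimator, this]

end

/-! ### Consistency of the variance estimator -/

/-- Pythagoras: the residual sum of squares is that of the errors minus that of their projection on
the span of the regressors. -/
lemma residual_dotProduct_self {n P : ℕ} {X : Matrix (Fin n) (Fin P) ℝ} (θ : Fin P → ℝ) {σ : ℝ}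
    (hn : 0 < n) (hS : (gram X).PosDef) (hσ : 0 < σ) (Y : Fin n → ℝ) :
    (Y - X *ᵥ restrictedLS X P Y) ⬝ᵥ (Y - X *ᵥ restrictedLS X P Y) =
      (Y - X *ᵥ θ) ⬝ᵥ (Y - X *ᵥ θ) - σ ^ 2 * (scores X θ σ Y ⬝ᵥ scores X θ σ Y) := by
  have hn' : (0 : ℝ) < n := by positivity
  have hsn : 0 < √(n : ℝ) := Real.sqrt_pos.mpr hn'
  set W := whitening (gram X) with hW
  set z := scores X θ σ Y with hz
  set e := Y - X *ᵥ θ with he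
  have h1 := sqrt_smul_restrictedLS_sub θ hn hS hσ P Y
  have h2 : headCols W P *ᵥ headVec z P = W *ᵥ z := by
    funext j
    exact (sum_eq_sum_head P (fun a => W j a * z a) fun a ha => absurd a.2 (not_lt.mpr ha)).symm
  have h3 : delta (gram X) (√(n : ℝ) • θ) P = 0 := by
    funext j
    have : IsEmpty (Tail P P) := ⟨fun i => absurd i.val.2 (not_lt.mpr i.2)⟩
    have h4 : offBlock (gram X) P *ᵥ tailVec (√(n : ℝ) • θ) P = 0 := by
      funext a; simp [mulVec, dotProduct]
    simp [delta, h4]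
  rw [← hW, ← hz, h2, h3, add_zero] at h1
  have h4 : restrictedLS X P Y = θ + (σ / √(n : ℝ)) • (W *ᵥ z) := by
    rw [div_eq_inv_mul, mul_smul, ← h1, smul_smul, inv_mul_cancel₀ hsn.ne', one_smul]
    abel
  have h5 : Y - X *ᵥ restrictedLS X P Y = e - (σ / √(n : ℝ)) • (X *ᵥ (W *ᵥ z)) := by
    rw [h4, mulVec_add, mulVec_smul, he]; abel
  have h6 : Wᵀ *ᵥ (Xᵀ *ᵥ e) = (√(n : ℝ) * σ) • z := by
    rw [hz, scores, smul_smul, mul_inv_cancel₀ (by positivity), one_smul]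
  have h7 : e ⬝ᵥ (X *ᵥ (W *ᵥ z)) = √(n : ℝ) * σ * (z ⬝ᵥ z) := by
    rw [dotProduct_mulVec, dotProduct_mulVec, ← mulVec_transpose, ← mulVec_transpose, h6,
      smul_dotProduct, smul_eq_mul]
  have h8 : (X *ᵥ (W *ᵥ z)) ⬝ᵥ (X *ᵥ (W *ᵥ z)) = n * (z ⬝ᵥ z) := by
    have h9 : Wᵀ *ᵥ (Xᵀ *ᵥ (X *ᵥ (W *ᵥ z))) = (n : ℝ) • z := by
      rw [mulVec_mulVec, mulVec_mulVec, mulVec_mulVec]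
      have : Wᵀ * Xᵀ * X * W = (n : ℝ) • (Wᵀ * gram X * W) := by
        rw [Matrix.mul_assoc Wᵀ, gram_eq X hn, Matrix.mul_smul, smul_mul]
      rw [this, whitening_transpose_mul_mul hS, smul_mulVec, one_mulVec]
    rw [dotProduct_mulVec, dotProduct_mulVec, ← mulVec_transpose, ← mulVec_transpose, h9,
      smul_dotProduct, smul_eq_mul]
  clear_value e
  rw [h5, sub_dotProduct, dotProduct_sub, dotProduct_sub, smul_dotProduct, smul_dotProduct,
    dotProduct_smul, dotProduct_smul, dotProduct_comm (X *ᵥ (W *ᵥ z)) e, h7, h8]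
  simp only [smul_eq_mul]
  have hss : √(n : ℝ) ^ 2 = n := Real.sq_sqrt hn'.le
  field_simp
  rw [hss]
  ring

/-- The variance of the square of a standard normal variable. -/
def varSq : ℝ := Var[fun x : ℝ => x ^ 2; gaussianReal 0 1]

lemma varSq_nonneg : 0 ≤ varSq := variance_nonneg _ _

lemma memLp_sq_gaussianReal : MemLp (fun x : ℝ => x ^ 2) 2 (gaussianReal 0 1) := by
  have h := (memLp_id_gaussianReal (μ := 0) (v := 1) 4)
  have h2 := h.norm_rpow_div (2 : ENNReal)
  have h3 : (4 : ENNReal) / 2 = 2 := by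
    rw [show (4 : ENNReal) = 2 * 2 by norm_num]
    exact ENNReal.mul_div_cancel_right (by simp) (by simp)
  simpa [h3] using h2

lemma integral_sq_gaussianReal : ∫ x : ℝ, x ^ 2 ∂(gaussianReal 0 1) = 1 := by
  have h := variance_eq_integral (μ := gaussianReal 0 1) (X := id) measurable_id.aemeasurable
  rw [variance_id_gaussianReal] at h
  simpa using h.symm

section
variable {ι : Type*} [Fintype ι]

lemma memLp_eval_sq (i : ι) : MemLp (fun u : ι → ℝ => u i ^ 2) 2 (stdNormal ι) :=
  memLp_sq_gaussianReal.comp_measurePreserving (measurePreserving_eval (fun _ => gaussianReal 0 1) i)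

lemma integrable_dotProduct_self : Integrable (fun u : ι → ℝ => u ⬝ᵥ u) (stdNormal ι) := by
  simp only [dotProduct, ← sq]
  exact integrable_finsetSum _ fun i _ => (memLp_eval_sq i).integrable (by norm_num)

lemma integral_dotProduct_self : ∫ u, u ⬝ᵥ u ∂(stdNormal ι) = Fintype.card ι := by
  simp only [dotProduct, ← sq]
  rw [integral_finsetSum _ fun i _ => (memLp_eval_sq i).integrable (by norm_num)]
  have h : ∀ i : ι, ∫ u : ι → ℝ, u i ^ 2 ∂(stdNormal ι) = 1 := fun i => by
    rw [← integral_sq_gaussianReal]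
    have := integral_comp_eval (μ := fun _ : ι => gaussianReal 0 1) (i := i)
      (f := fun x : ℝ => x ^ 2) (by fun_prop)
    exact this
  simp [h]

/-- The mean absolute deviation of a `χ²` variable with `N` degrees of freedom is `O(√N)`. -/
lemma integral_abs_dotProduct_self_sub_le :
    ∫ u, |u ⬝ᵥ u - Fintype.card ι| ∂(stdNormal ι) ≤ √(Fintype.card ι) * (varSq + 1) / 2 := by
  rcases isEmpty_or_nonempty ι with hι | hι
  · simp
  set N : ℝ := (Fintype.card ι : ℝ) with hN
  have hN0 : 0 < N := by positivity
  have hs : 0 < √N := Real.sqrt_pos.mpr hN0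
  have hmem : MemLp (fun u : ι → ℝ => u ⬝ᵥ u) 2 (stdNormal ι) := by
    simp only [dotProduct, ← sq]
    exact memLp_finsetSum _ fun i _ => memLp_eval_sq i
  have hvar : ∫ u, (u ⬝ᵥ u - N) ^ 2 ∂(stdNormal ι) = N * varSq := by
    have h1 := variance_eq_integral (μ := stdNormal ι) hmem.aestronglyMeasurable.aemeasurable
    rw [integral_dotProduct_self] at h1
    rw [← h1]
    have h2 := variance_sum_pi (μ := fun _ : ι => gaussianReal 0 1)
      (X := fun _ x => x ^ 2) fun _ => memLp_sq_gaussianReal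
    have h3 : (∑ i, fun u : ι → ℝ => u i ^ 2) = fun u => u ⬝ᵥ u := by
      funext u; simp [dotProduct, sq]
    rw [h3] at h2
    rw [h2]
    simp [hN, varSq]
  have hint2 : Integrable (fun u : ι → ℝ => (u ⬝ᵥ u - N) ^ 2) (stdNormal ι) :=
    (hmem.sub (memLp_const N)).integrable_sq
  -- `|x| ≤ (x² / √N + √N) / 2`
  calc ∫ u, |u ⬝ᵥ u - N| ∂(stdNormal ι)
      ≤ ∫ u, ((u ⬝ᵥ u - N) ^ 2 / √N + √N) / 2 ∂(stdNormal ι) := by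
        refine integral_mono (integrable_dotProduct_self.sub (integrable_const _)).abs
          (((hint2.div_const _).add (integrable_const _)).div_const _) fun u => ?_
        simp only
        set x := u ⬝ᵥ u - N
        have h : 0 ≤ (|x| - √N) ^ 2 := sq_nonneg _
        rw [le_div_iff₀ (by norm_num), div_add' _ _ _ hs.ne', le_div_iff₀ hs]
        nlinarith [sq_abs x]
    _ = √N * (varSq + 1) / 2 := by
        rw [integral_div, integral_add (hint2.div_const _) (integrable_const _), integral_div, hvar]
        simp only [integral_const, probReal_univ, smul_eq_mul, one_mul]
        have : N / √N = √N := Real.div_sqrt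
        rw [mul_div_right_comm, this]
        ring

end

section
variable {n P : ℕ} {X : Matrix (Fin n) (Fin P) ℝ} (θ : Fin P → ℝ) {σ : ℝ}

lemma abs_sigmaHat_sq_sub_le (hn : P < n) (hS : (gram X).PosDef) (hσ : 0 < σ) (Y : Fin n → ℝ) :
    |sigmaHat X Y ^ 2 - σ ^ 2| ≤ ((n : ℝ) - P)⁻¹ * (|(Y - X *ᵥ θ) ⬝ᵥ (Y - X *ᵥ θ) - σ ^ 2 * n| +
      σ ^ 2 * (scores X θ σ Y ⬝ᵥ scores X θ σ Y) + σ ^ 2 * P) := by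
  have hnP : (0 : ℝ) < (n : ℝ) - P := by
    have : (P : ℝ) < n := by exact_mod_cast hn
    linarith
  have hz : 0 ≤ scores X θ σ Y ⬝ᵥ scores X θ σ Y := by
    simpa using dotProduct_star_self_nonneg (scores X θ σ Y)
  have hr : 0 ≤ (Y - X *ᵥ restrictedLS X P Y) ⬝ᵥ (Y - X *ᵥ restrictedLS X P Y) := by
    simpa using dotProduct_star_self_nonneg (Y - X *ᵥ restrictedLS X P Y)
  rw [sigmaHat, Real.sq_sqrt (by positivity), residual_dotProduct_self θ (by omega) hS hσ]
  set a := (Y - X *ᵥ θ) ⬝ᵥ (Y - X *ᵥ θ)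
  set b := scores X θ σ Y ⬝ᵥ scores X θ σ Y
  have h1 : ((n : ℝ) - P)⁻¹ * (a - σ ^ 2 * b) - σ ^ 2 =
      ((n : ℝ) - P)⁻¹ * ((a - σ ^ 2 * n) - σ ^ 2 * b + σ ^ 2 * P) := by
    field_simp
    ring
  rw [h1, abs_mul, abs_of_pos (inv_pos.mpr hnP)]
  refine mul_le_mul_of_nonneg_left ?_ (inv_pos.mpr hnP).le
  have h2 : |σ ^ 2 * b| = σ ^ 2 * b := abs_of_nonneg (by positivity)
  have h3 : |σ ^ 2 * P| = σ ^ 2 * P := abs_of_nonneg (by positivity)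
  calc _ ≤ |a - σ ^ 2 * n - σ ^ 2 * b| + |σ ^ 2 * (P : ℝ)| := abs_add_le _ _
    _ ≤ |a - σ ^ 2 * n| + |σ ^ 2 * b| + |σ ^ 2 * (P : ℝ)| := by gcongr; exact abs_sub _ _
    _ = _ := by rw [h2, h3]

/-- Markov's inequality for the deviation of the variance estimator. -/
lemma measureReal_sigmaHat_sq_deviation_le (hn : 2 * P < n) (hS : (gram X).PosDef) (hσ : 0 < σ)
    {η : ℝ} (hη : 0 < η) :
    (dataLaw X θ σ).real {Y | η ≤ |sigmaHat X Y ^ 2 - σ ^ 2|} ≤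
      σ ^ 2 * (varSq + 1 + 4 * P) / √(n : ℝ) / η := by
  have hn0 : 0 < n := by omega
  have hn' : (0 : ℝ) < n := by exact_mod_cast hn0
  have hs : 0 < √(n : ℝ) := Real.sqrt_pos.mpr hn'
  have hs1 : 1 ≤ √(n : ℝ) := by
    rw [Real.one_le_sqrt]; exact_mod_cast hn0
  have h2n : (2 : ℝ) * P < n := by exact_mod_cast hn
  have hnP : (n : ℝ) / 2 ≤ (n : ℝ) - P := by linarith
  have hnP' : (0 : ℝ) < (n : ℝ) - P := by linarith
  have hms := measurable_scores X θ σ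
  set f : (Fin n → ℝ) → ℝ := fun Y => |(Y - X *ᵥ θ) ⬝ᵥ (Y - X *ᵥ θ) - σ ^ 2 * n| with hf
  set g : (Fin n → ℝ) → ℝ := fun Y => scores X θ σ Y ⬝ᵥ scores X θ σ Y with hg
  have hfu : ∀ u : Fin n → ℝ, f (X *ᵥ θ + σ • u) = σ ^ 2 * |u ⬝ᵥ u - (n : ℝ)| := by
    intro u
    simp only [hf, add_sub_cancel_left, smul_dotProduct, dotProduct_smul, smul_eq_mul]
    rw [← abs_of_nonneg (sq_nonneg σ), ← abs_mul, abs_of_nonneg (sq_nonneg σ)]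
    congr 1
    ring
  have hfc : Continuous f := by
    have h : Continuous fun Y : Fin n → ℝ => Y - X *ᵥ θ := continuous_id.sub continuous_const
    exact ((h.dotProduct h).sub continuous_const).abs
  have hmap : Measurable fun u : Fin n → ℝ => X *ᵥ θ + σ • u := by fun_prop
  have hfi : Integrable f (dataLaw X θ σ) := by
    rw [dataLaw_eq_map, integrable_map_measure hfc.aestronglyMeasurable hmap.aemeasurable]
    have : f ∘ (fun u : Fin n → ℝ => X *ᵥ θ + σ • u) = fun u => σ ^ 2 * |u ⬝ᵥ u - (n : ℝ)| :=
      funext hfu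
    rw [this]
    exact (integrable_dotProduct_self.sub (integrable_const _)).abs.const_mul _
  have hfI : ∫ Y, f Y ∂(dataLaw X θ σ) ≤ σ ^ 2 * (√(n : ℝ) * (varSq + 1) / 2) := by
    rw [dataLaw_eq_map, integral_map hmap.aemeasurable hfc.aestronglyMeasurable]
    simp_rw [hfu]
    rw [integral_const_mul]
    have h := integral_abs_dotProduct_self_sub_le (ι := Fin n)
    rw [Fintype.card_fin] at h
    gcongr
  have hzc : AEStronglyMeasurable (fun z : Fin P → ℝ => z ⬝ᵥ z)
      ((dataLaw X θ σ).map (scores X θ σ)) :=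
    (continuous_id.dotProduct continuous_id).aestronglyMeasurable
  have hgi : Integrable g (dataLaw X θ σ) := by
    have h := integrable_dotProduct_self (ι := Fin P)
    rw [← map_scores θ hn0 hS hσ, integrable_map_measure hzc hms.aemeasurable] at h
    exact h
  have hgI : ∫ Y, g Y ∂(dataLaw X θ σ) = P := by
    have h := integral_dotProduct_self (ι := Fin P)
    rw [← map_scores θ hn0 hS hσ, integral_map hms.aemeasurable hzc, Fintype.card_fin] at h
    exact h
  set D : (Fin n → ℝ) → ℝ := fun Y => ((n : ℝ) - P)⁻¹ * (f Y + σ ^ 2 * g Y + σ ^ 2 * P) with hD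
  have hDi : Integrable D (dataLaw X θ σ) :=
    ((hfi.add (hgi.const_mul _)).add (integrable_const _)).const_mul _
  have hg0 : ∀ Y, 0 ≤ g Y := fun Y => by
    simpa using dotProduct_star_self_nonneg (scores X θ σ Y)
  have hD0 : ∀ Y, 0 ≤ D Y := fun Y => by
    have := hg0 Y
    have : 0 ≤ f Y := abs_nonneg _
    positivity
  have hDI : ∫ Y, D Y ∂(dataLaw X θ σ) ≤ σ ^ 2 * (varSq + 1 + 4 * P) / √(n : ℝ) := by
    have hv := varSq_nonneg
    have h1 : ∫ Y, D Y ∂(dataLaw X θ σ) =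
        ((n : ℝ) - P)⁻¹ * (∫ Y, f Y ∂(dataLaw X θ σ) + σ ^ 2 * P + σ ^ 2 * P) := by
      have h2 : Integrable (fun Y => σ ^ 2 * g Y) (dataLaw X θ σ) := hgi.const_mul _
      have h3 : Integrable (fun Y => f Y + σ ^ 2 * g Y) (dataLaw X θ σ) := hfi.add h2
      rw [hD, integral_const_mul, integral_add h3 (integrable_const _),
        integral_add hfi h2, integral_const_mul, hgI]
      simp
    calc ∫ Y, D Y ∂(dataLaw X θ σ)
        ≤ ((n : ℝ) / 2)⁻¹ * (σ ^ 2 * (√(n : ℝ) * (varSq + 1) / 2) + σ ^ 2 * (P * √(n : ℝ)) +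
            σ ^ 2 * (P * √(n : ℝ))) := by
          rw [h1]
          have h0 : 0 ≤ ∫ Y, f Y ∂(dataLaw X θ σ) := integral_nonneg fun Y => abs_nonneg _
          have hP : (P : ℝ) ≤ P * √(n : ℝ) := le_mul_of_one_le_right (by positivity) hs1
          gcongr
      _ = σ ^ 2 * (varSq + 1 + 4 * P) / √(n : ℝ) := by
          have hss : √(n : ℝ) ^ 2 = n := Real.sq_sqrt hn'.le
          rw [eq_div_iff hs.ne']
          field_simp
          rw [hss]
          ring
  have hmark := mul_meas_ge_le_integral_of_nonneg (ae_of_all _ hD0) hDi η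
  rw [le_div_iff₀ hη, mul_comm]
  refine le_trans (mul_le_mul_of_nonneg_left ?_ hη.le) (hmark.trans hDI)
  refine measureReal_mono (fun Y hY => ?_) (measure_ne_top _ _)
  exact le_trans (show η ≤ |sigmaHat X Y ^ 2 - σ ^ 2| from hY)
    (abs_sigmaHat_sq_sub_le θ (by omega) hS hσ Y)

end

/-- Consistency of `σ̂`: there is a deterministic null sequence that the deviation of `σ̂` from the
limit of the scales exceeds with vanishing probability. -/
lemma exists_sigmaHat_deviation {P : ℕ} (X : ∀ n : ℕ, Matrix (Fin n) (Fin P) ℝ)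
    (hS : ∀ n, P < n → (gram (X n)).PosDef) (θ : ℕ → Fin P → ℝ) (σ : ℕ → ℝ)
    (hσ : ∀ n, P < n → 0 < σ n) {σlim : ℝ} (hσlim : 0 < σlim) (hσt : Tendsto σ atTop (𝓝 σlim)) :
    ∃ δ : ℕ → ℝ, Tendsto δ atTop (𝓝 0) ∧ Tendsto (fun n =>
      (dataLaw (X n) (θ n) (σ n)).real {Y | δ n < |sigmaHat (X n) Y - σlim|}) atTop (𝓝 0) := by
  set d : ℕ → ℝ := fun n => σ n ^ 2 * (varSq + 1 + 4 * P) / √(n : ℝ) with hd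
  have hdt : Tendsto d atTop (𝓝 0) := by
    have h1 : Tendsto (fun n : ℕ => √(n : ℝ)) atTop atTop :=
      Real.tendsto_sqrt_atTop.comp tendsto_natCast_atTop_atTop
    exact ((hσt.pow 2).mul_const _).div_atTop h1
  have hsd : Tendsto (fun n => √(d n)) atTop (𝓝 0) := by
    simpa using hdt.sqrt
  -- Markov's bound with threshold `√d` for `|σ̂² - σ²|`; division by `σ` passes to `|σ̂ - σ|`
  refine ⟨fun n => √(d n) / σ n + |σ n - σlim|, ?_, ?_⟩
  · have h1 := (hsd.div hσt hσlim.ne').add (hσt.sub_const σlim).abs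
    simpa using h1
  · refine squeeze_zero' (Eventually.of_forall fun n => measureReal_nonneg) ?_ hsd
    filter_upwards [eventually_gt_atTop (2 * P)] with n hn
    have hPn : P < n := by omega
    have hσn := hσ n hPn
    have hn' : (0 : ℝ) < n := by
      have : 0 < n := by omega
      exact_mod_cast this
    have hv := varSq_nonneg
    have hdpos : 0 < d n := by
      have := Real.sqrt_pos.mpr hn'
      positivity
    have hsp := Real.sqrt_pos.mpr hdpos
    have h1 := measureReal_sigmaHat_sq_deviation_le (θ n) hn (hS n hPn) hσn hsp
    have h2 : σ n ^ 2 * (varSq + 1 + 4 * P) / √(n : ℝ) / √(d n) = √(d n) := Real.div_sqrt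
    rw [h2] at h1
    refine le_trans ?_ h1
    refine measureReal_mono (fun Y hY => ?_) (measure_ne_top _ _)
    have hY' : √(d n) / σ n + |σ n - σlim| < |sigmaHat (X n) Y - σlim| := hY
    have h0 : 0 ≤ sigmaHat (X n) Y := Real.sqrt_nonneg _
    have h3 : |sigmaHat (X n) Y - σlim| ≤ |sigmaHat (X n) Y - σ n| + |σ n - σlim| :=
      abs_sub_le _ _ _
    have h4 : √(d n) / σ n < |sigmaHat (X n) Y - σ n| := by linarith
    rw [div_lt_iff₀ hσn] at h4
    -- `|σ̂² - σ²| = |σ̂ - σ| (σ̂ + σ) ≥ |σ̂ - σ| σ`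
    have h5 : |sigmaHat (X n) Y ^ 2 - σ n ^ 2| =
        |sigmaHat (X n) Y - σ n| * (sigmaHat (X n) Y + σ n) := by
      have h6 : |sigmaHat (X n) Y + σ n| = sigmaHat (X n) Y + σ n :=
        abs_of_nonneg (add_nonneg h0 hσn.le)
      rw [← h6, ← abs_mul]
      congr 1
      ring
    show √(d n) ≤ |sigmaHat (X n) Y ^ 2 - σ n ^ 2|
    rw [h5]
    refine h4.le.trans ?_
    gcongr
    linarith

/-! ### The selection event in terms of the scores -/

/-- The event, in terms of the scores `z`, that order `p` is selected, when the tests of the orders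
above `p` use the scale `s` and the test of order `p` uses the scale `t`. It increases with `s` and
decreases with `t`. -/
def selRegion {P : ℕ} (c : ℕ → ℝ) (p : ℕ) (σ : ℝ) (β : Fin P → ℝ) (s t : ℝ) : Set (Fin P → ℝ) :=
  {z | (∀ i : Fin P, p ≤ (i : ℕ) → |σ * z i + β i| < c (i + 1) * s) ∧
    ∀ i : Fin P, (i : ℕ) + 1 = p → c p * t ≤ |σ * z i + β i|}

lemma measurableSet_selRegion {P : ℕ} (c : ℕ → ℝ) (p : ℕ) (σ : ℝ) (β : Fin P → ℝ) (s t : ℝ) :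
    MeasurableSet (selRegion c p σ β s t) := by
  have h : ∀ i : Fin P, Measurable fun z : Fin P → ℝ => |σ * z i + β i| := fun i => by
    have : Continuous fun z : Fin P → ℝ => |σ * z i + β i| := by fun_prop
    exact this.measurable
  have h2 : selRegion c p σ β s t =
      (⋂ i : Fin P, ⋂ (_ : p ≤ (i : ℕ)), {z | |σ * z i + β i| < c (i + 1) * s}) ∩
      ⋂ i : Fin P, ⋂ (_ : (i : ℕ) + 1 = p), {z | c p * t ≤ |σ * z i + β i|} := by
    ext z; simp [selRegion]
  rw [h2]
  exact (MeasurableSet.iInter fun i => MeasurableSet.iInter fun _ =>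
      measurableSet_lt (h i) measurable_const).inter
    (MeasurableSet.iInter fun i => MeasurableSet.iInter fun _ =>
      measurableSet_le measurable_const (h i))

lemma selRegion_mono {P : ℕ} {c : ℕ → ℝ} {p : ℕ} {σ : ℝ} {β : Fin P → ℝ} {s s' t t' : ℝ}
    (hc : ∀ q, p ≤ q → q ≤ P → 0 ≤ c q) (hs : s ≤ s') (ht : t' ≤ t) :
    selRegion c p σ β s t ⊆ selRegion c p σ β s' t' := by
  intro z hz
  refine ⟨fun i hi => (hz.1 i hi).trans_le ?_, fun i hi => le_trans ?_ (hz.2 i hi)⟩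
  · exact mul_le_mul_of_nonneg_left hs (hc _ (by omega) i.2)
  · exact mul_le_mul_of_nonneg_left ht (hc _ le_rfl (by omega))

lemma selected_eq_iff_scores_mem {n P : ℕ} {X : Matrix (Fin n) (Fin P) ℝ} (c : ℕ → ℝ)
    (s : (Fin n → ℝ) → ℝ) (θ : Fin P → ℝ) {σ : ℝ} (hn : 0 < n) (hS : (gram X).PosDef) (hσ : 0 < σ)
    {O p : ℕ} (hcO : c O = 0) (hOp : O ≤ p) (hpP : p ≤ P) {Y : Fin n → ℝ} (hs : 0 < s Y) :
    selected X c s Y = p ↔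
      scores X θ σ Y ∈ selRegion c p σ (drift (gram X) (√(n : ℝ) • θ)) (s Y) (s Y) := by
  have habs : ∀ i : Fin P, |tStat X (s Y) (i + 1) Y| =
      |σ * scores X θ σ Y i + drift (gram X) (√(n : ℝ) • θ) i| / s Y := fun i => by
    rw [tStat_succ θ hn hS hσ, abs_div, abs_of_pos hs]
  rw [selected_eq_iff X c s hcO hOp hpP, and_comm]
  refine and_congr ⟨fun h i hi => ?_, fun h q hq hqP => ?_⟩ ⟨fun h i hi => ?_, fun h => ?_⟩
  · have := h (i + 1) (by omega) i.2
    rwa [habs, div_lt_iff₀ hs] at this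
  · have := h ⟨q - 1, by omega⟩ (by simp only; omega)
    rw [← div_lt_iff₀ hs, ← habs] at this
    simp only [Nat.sub_add_cancel (show 1 ≤ q by omega)] at this
    exact this
  · subst hi
    rwa [habs, le_div_iff₀ hs] at h
  · rcases Nat.eq_zero_or_pos p with h0 | h0
    -- for `p = 0` the region has no condition on order `p`, and `c_p = c_𝒪 = 0`
    · have : O = p := by omega
      rw [← this, hcO]
      positivity
    · have := h ⟨p - 1, by omega⟩ (by simp only; omega)
      rw [← le_div_iff₀ hs, ← habs] at this
      simp only [Nat.sub_add_cancel (show 1 ≤ p by omega)] at this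
      exact this

/-- `√n A (θ̃(p) - θ)` as a function of the scores `z`, if `S = X'X / n` and `ψ = √n θ`. -/
def estMap {P k : ℕ} (A : Matrix (Fin k) (Fin P) ℝ) (S : Matrix (Fin P) (Fin P) ℝ) (σ : ℝ)
    (ψ : Fin P → ℝ) (p : ℕ) (z : Fin P → ℝ) : Fin k → ℝ :=
  A *ᵥ (σ • (headCols (whitening S) p *ᵥ headVec z p) + delta S ψ p)

lemma continuous_estMap {P k : ℕ} (A : Matrix (Fin k) (Fin P) ℝ) (S : Matrix (Fin P) (Fin P) ℝ)
    (σ : ℝ) (ψ : Fin P → ℝ) (p : ℕ) : Continuous (estMap A S σ ψ p) := by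
  have h : Continuous fun z : Fin P → ℝ => headVec z p :=
    continuous_pi fun i => continuous_apply i.val
  have h2 := ((continuous_mulVec (headCols (whitening S) p)).comp h).const_smul σ
  exact (continuous_mulVec A).comp (h2.add continuous_const)

section
variable {n P k : ℕ} {X : Matrix (Fin n) (Fin P) ℝ} (A : Matrix (Fin k) (Fin P) ℝ) (c : ℕ → ℝ)
  {s : (Fin n → ℝ) → ℝ} (θ : Fin P → ℝ) {σ : ℝ} {O p : ℕ}

lemma sqrt_smul_mulVec_eq_estMap (hn : 0 < n) (hS : (gram X).PosDef) (hσ : 0 < σ)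
    (p : ℕ) (Y : Fin n → ℝ) : √(n : ℝ) • (A *ᵥ (restrictedLS X p Y - θ)) =
      estMap A (gram X) σ (√(n : ℝ) • θ) p (scores X θ σ Y) := by
  rw [estMap, ← sqrt_smul_restrictedLS_sub θ hn hS hσ, mulVec_smul]

lemma weightedCondLaw_real (hn : 0 < n) (hS : (gram X).PosDef) (hσ : 0 < σ) (hs : Measurable s)
    (hcO : c O = 0) (hOp : O ≤ p) (hpP : p ≤ P) {B : Set (Fin k → ℝ)} (hB : MeasurableSet B) :
    (weightedCondLaw A X c θ σ s p).real B =
      (dataLaw X θ σ).real ({Y | selected X c s Y = p} ∩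
        scores X θ σ ⁻¹' (estMap A (gram X) σ (√(n : ℝ) • θ) p ⁻¹' B)) := by
  rw [weightedCondLaw_eq X c A θ σ hs hcO hOp hpP]
  have he : (fun Y => √(n : ℝ) • (A *ᵥ (restrictedLS X p Y - θ))) =
      estMap A (gram X) σ (√(n : ℝ) • θ) p ∘ scores X θ σ :=
    funext fun Y => sqrt_smul_mulVec_eq_estMap A θ hn hS hσ p Y
  rw [he]
  have hm := (continuous_estMap A (gram X) σ (√(n : ℝ) • θ) p).measurable
  have hms := measurable_scores X θ σ
  rw [map_measureReal_apply (hm.comp hms) hB, measureReal_restrict_apply ((hm.comp hms) hB),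
    Set.inter_comm]
  rfl

lemma isFiniteMeasure_weightedCondLaw (hs : Measurable s) (hcO : c O = 0) (hOp : O ≤ p)
    (hpP : p ≤ P) : IsFiniteMeasure (weightedCondLaw A X c θ σ s p) := by
  rw [weightedCondLaw_eq X c A θ σ hs hcO hOp hpP]
  infer_instance

end

/-- The joint law of the selection event and the estimator is approximated, uniformly over Borel
sets, by the law under standard normal scores with the selection event replaced by its limit `E`.
The estimated scale enters only through its consistency: by monotonicity of the selection region in
the scales, the event is squeezed between two regions with deterministic scales. -/
lemma exists_uniform_approximation {P k : ℕ} (A : Matrix (Fin k) (Fin P) ℝ)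
    (X : ∀ n : ℕ, Matrix (Fin n) (Fin P) ℝ) (hS : ∀ n, P < n → (gram (X n)).PosDef)
    (c : ℕ → ℝ) {O p : ℕ} (hcO : c O = 0) (hOp : O ≤ p) (hpP : p ≤ P)
    (hc : ∀ q, p ≤ q → q ≤ P → 0 ≤ c q)
    (θ : ℕ → Fin P → ℝ) (σ : ℕ → ℝ) (hσ : ∀ n, P < n → 0 < σ n) {σlim : ℝ} (hσlim : 0 < σlim)
    (s : ∀ n : ℕ, (Fin n → ℝ) → ℝ) (hs : ∀ n, Measurable (s n))
    {δ : ℕ → ℝ} (hδ : Tendsto δ atTop (𝓝 0))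
    (hdev : Tendsto (fun n => (dataLaw (X n) (θ n) (σ n)).real {Y | δ n < |s n Y - σlim|})
      atTop (𝓝 0))
    {E : Set (Fin P → ℝ)} (hE : MeasurableSet E)
    (hEt : ∀ a b : ℕ → ℝ, Tendsto a atTop (𝓝 σlim) → Tendsto b atTop (𝓝 σlim) →
      ∀ᵐ z ∂(stdNormal (Fin P)), ∀ᶠ n : ℕ in atTop,
        (z ∈ selRegion c p (σ n) (drift (gram (X n)) (√(n : ℝ) • θ n)) (a n) (b n) ↔ z ∈ E)) :
    ∃ ε : ℕ → ℝ, Tendsto ε atTop (𝓝 0) ∧ ∀ᶠ n : ℕ in atTop, ∀ B : Set (Fin k → ℝ),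
      MeasurableSet B →
      |(weightedCondLaw A (X n) c (θ n) (σ n) (s n) p).real B - (stdNormal (Fin P)).real
        (E ∩ estMap A (gram (X n)) (σ n) (√(n : ℝ) • θ n) p ⁻¹' B)| ≤ ε n := by
  set R : ℕ → ℝ → ℝ → Set (Fin P → ℝ) := fun n =>
    selRegion c p (σ n) (drift (gram (X n)) (√(n : ℝ) • θ n)) with hR
  have hRm : ∀ n a b, MeasurableSet (R n a b) := fun n a b => measurableSet_selRegion _ _ _ _ _ _
  -- dominated convergence
  have hsymm : ∀ a b : ℕ → ℝ, Tendsto a atTop (𝓝 σlim) → Tendsto b atTop (𝓝 σlim) →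
      Tendsto (fun n => (stdNormal (Fin P)).real (symmDiff (R n (a n) (b n)) E)) atTop (𝓝 0) := by
    intro a b ha hb
    have h1 := tendsto_measure_of_ae_tendsto_indicator_of_isFiniteMeasure (μ := stdNormal (Fin P))
      (A := ∅) (As := fun n => symmDiff (R n (a n) (b n)) E) atTop MeasurableSet.empty
      (fun n => (hRm n _ _).symmDiff hE) ?_
    · have h2 := (ENNReal.tendsto_toReal (measure_ne_top (stdNormal (Fin P)) ∅)).comp h1
      rw [measure_empty, ENNReal.toReal_zero] at h2
      exact h2
    · filter_upwards [hEt a b ha hb] with z hz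
      filter_upwards [hz] with n hn
      have hn' : z ∈ R n (a n) (b n) ↔ z ∈ E := hn
      simp [Set.mem_symmDiff, hn']
  have hp : Tendsto (fun n => σlim + δ n) atTop (𝓝 σlim) := by simpa using hδ.const_add σlim
  have hm : Tendsto (fun n => σlim - δ n) atTop (𝓝 σlim) := by simpa using hδ.const_sub σlim
  refine ⟨fun n => (dataLaw (X n) (θ n) (σ n)).real {Y | δ n < |s n Y - σlim|} +
    ((stdNormal (Fin P)).real (symmDiff (R n (σlim + δ n) (σlim - δ n)) E) +
      (stdNormal (Fin P)).real (symmDiff (R n (σlim - δ n) (σlim + δ n)) E)), ?_, ?_⟩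
  · simpa using hdev.add ((hsymm _ _ hp hm).add (hsymm _ _ hm hp))
  filter_upwards [eventually_gt_atTop P, hδ.eventually_lt_const hσlim] with n hn hδn B hB
  have hn0 : 0 < n := by omega
  have hms := measurable_scores (X n) (θ n) (σ n)
  have hFB : MeasurableSet (estMap A (gram (X n)) (σ n) (√(n : ℝ) • θ n) p ⁻¹' B) :=
    (continuous_estMap _ _ _ _ _).measurable hB
  have hreal : ∀ D : Set (Fin P → ℝ), MeasurableSet D → (stdNormal (Fin P)).real D =
      (dataLaw (X n) (θ n) (σ n)).real (scores (X n) (θ n) (σ n) ⁻¹' D) := fun D hD => by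
    rw [← map_scores (θ n) hn0 (hS n hn) (hσ n hn), map_measureReal_apply hms hD]
  rw [weightedCondLaw_real A c (θ n) hn0 (hS n hn) (hσ n hn) (hs n) hcO hOp hpP hB,
    hreal _ (hE.inter hFB), hreal _ ((hRm n _ _).symmDiff hE), hreal _ ((hRm n _ _).symmDiff hE)]
  have hsel := measurableSet_selected_eq (X n) c (hs n) hcO hOp hpP
  refine (abs_measureReal_sub_le_measureReal_symmDiff (hsel.inter (hms hFB)).nullMeasurableSet
    (hms (hE.inter hFB)).nullMeasurableSet).trans ?_
  have hsub : symmDiff ({Y | selected (X n) c (s n) Y = p} ∩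
        scores (X n) (θ n) (σ n) ⁻¹' (estMap A (gram (X n)) (σ n) (√(n : ℝ) • θ n) p ⁻¹' B))
      (scores (X n) (θ n) (σ n) ⁻¹'
        (E ∩ estMap A (gram (X n)) (σ n) (√(n : ℝ) • θ n) p ⁻¹' B)) ⊆
      {Y | δ n < |s n Y - σlim|} ∪
        (scores (X n) (θ n) (σ n) ⁻¹' (symmDiff (R n (σlim + δ n) (σlim - δ n)) E) ∪
          scores (X n) (θ n) (σ n) ⁻¹' (symmDiff (R n (σlim - δ n) (σlim + δ n)) E)) := by
    intro Y hY
    by_contra hcon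
    simp only [Set.mem_union, not_or] at hcon
    obtain ⟨h1, h2, h3⟩ := hcon
    have h1' : |s n Y - σlim| ≤ δ n := not_lt.mp h1
    have h4 := abs_le.mp h1'
    have hsY : 0 < s n Y := by linarith [h4.1]
    have hiff := selected_eq_iff_scores_mem c (s n) (θ n) hn0 (hS n hn) (hσ n hn) hcO hOp hpP hsY
    set z := scores (X n) (θ n) (σ n) Y with hz
    have h2' : z ∈ R n (σlim + δ n) (σlim - δ n) ↔ z ∈ E := by
      have : ¬ z ∈ symmDiff (R n (σlim + δ n) (σlim - δ n)) E := h2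
      rw [Set.mem_symmDiff] at this
      clear_value R
      clear * - this
      tauto
    have h3' : z ∈ R n (σlim - δ n) (σlim + δ n) ↔ z ∈ E := by
      have : ¬ z ∈ symmDiff (R n (σlim - δ n) (σlim + δ n)) E := h3
      rw [Set.mem_symmDiff] at this
      clear_value R
      clear * - this
      tauto
    -- off the exceptional set, `σlim - δ n ≤ s n Y ≤ σlim + δ n`, so the monotonicity applies
    have hup : selected (X n) c (s n) Y = p → z ∈ E := fun h =>
      h2'.1 (selRegion_mono hc (by linarith [h4.2]) (by linarith [h4.1]) (hiff.1 h))
    have hdn : z ∈ E → selected (X n) c (s n) Y = p := fun h =>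
      hiff.2 (selRegion_mono hc (by linarith [h4.1]) (by linarith [h4.2]) (h3'.2 h))
    rcases Set.mem_symmDiff.mp hY with ⟨⟨h5, h6⟩, h7⟩ | ⟨⟨h5, h6⟩, h7⟩
    · exact h7 ⟨hup h5, h6⟩
    · exact h7 ⟨hdn h5, h6⟩
  refine (measureReal_mono hsub (measure_ne_top _ _)).trans ?_
  exact (measureReal_union_le _ _).trans (add_le_add le_rfl (measureReal_union_le _ _))

/-! ### The limit of the selection event -/

/-- The limit of the selection event. The test of order `p` drops out if `p = p_*`: either it is
vacuous since `c_𝒪 = 0`, or its noncentrality diverges. If `p < p_*`, the order `p` is not selected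
in the limit. -/
def limitRegion {P : ℕ} (c : ℕ → ℝ) (pst p : ℕ) (σ : ℝ) (β : Fin P → ℝ) : Set (Fin P → ℝ) :=
  {z | pst ≤ p ∧ (∀ i : Fin P, p ≤ (i : ℕ) → |σ * z i + β i| < c (i + 1) * σ) ∧
    (pst < p → ∀ i : Fin P, (i : ℕ) + 1 = p → c p * σ ≤ |σ * z i + β i|)}

lemma eventually_lt_iff_of_tendsto {a b : ℕ → ℝ} {x y : ℝ} (ha : Tendsto a atTop (𝓝 x))
    (hb : Tendsto b atTop (𝓝 y)) (hxy : x ≠ y) : ∀ᶠ n in atTop, (a n < b n ↔ x < y) := by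
  rcases hxy.lt_or_gt with h | h
  · filter_upwards [ha.eventually_lt hb h] with n hn
    exact iff_of_true hn h
  · filter_upwards [hb.eventually_lt ha h] with n hn
    exact iff_of_false (not_lt.mpr hn.le) (not_lt.mpr h.le)

/-- Ties between a limiting test statistic and its critical value have probability zero. -/
lemma ae_abs_ne {P : ℕ} {σ : ℝ} (hσ : 0 < σ) (β d : Fin P → ℝ) :
    ∀ᵐ z ∂(stdNormal (Fin P)), ∀ i, |σ * z i + β i| ≠ d i := by
  rw [ae_all_iff]
  intro i
  have h := stdNormal_eval_eq_zero i
    (s := {(d i - β i) / σ, (-d i - β i) / σ}) (Set.toFinite _)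
  rw [ae_iff]
  refine measure_mono_null (fun z hz => ?_) h
  have hz' : |σ * z i + β i| = d i := by simpa using hz
  have : z i = (d i - β i) / σ ∨ z i = (-d i - β i) / σ := by
    rcases abs_choice (σ * z i + β i) with h1 | h1
    · left
      rw [eq_div_iff hσ.ne']
      linarith
    · right
      rw [eq_div_iff hσ.ne']
      linarith
  simpa using this

section
variable {P O : ℕ} {ψ : Fin P → EReal}

lemma ne_top_ne_bot_of_pStar_le {i : Fin P} (h : pStar O ψ ≤ (i : ℕ)) : ψ i ≠ ⊤ ∧ ψ i ≠ ⊥ := by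
  by_contra hcon
  have h1 : ψ i = ⊤ ∨ ψ i = ⊥ := by tauto
  have hO : O ≤ (i : ℕ) := (le_max_left _ _).trans h
  have h2 : (i : ℕ) + 1 ≤ pStar O ψ := by
    refine le_trans ?_ (le_max_right _ _)
    exact Finset.le_sup (f := fun i : Fin P => (i : ℕ) + 1)
      (Finset.mem_filter.mpr ⟨Finset.mem_univ i, by omega, h1⟩)
  omega

lemma exists_of_lt_pStar (h : O < pStar O ψ) :
    ∃ i : Fin P, (i : ℕ) + 1 = pStar O ψ ∧ (ψ i = ⊤ ∨ ψ i = ⊥) := by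
  set F := Finset.univ.filter fun i : Fin P => O < (i : ℕ) + 1 ∧ (ψ i = ⊤ ∨ ψ i = ⊥) with hF
  have h1 : pStar O ψ = F.sup fun i => (i : ℕ) + 1 := by
    have h3 : pStar O ψ = max O (F.sup fun i => (i : ℕ) + 1) := rfl
    rcases le_total O (F.sup fun i => (i : ℕ) + 1) with h2 | h2
    · rw [h3, max_eq_right h2]
    · rw [h3, max_eq_left h2] at h
      omega
  have hne : F.Nonempty := by
    by_contra hcon
    rw [Finset.not_nonempty_iff_eq_empty] at hcon
    rw [h1, hcon] at h
    simp at h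
  obtain ⟨i, hi, hi2⟩ := Finset.exists_mem_eq_sup F hne fun i => (i : ℕ) + 1
  exact ⟨i, by rw [h1, hi2], (Finset.mem_filter.mp hi).2.2⟩

lemma le_pStar : O ≤ pStar O ψ := le_max_left _ _

lemma tendsto_realPart {x : ℕ → ℝ} {y : EReal} (h : Tendsto (fun n => (x n : EReal)) atTop (𝓝 y))
    (hy : y ≠ ⊤ ∧ y ≠ ⊥) : Tendsto x atTop (𝓝 y.toReal) := by
  rw [← EReal.coe_toReal hy.1 hy.2] at h
  exact EReal.tendsto_coe.mp h

lemma tendsto_abs_atTop_of_infinite {x : ℕ → ℝ} {y : EReal}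
    (h : Tendsto (fun n => (x n : EReal)) atTop (𝓝 y)) (hy : y = ⊤ ∨ y = ⊥) :
    Tendsto (fun n => |x n|) atTop atTop := by
  rcases hy with rfl | rfl
  · exact tendsto_abs_atTop_atTop.comp (EReal.tendsto_coe_nhds_top_iff.mp h)
  · exact tendsto_abs_atBot_atTop.comp (EReal.tendsto_coe_nhds_bot_iff.mp h)

variable {S : ℕ → Matrix (Fin P) (Fin P) ℝ} {Q : Matrix (Fin P) (Fin P) ℝ} {τ : ℕ → Fin P → ℝ}

lemma tendsto_drift (h : Tendsto S atTop (𝓝 Q)) (hQ : Q.PosDef)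
    (hψ : ∀ i, Tendsto (fun n => (τ n i : EReal)) atTop (𝓝 (ψ i))) {i : Fin P}
    (hi : pStar O ψ ≤ (i : ℕ)) :
    Tendsto (fun n => drift (S n) (τ n) i) atTop (𝓝 (drift Q (realPart ψ) i)) := by
  have hfin : ∀ j : Fin P, pStar O ψ ≤ (j : ℕ) →
      Tendsto (fun n => τ n j) atTop (𝓝 (realPart ψ j)) := fun j hj =>
    tendsto_realPart (hψ j) (ne_top_ne_bot_of_pStar_le hj)
  have h1 := tendsto_delta h hQ (i + 1) (ψn := τ) (ψ := realPart ψ)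
    fun j hj => hfin j (by omega)
  exact ((tendsto_pi_nhds.mp h1 i).add (hfin i hi)).div (tendsto_xi h hQ _) (xi_pos hQ i).ne'

/-- At order `p_*` the noncentrality diverges: `δ^{(p_*)}` involves only the coordinates of `ψ` after
the last infinite one, hence stays bounded. -/
lemma tendsto_abs_drift_atTop (h : Tendsto S atTop (𝓝 Q)) (hQ : Q.PosDef)
    (hψ : ∀ i, Tendsto (fun n => (τ n i : EReal)) atTop (𝓝 (ψ i))) {i : Fin P}
    (hi : (i : ℕ) + 1 = pStar O ψ) (hi2 : ψ i = ⊤ ∨ ψ i = ⊥) :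
    Tendsto (fun n => |drift (S n) (τ n) i|) atTop atTop := by
  have h1 := tendsto_delta h hQ (i + 1) (ψn := τ) (ψ := realPart ψ) fun j hj =>
    tendsto_realPart (hψ j) (ne_top_ne_bot_of_pStar_le (O := O) (by omega))
  have h2 := tendsto_abs_atTop_of_infinite (hψ i) hi2
  have h3 : Tendsto (fun n => |τ n i| + -|delta (S n) (τ n) (i + 1) i|) atTop atTop :=
    h2.atTop_add (tendsto_pi_nhds.mp h1 i).abs.neg
  have h4 : Tendsto (fun n => |delta (S n) (τ n) (i + 1) i + τ n i|) atTop atTop := by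
    refine tendsto_atTop_mono (fun n => ?_) h3
    have := abs_sub_abs_le_abs_sub (τ n i) (-delta (S n) (τ n) (i + 1) i)
    rw [abs_neg, sub_neg_eq_add, add_comm (τ n i)] at this
    linarith
  have h5 : Tendsto (fun n => |xi (S n) (i + 1)|⁻¹) atTop (𝓝 |xi Q (i + 1)|⁻¹) :=
    (tendsto_xi h hQ _).abs.inv₀ (abs_pos.mpr (xi_pos hQ i).ne').ne'
  have h6 := h4.atTop_mul_pos (inv_pos.mpr (abs_pos.mpr (xi_pos hQ i).ne')) h5
  refine h6.congr fun n => ?_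
  rw [drift, abs_div, div_eq_mul_inv]

/-- The selection events converge almost surely, for all scales tending to `σ`. -/
lemma ae_eventually_mem_selRegion_iff (c : ℕ → ℝ) {p : ℕ} (hcO : c O = 0) (hOp : O ≤ p)
    (h : Tendsto S atTop (𝓝 Q)) (hQ : Q.PosDef)
    (hψ : ∀ i, Tendsto (fun n => (τ n i : EReal)) atTop (𝓝 (ψ i)))
    {σ : ℕ → ℝ} {σlim : ℝ} (hσlim : 0 < σlim) (hσ : Tendsto σ atTop (𝓝 σlim))
    {a b : ℕ → ℝ} (ha : Tendsto a atTop (𝓝 σlim)) (hb : Tendsto b atTop (𝓝 σlim)) :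
    ∀ᵐ z ∂(stdNormal (Fin P)), ∀ᶠ n : ℕ in atTop,
      (z ∈ selRegion c p (σ n) (drift (S n) (τ n)) (a n) (b n) ↔
        z ∈ limitRegion c (pStar O ψ) p σlim (drift Q (realPart ψ))) := by
  filter_upwards [ae_abs_ne hσlim (drift Q (realPart ψ)) (fun i => c (i + 1) * σlim)] with z hz
  have hlim : ∀ i : Fin P, pStar O ψ ≤ (i : ℕ) → ∀ {a : ℕ → ℝ}, Tendsto a atTop (𝓝 σlim) →
      ∀ᶠ n in atTop, (|σ n * z i + drift (S n) (τ n) i| < c (i + 1) * a n ↔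
        |σlim * z i + drift Q (realPart ψ) i| < c (i + 1) * σlim) := by
    intro i hi a ha
    exact eventually_lt_iff_of_tendsto
      (((hσ.mul_const _).add (tendsto_drift h hQ hψ hi)).abs) (ha.const_mul _) (hz i)
  have hinf : ∀ i : Fin P, (i : ℕ) + 1 = pStar O ψ → ψ i = ⊤ ∨ ψ i = ⊥ →
      ∀ {a : ℕ → ℝ}, Tendsto a atTop (𝓝 σlim) →
      ∀ᶠ n in atTop, c (i + 1) * a n ≤ |σ n * z i + drift (S n) (τ n) i| := by
    intro i hi hi2 a ha
    have h1 := tendsto_abs_drift_atTop (O := O) h hQ hψ hi hi2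
    have h2 : Tendsto (fun n => |σ n * z i| + c (i + 1) * a n) atTop
        (𝓝 (|σlim * z i| + c (i + 1) * σlim)) :=
      (hσ.mul_const _).abs.add (ha.const_mul _)
    filter_upwards [h1.eventually_ge_atTop (|σlim * z i| + c (i + 1) * σlim + 1),
      h2.eventually_lt_const (lt_add_one _)] with n h3 h4
    have h5 := abs_sub_abs_le_abs_sub (drift (S n) (τ n) i) (-(σ n * z i))
    rw [abs_neg, sub_neg_eq_add, add_comm (drift _ _ _)] at h5
    linarith
  rcases lt_or_ge p (pStar O ψ) with hlt | hge
  -- for `p < p_*` the test of order `p_*` eventually rejects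
  · obtain ⟨i, hi, hi2⟩ := exists_of_lt_pStar (hOp.trans_lt hlt)
    filter_upwards [hinf i hi hi2 ha] with n hn
    constructor
    · intro hmem
      exact absurd (hmem.1 i (by omega)) (not_lt.mpr hn)
    · intro hmem
      exact absurd hmem.1 (not_le.mpr hlt)
  · have htail : ∀ᶠ n in atTop, ∀ i : Fin P, p ≤ (i : ℕ) →
        (|σ n * z i + drift (S n) (τ n) i| < c (i + 1) * a n ↔
        |σlim * z i + drift Q (realPart ψ) i| < c (i + 1) * σlim) := by
      rw [eventually_all]
      intro i
      by_cases hi : p ≤ (i : ℕ)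
      · filter_upwards [hlim i (hge.trans hi) ha] with n hn _ using hn
      · exact Eventually.of_forall fun n hi' => absurd hi' hi
    have hhead : ∀ᶠ n in atTop, ∀ i : Fin P, (i : ℕ) + 1 = p →
        (c p * b n ≤ |σ n * z i + drift (S n) (τ n) i| ↔
        (pStar O ψ < p → c p * σlim ≤ |σlim * z i + drift Q (realPart ψ) i|)) := by
      rw [eventually_all]
      intro i
      by_cases hi : (i : ℕ) + 1 = p
      swap
      · exact Eventually.of_forall fun n hi' => absurd hi' hi
      rcases hge.lt_or_eq with hlt | heq
      · filter_upwards [hlim i (by omega) hb] with n hn _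
        rw [← not_lt, ← hi, hn, not_lt, hi]
        simp [hlt]
      -- for `p = p_*` the test of order `p` eventually rejects: either its noncentrality diverges,
      -- or `p_* = 𝒪`, where the critical value is `0`
      · have htriv : ∀ᶠ n in atTop, c p * b n ≤ |σ n * z i + drift (S n) (τ n) i| := by
          rcases (le_pStar (O := O) (ψ := ψ)).lt_or_eq with hO | hO
          · obtain ⟨j, hj, hj2⟩ := exists_of_lt_pStar hO
            have hij : j = i := Fin.ext (by omega)
            subst hij
            filter_upwards [hinf j hj hj2 hb] with n hn
            rwa [hi] at hn
          · refine Eventually.of_forall fun n => ?_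
            rw [← heq, ← hO, hcO, zero_mul]
            positivity
        filter_upwards [htriv] with n hn _
        simp [hn, heq]
    filter_upwards [htail, hhead] with n h1 h2
    constructor
    · intro hmem
      exact ⟨hge, fun i hi => (h1 i hi).1 (hmem.1 i hi),
        fun hlt i hi => (h2 i hi).1 (hmem.2 i hi) hlt⟩
    · intro hmem
      exact ⟨fun i hi => (h1 i hi).2 (hmem.2.1 i hi),
        fun i hi => (h2 i hi).2 fun hlt => hmem.2.2 hlt i hi⟩

end

/-! ### From uniform approximation to weak convergence -/

/-- At a continuity point `t` of the distribution function, the lower orthant at `t` is a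
continuity set. -/
lemma measure_Iic_diff_eq_zero {k : ℕ} (ν : Measure (Fin k → ℝ)) [IsFiniteMeasure ν]
    {t : Fin k → ℝ} (ht : ContinuousAt (cdfOf ν) t) :
    ν (Set.Iic t \ {z | ∀ i, z i < t i}) = 0 := by
  -- approach `t` from below along the diagonal
  have hu : Tendsto (fun m : ℕ => fun i => t i - 1 / ((m : ℝ) + 1)) atTop (𝓝 t) := by
    refine tendsto_pi_nhds.mpr fun i => ?_
    simpa using (tendsto_one_div_add_atTop_nhds_zero_nat (𝕜 := ℝ)).const_sub (t i)
  have h1 := ht.tendsto.comp hu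
  have h2 : ∀ m : ℕ, ν.real (Set.Iic t \ {z | ∀ i, z i < t i}) ≤
      cdfOf ν t - cdfOf ν (fun i => t i - 1 / ((m : ℝ) + 1)) := by
    intro m
    have hpos : 0 < 1 / ((m : ℝ) + 1) := by positivity
    have hsub : Set.Iic (fun i => t i - 1 / ((m : ℝ) + 1)) ⊆ Set.Iic t := fun z hz i =>
      (hz i).trans (by simp only; linarith)
    rw [cdfOf, cdfOf, ← measureReal_sdiff hsub measurableSet_Iic]
    refine measureReal_mono (fun z hz => ⟨hz.1, fun hz2 => hz.2 fun i => ?_⟩) (measure_ne_top _ _)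
    exact (hz2 i).trans_lt (by simp only; linarith)
  have h3 : ν.real (Set.Iic t \ {z | ∀ i, z i < t i}) ≤ 0 := by
    have h4 := h1.const_sub (cdfOf ν t)
    rw [sub_self] at h4
    exact ge_of_tendsto' h4 h2
  have h4 := le_antisymm h3 measureReal_nonneg
  exact (measureReal_eq_zero_iff (measure_ne_top _ _)).mp h4

lemma tendsto_of_abs_sub_le {a b ε : ℕ → ℝ} {l : ℝ} (hε : Tendsto ε atTop (𝓝 0))
    (h : ∀ᶠ n in atTop, |a n - b n| ≤ ε n) (hb : Tendsto b atTop (𝓝 l)) :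
    Tendsto a atTop (𝓝 l) := by
  have h1 : Tendsto (fun n => a n - b n) atTop (𝓝 0) := squeeze_zero_norm' h hε
  simpa using h1.add hb

lemma weakConv_of_approximation {k : ℕ} {Ω : Type*} [MeasurableSpace Ω] (γ : Measure Ω)
    [IsFiniteMeasure γ] {E : Set Ω} {F : Ω → Fin k → ℝ}
    {Fn : ℕ → Ω → Fin k → ℝ} (hF : Measurable F) (hFn : ∀ n, Measurable (Fn n))
    (hlim : ∀ z, Tendsto (fun n => Fn n z) atTop (𝓝 (F z)))
    {H : ℕ → Measure (Fin k → ℝ)} {ε : ℕ → ℝ} (hε : Tendsto ε atTop (𝓝 0))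
    (happ : ∀ᶠ n in atTop, ∀ B, MeasurableSet B →
      |(H n).real B - γ.real (E ∩ Fn n ⁻¹' B)| ≤ ε n) :
    WeakConv H ((γ.restrict E).map F) := by
  have hreal : ∀ {f : Ω → Fin k → ℝ}, Measurable f → ∀ {B}, MeasurableSet B →
      (γ.restrict E).real (f ⁻¹' B) = γ.real (E ∩ f ⁻¹' B) := fun hf B hB => by
    rw [measureReal_restrict_apply (hf hB), Set.inter_comm]
  refine ⟨fun t ht => ?_, ?_⟩
  · refine tendsto_of_abs_sub_le hε (b := fun n => γ.real (E ∩ Fn n ⁻¹' Set.Iic t))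
      (happ.mono fun n hn => hn _ measurableSet_Iic) ?_
    rw [cdfOf, map_measureReal_apply hF measurableSet_Iic]
    simp_rw [← hreal (hFn _) measurableSet_Iic]
    refine (ENNReal.tendsto_toReal (measure_ne_top _ _)).comp
      (tendsto_measure_of_ae_tendsto_indicator_of_isFiniteMeasure atTop (hF measurableSet_Iic)
        (fun n => hFn n measurableSet_Iic) ?_)
    have h0 := measure_Iic_diff_eq_zero _ ht
    have hopen : IsOpen {z : Fin k → ℝ | ∀ i, z i < t i} := by
      simp only [Set.ofPred_forall]
      exact isOpen_iInter_of_finite fun i => isOpen_lt (continuous_apply i) continuous_const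
    rw [Measure.map_apply hF (measurableSet_Iic.diff hopen.measurableSet)] at h0
    filter_upwards [measure_eq_zero_iff_ae_notMem.mp h0] with z hz
    by_cases hz1 : F z ∈ Set.Iic t
    · have hz2 : F z ∈ {z : Fin k → ℝ | ∀ i, z i < t i} := by
        by_contra hcon
        exact hz ⟨hz1, hcon⟩
      filter_upwards [(hlim z).eventually (hopen.mem_nhds hz2)] with n hn
      exact iff_of_true (fun i => (hn i).le) hz1
    · filter_upwards [(hlim z).eventually (isClosed_Iic.isOpen_compl.mem_nhds hz1)] with n hn
      exact iff_of_false hn hz1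
  · refine tendsto_of_abs_sub_le hε (b := fun n => γ.real (E ∩ Fn n ⁻¹' Set.univ))
      (happ.mono fun n hn => hn _ MeasurableSet.univ) ?_
    rw [map_measureReal_apply hF MeasurableSet.univ, measureReal_restrict_apply (by simp)]
    simp

lemma tvConv_of_approximation {k : ℕ} {H : ℕ → Measure (Fin k → ℝ)} {ν : Measure (Fin k → ℝ)}
    {ε : ℕ → ℝ} (hε : Tendsto ε atTop (𝓝 0))
    (h : ∀ᶠ n in atTop, ∀ B, MeasurableSet B → |(H n).real B - ν.real B| ≤ ε n) :
    TVConv H ν := by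
  refine squeeze_zero' (Eventually.of_forall fun n => Real.iSup_nonneg fun B => abs_nonneg _) ?_ hε
  filter_upwards [h] with n hn
  have : Nonempty {B : Set (Fin k → ℝ) // MeasurableSet B} := ⟨⟨∅, MeasurableSet.empty⟩⟩
  exact ciSup_le fun B => hn B.val B.2

/-! ### Total variation under asymptotically trivial changes of variables -/

/-- Scheffé's lemma. -/
lemma tendsto_integral_abs_sub_of_tendsto_ae {Ω : Type*} [MeasurableSpace Ω] {μ : Measure Ω}
    {f : ℕ → Ω → ℝ} {g : Ω → ℝ} (hf : ∀ᶠ n in atTop, Integrable (f n) μ) (hg : Integrable g μ)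
    (hf0 : ∀ n z, 0 ≤ f n z) (hg0 : ∀ z, 0 ≤ g z)
    (hfg : ∀ᶠ n in atTop, ∫ z, f n z ∂μ = ∫ z, g z ∂μ)
    (hlim : ∀ᵐ z ∂μ, Tendsto (fun n => f n z) atTop (𝓝 (g z))) :
    Tendsto (fun n => ∫ z, |f n z - g z| ∂μ) atTop (𝓝 0) := by
  have h1 : Tendsto (fun n => ∫ z, max (g z - f n z) 0 ∂μ) atTop (𝓝 (∫ _, (0 : ℝ) ∂μ)) := by
    refine tendsto_integral_filter_of_dominated_convergence g ?_ ?_ hg ?_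
    · filter_upwards [hf] with n hn
      exact ((hg.sub hn).pos_part).aestronglyMeasurable
    · refine Eventually.of_forall fun n => ae_of_all _ fun z => ?_
      rw [Real.norm_of_nonneg (le_max_right _ _)]
      exact max_le (by linarith [hf0 n z]) (hg0 z)
    · filter_upwards [hlim] with z hz
      have h2 := (hz.const_sub (g z)).max (tendsto_const_nhds (x := (0 : ℝ)))
      simpa using h2
  rw [integral_zero] at h1
  have h2 := h1.const_mul 2
  rw [mul_zero] at h2
  refine h2.congr' ?_
  filter_upwards [hf, hfg] with n hn hn2
  -- only the negative part of `f n - g` is dominated, by `g`; equality of the integrals does the rest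
  have h3 : ∀ z, |f n z - g z| = 2 * max (g z - f n z) 0 + (f n z - g z) := fun z => by
    rcases le_total (f n z) (g z) with h | h
    · rw [abs_of_nonpos (by linarith), max_eq_left (by linarith)]; ring
    · rw [abs_of_nonneg (by linarith), max_eq_right (by linarith)]; ring
  simp_rw [h3]
  have h4 : Integrable (fun z => 2 * max (g z - f n z) 0) μ := (hg.sub hn).pos_part.const_mul 2
  have h5 : Integrable (fun z => f n z - g z) μ := hn.sub hg
  rw [integral_add h4 h5, integral_const_mul,
    integral_sub hn hg, hn2]
  ring

section
variable {ι : Type*} [Fintype ι] [DecidableEq ι]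

lemma map_affine_volume {M : Matrix ι ι ℝ} (hM : M.det ≠ 0) (v : ι → ℝ) :
    (volume : Measure (ι → ℝ)).map (fun z => M *ᵥ (z - v)) =
      ENNReal.ofReal |M.det⁻¹| • volume := by
  have h1 : (fun z : ι → ℝ => M *ᵥ (z - v)) = (fun z => M *ᵥ z) ∘ fun z => z - v := rfl
  rw [h1, ← Measure.map_map (measurable_mulVec M) (by fun_prop),
    (measurePreserving_sub_right volume v).map_eq]
  exact Real.map_matrix_volume_pi_eq_smul_volume_pi hM

/-- If the affine maps `z ↦ L_n z + v_n` tend to the identity, the images under these maps of a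
finite measure with an almost everywhere continuous density converge in total variation. -/
lemma exists_uniform_bound_of_affine {h : (ι → ℝ) → ℝ} (hint : Integrable h) (h0 : ∀ z, 0 ≤ h z)
    (hcont : ∀ᵐ z, ContinuousAt h z) {L : ℕ → Matrix ι ι ℝ} {v : ℕ → ι → ℝ}
    (hL : Tendsto L atTop (𝓝 1)) (hv : Tendsto v atTop (𝓝 0)) :
    ∃ ε : ℕ → ℝ, Tendsto ε atTop (𝓝 0) ∧ ∀ᶠ n in atTop, ∀ B : Set (ι → ℝ), MeasurableSet B →
      |(∫ z in (fun z => L n *ᵥ z + v n) ⁻¹' B, h z) - ∫ z in B, h z| ≤ ε n := by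
  have hdet : Tendsto (fun n => (L n).det) atTop (𝓝 1) := by
    have : Continuous fun M : Matrix ι ι ℝ => M.det := continuous_id.matrix_det
    have h1 := (this.tendsto 1).comp hL
    rw [det_one] at h1
    exact h1
  have hinv : Tendsto (fun n => (L n)⁻¹) atTop (𝓝 1) := by
    have h1 := (continuousAt_matrix_inv_of_isUnit (M := (1 : Matrix ι ι ℝ)) (by simp)).tendsto.comp hL
    rw [inv_one] at h1
    exact h1
  have hdet0 : ∀ᶠ n in atTop, (L n).det ≠ 0 :=
    hdet.eventually_ne one_ne_zero
  set Θ : ℕ → (ι → ℝ) → ι → ℝ := fun n z => (L n)⁻¹ *ᵥ (z - v n) with hΘ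
  have hΘm : ∀ n, Measurable (Θ n) := fun n =>
    (measurable_mulVec _).comp (measurable_id.sub_const (v n))
  -- the density of the image measure
  set f : ℕ → (ι → ℝ) → ℝ := fun n z => |(L n).det|⁻¹ * h (Θ n z) with hf
  have hmap : ∀ n, (L n).det ≠ 0 → (volume : Measure (ι → ℝ)).map (Θ n) =
      ENNReal.ofReal |(L n).det| • volume := fun n hn => by
    have h1 : ((L n)⁻¹).det ≠ 0 := by
      rw [det_nonsing_inv, Ring.inverse_eq_inv']; exact inv_ne_zero hn
    rw [hΘ, map_affine_volume h1, det_nonsing_inv, Ring.inverse_eq_inv', inv_inv]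
  have hfint : ∀ n, (L n).det ≠ 0 → Integrable (f n) := fun n hn => by
    refine Integrable.const_mul ?_ _
    have h1 : Integrable h ((volume : Measure (ι → ℝ)).map (Θ n)) := by
      rw [hmap n hn]; exact hint.smul_measure ENNReal.ofReal_ne_top
    exact h1.comp_measurable (hΘm n)
  have hset : ∀ n, (L n).det ≠ 0 → ∀ B : Set (ι → ℝ), MeasurableSet B →
      ∫ z in (fun z => L n *ᵥ z + v n) ⁻¹' B, h z = ∫ z in B, f n z := by
    intro n hn B hB
    have hΨm : Measurable fun z => L n *ᵥ z + v n := (measurable_mulVec _).add_const _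
    have hmeas : AEStronglyMeasurable h ((volume : Measure (ι → ℝ)).map (Θ n)) := by
      rw [hmap n hn]; exact hint.aestronglyMeasurable.smul_measure _
    have h1 := setIntegral_map (hΨm hB) hmeas (hΘm n).aemeasurable
    have h2 : Θ n ⁻¹' ((fun z => L n *ᵥ z + v n) ⁻¹' B) = B := by
      ext z
      have hu : IsUnit (L n).det := isUnit_iff_ne_zero.mpr hn
      simp [hΘ, mulVec_mulVec, mul_nonsing_inv _ hu]
    rw [h2, hmap n hn, Measure.restrict_smul, integral_smul_measure,
      ENNReal.toReal_ofReal (abs_nonneg _)] at h1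
    simp only [hf]
    rw [integral_const_mul, ← h1, smul_eq_mul, inv_mul_cancel_left₀ (abs_ne_zero.mpr hn)]
  refine ⟨fun n => ∫ z, |f n z - h z|, ?_, ?_⟩
  · refine tendsto_integral_abs_sub_of_tendsto_ae (hdet0.mono hfint) hint
      (fun n z => mul_nonneg (by positivity) (h0 _)) h0 ?_ ?_
    · filter_upwards [hdet0] with n hn
      have := hset n hn Set.univ MeasurableSet.univ
      simpa using this.symm
    · filter_upwards [hcont] with z hz
      have h1 : Tendsto (fun n => Θ n z) atTop (𝓝 z) := by
        have := tendsto_mulVec hinv (hv.const_sub z)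
        simpa using this
      have h2 : Tendsto (fun n => |(L n).det|⁻¹) atTop (𝓝 1) := by
        simpa using hdet.abs.inv₀ (by simp)
      simpa using h2.mul (hz.tendsto.comp h1)
  · filter_upwards [hdet0] with n hn B hB
    rw [hset n hn B hB, ← integral_sub (hfint n hn).integrableOn hint.integrableOn]
    have h1 : Integrable fun z => f n z - h z := (hfint n hn).sub hint
    exact (abs_integral_le_integral_abs).trans
      (setIntegral_le_integral h1.abs (ae_of_all _ fun z => abs_nonneg _))

end

section
variable {ι : Type*} [Fintype ι]

lemma volume_absolutelyContinuous_stdNormal : volume ≪ stdNormal ι := by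
  rw [stdNormal_eq_withDensity]
  refine withDensity_absolutelyContinuous' ?_ (ae_of_all _ fun z => ?_)
  · exact (continuous_stdNormalPDF ι).measurable.ennreal_ofReal.aemeasurable
  · have : 0 < stdNormalPDF ι z :=
      Finset.prod_pos fun i _ => gaussianPDFReal_pos 0 1 (z i) (by simp)
    simpa using this

lemma integrable_stdNormalPDF : Integrable (stdNormalPDF ι) := by
  refine ⟨(continuous_stdNormalPDF ι).aestronglyMeasurable, ?_⟩
  rw [hasFiniteIntegral_iff_ofReal (ae_of_all _ stdNormalPDF_nonneg)]
  have h : stdNormal ι Set.univ < ⊤ := measure_lt_top _ _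
  rwa [stdNormal_eq_withDensity, withDensity_apply _ MeasurableSet.univ, setLIntegral_univ] at h

lemma stdNormal_real_eq_integral {B : Set (ι → ℝ)} (hB : MeasurableSet B) :
    (stdNormal ι).real B = ∫ z in B, stdNormalPDF ι z := by
  rw [Measure.real, stdNormal_eq_withDensity, withDensity_apply _ hB,
    ← ofReal_integral_eq_lintegral_ofReal integrable_stdNormalPDF.integrableOn
      (ae_of_all _ stdNormalPDF_nonneg),
    ENNReal.toReal_ofReal (integral_nonneg stdNormalPDF_nonneg)]

/-- Total variation convergence of the images of the standard normal law, restricted to an event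
with null boundary, under maps that differ from a fixed one by a vanishing affine reparametrization
of the domain. -/
lemma exists_uniform_bound_of_reparametrization {k : ℕ} [DecidableEq ι] {E : Set (ι → ℝ)}
    (hE : MeasurableSet E) (hEloc : ∀ᵐ z ∂(stdNormal ι), ∀ᶠ y in 𝓝 z, (y ∈ E ↔ z ∈ E))
    {F : (ι → ℝ) → Fin k → ℝ} (hF : Measurable F) {Fn : ℕ → (ι → ℝ) → Fin k → ℝ}
    {L : ℕ → Matrix ι ι ℝ} {v : ℕ → ι → ℝ}
    (hL : Tendsto L atTop (𝓝 1)) (hv : Tendsto v atTop (𝓝 0))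
    (hFn : ∀ᶠ n in atTop, ∀ z, Fn n z = F (L n *ᵥ z + v n)) :
    ∃ ε : ℕ → ℝ, Tendsto ε atTop (𝓝 0) ∧ ∀ᶠ n in atTop, ∀ B : Set (Fin k → ℝ), MeasurableSet B →
      |(stdNormal ι).real (E ∩ Fn n ⁻¹' B) - (stdNormal ι).real (E ∩ F ⁻¹' B)| ≤ ε n := by
  have hint : Integrable (E.indicator (stdNormalPDF ι)) := integrable_stdNormalPDF.indicator hE
  have hset : ∀ B : Set (ι → ℝ), MeasurableSet B →
      ∫ z in B, E.indicator (stdNormalPDF ι) z = (stdNormal ι).real (E ∩ B) := fun B hB => by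
    rw [setIntegral_indicator hE, stdNormal_real_eq_integral (hE.inter hB), Set.inter_comm]
  have hcont : ∀ᵐ z, ContinuousAt (E.indicator (stdNormalPDF ι)) z := by
    filter_upwards [volume_absolutelyContinuous_stdNormal.ae_le hEloc] with z hz
    by_cases hzE : z ∈ E
    · refine (continuous_stdNormalPDF ι).continuousAt.congr ?_
      filter_upwards [hz] with y hy
      rw [Set.indicator_of_mem (hy.2 hzE)]
    · refine (continuousAt_const (y := (0 : ℝ))).congr ?_
      filter_upwards [hz] with y hy
      rw [Set.indicator_of_notMem fun h => hzE (hy.1 h)]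
  obtain ⟨ε, hε, hb⟩ := exists_uniform_bound_of_affine hint
    (fun z => Set.indicator_nonneg (fun z _ => stdNormalPDF_nonneg z) z) hcont hL hv
  refine ⟨ε, hε, ?_⟩
  filter_upwards [hb, hFn] with n hn hFn' B hB
  have h1 := hn (F ⁻¹' B) (hF hB)
  have hΨm : Measurable fun z => L n *ᵥ z + v n := (measurable_mulVec _).add_const _
  rw [hset _ (hΨm (hF hB)), hset _ (hF hB)] at h1
  have h2 : (fun z => L n *ᵥ z + v n) ⁻¹' (F ⁻¹' B) = Fn n ⁻¹' B := by
    ext z; simp [hFn']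
  rwa [h2] at h1

end

lemma exists_generalized_inverse {ι κ : Type*} [Fintype ι] [Fintype κ] [DecidableEq ι]
    [DecidableEq κ] (N : Matrix κ ι ℝ) : ∃ R : Matrix ι κ ℝ, N * R * N = N := by
  obtain ⟨g, hg⟩ := N.mulVecLin.rangeRestrict.exists_rightInverse_of_surjective
    (LinearMap.range_rangeRestrict _)
  obtain ⟨g', hg'⟩ := LinearMap.exists_extend g
  refine ⟨LinearMap.toMatrix' g', ?_⟩
  apply Matrix.toLin'.injective
  refine LinearMap.ext fun x => ?_
  rw [toLin'_mul, toLin'_mul, toLin'_toMatrix']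
  have h1 : g' (N.mulVecLin x) = g (N.mulVecLin.rangeRestrict x) :=
    LinearMap.congr_fun hg' (N.mulVecLin.rangeRestrict x)
  have h2 : N.mulVecLin.rangeRestrict (g (N.mulVecLin.rangeRestrict x)) =
      N.mulVecLin.rangeRestrict x := LinearMap.congr_fun hg _
  have h3 : N.mulVecLin (g (N.mulVecLin.rangeRestrict x)) = N.mulVecLin x :=
    congrArg Subtype.val h2
  rw [← h1] at h3
  exact h3

/-! ### The estimator as an affine function of the scores -/

/-- The matrix of the restriction of a vector to its first `p` coordinates. -/
def headSelector (P p : ℕ) : Matrix (Head P p) (Fin P) ℝ :=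
  (1 : Matrix (Fin P) (Fin P) ℝ).submatrix Subtype.val id

lemma headSelector_mulVec {P : ℕ} (p : ℕ) (z : Fin P → ℝ) :
    headSelector P p *ᵥ z = headVec z p := by
  funext i
  have h : (headSelector P p *ᵥ z) i = ((1 : Matrix (Fin P) (Fin P) ℝ) *ᵥ z) i.val := rfl
  rw [h, one_mulVec, headVec]

lemma exists_headVec_eq {P p : ℕ} (x : Head P p → ℝ) : ∃ z : Fin P → ℝ, headVec z p = x :=
  ⟨fun i => if h : (i : ℕ) < p then x ⟨i, h⟩ else 0, by
    funext i; simp [headVec, i.2]⟩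

section
variable {P k : ℕ} (A : Matrix (Fin k) (Fin P) ℝ)

/-- The linear part of `estMap`. -/
def estMatrix (S : Matrix (Fin P) (Fin P) ℝ) (σ : ℝ) (p : ℕ) : Matrix (Fin k) (Fin P) ℝ :=
  σ • (A * (headCols (whitening S) p * headSelector P p))

lemma estMap_eq_estMatrix (S : Matrix (Fin P) (Fin P) ℝ) (σ : ℝ) (ψ : Fin P → ℝ) (p : ℕ)
    (z : Fin P → ℝ) :
    estMap A S σ ψ p z = estMatrix A S σ p *ᵥ z + A *ᵥ delta S ψ p := by
  rw [estMap, estMatrix, smul_mulVec, ← mulVec_mulVec, ← mulVec_mulVec, headSelector_mulVec,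
    mulVec_add, mulVec_smul]

lemma mulVec_eq_head_add_tail (p : ℕ) (y : Fin P → ℝ) :
    A *ᵥ y = headCols A p *ᵥ headVec y p + tailCols A p *ᵥ tailVec y p := by
  funext i
  exact sum_head_add_sum_tail p fun a => A i a * y a

lemma mulVec_headCols_whitening (S : Matrix (Fin P) (Fin P) ℝ) (p : ℕ) (x : Head P p → ℝ) :
    A *ᵥ (headCols (whitening S) p *ᵥ x) = headCols A p *ᵥ (leadBlock (whitening S) p *ᵥ x) := by
  rw [mulVec_eq_head_add_tail A p]
  have h1 : tailVec (headCols (whitening S) p *ᵥ x) p = 0 := by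
    funext j
    exact headCols_whitening_mulVec_of_le S p x j.2
  rw [h1, mulVec_zero, add_zero]
  rfl

lemma mulVec_delta (S : Matrix (Fin P) (Fin P) ℝ) (ψ : Fin P → ℝ) (p : ℕ) :
    A *ᵥ delta S ψ p = headCols A p *ᵥ ((leadBlock S p)⁻¹ *ᵥ (offBlock S p *ᵥ tailVec ψ p)) -
      tailCols A p *ᵥ tailVec ψ p := by
  have h1 : headVec (delta S ψ p) p = (leadBlock S p)⁻¹ *ᵥ (offBlock S p *ᵥ tailVec ψ p) := by
    funext i; simp [headVec, delta, i.2]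
  have h2 : tailVec (delta S ψ p) p = -tailVec ψ p := by
    funext i; simp [tailVec, delta, not_lt.mpr i.2]
  rw [mulVec_eq_head_add_tail A p, h1, h2, mulVec_neg, sub_eq_add_neg]

/-- The estimator takes values in the range of `A[p]`, shifted by `-A[¬p] ψ[¬p]`. -/
lemma exists_headCols_mulVec_eq (S : Matrix (Fin P) (Fin P) ℝ) (σ : ℝ) (ψ : Fin P → ℝ) (p : ℕ)
    (z : Fin P → ℝ) : ∃ x, estMap A S σ ψ p z =
      headCols A p *ᵥ x - tailCols A p *ᵥ tailVec ψ p := by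
  refine ⟨leadBlock (whitening S) p *ᵥ (σ • headVec z p) +
    (leadBlock S p)⁻¹ *ᵥ (offBlock S p *ᵥ tailVec ψ p), ?_⟩
  rw [estMap, mulVec_add, ← mulVec_smul, mulVec_headCols_whitening, mulVec_delta, mulVec_add]
  abel

/-- The linear part of the estimator is onto the range of `A[p]`. -/
lemma exists_estMatrix_mulVec_eq {S : Matrix (Fin P) (Fin P) ℝ} (hS : S.PosDef) {σ : ℝ}
    (hσ : σ ≠ 0) (p : ℕ) (x : Head P p → ℝ) :
    ∃ z, estMatrix A S σ p *ᵥ z = headCols A p *ᵥ x := by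
  obtain ⟨z, hz⟩ := exists_headVec_eq (σ⁻¹ • ((leadBlock (whitening S) p)⁻¹ *ᵥ x))
  refine ⟨z, ?_⟩
  rw [estMatrix, smul_mulVec, ← mulVec_mulVec, ← mulVec_mulVec, headSelector_mulVec, hz,
    mulVec_smul, mulVec_smul, smul_smul, mul_inv_cancel₀ hσ, one_smul, mulVec_headCols_whitening,
    mulVec_mulVec _ (leadBlock (whitening S) p), mul_nonsing_inv _ (isUnit_det_leadBlock_whitening hS p),
    one_mulVec]

variable {S : ℕ → Matrix (Fin P) (Fin P) ℝ} {Q : Matrix (Fin P) (Fin P) ℝ} {τ : ℕ → Fin P → ℝ}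
  {ψ : Fin P → ℝ} {σ : ℕ → ℝ} {σlim : ℝ} {p : ℕ}

lemma tendsto_estMatrix (h : Tendsto S atTop (𝓝 Q)) (hQ : Q.PosDef) (hσ : Tendsto σ atTop (𝓝 σlim))
    (p : ℕ) : Tendsto (fun n => estMatrix A (S n) (σ n) p) atTop (𝓝 (estMatrix A Q σlim p)) := by
  have h1 : Continuous fun W : Matrix (Fin P) (Fin P) ℝ => A * (headCols W p * headSelector P p) := by
    have : Continuous fun W : Matrix (Fin P) (Fin P) ℝ => headCols W p :=
      continuous_id.matrix_submatrix _ _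
    exact continuous_const.matrix_mul (this.matrix_mul continuous_const)
  exact hσ.smul ((h1.tendsto _).comp (tendsto_whitening h hQ))

lemma tendsto_estMap (h : Tendsto S atTop (𝓝 Q)) (hQ : Q.PosDef) (hσ : Tendsto σ atTop (𝓝 σlim))
    (hψ : ∀ i : Fin P, p ≤ (i : ℕ) → Tendsto (fun n => τ n i) atTop (𝓝 (ψ i))) (z : Fin P → ℝ) :
    Tendsto (fun n => estMap A (S n) (σ n) (τ n) p z) atTop (𝓝 (estMap A Q σlim ψ p z)) := by
  simp_rw [estMap_eq_estMatrix]
  exact (tendsto_mulVec (tendsto_estMatrix A h hQ hσ p) tendsto_const_nhds).add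
    (tendsto_mulVec tendsto_const_nhds (tendsto_delta h hQ p hψ))

/-- If the affine range of the estimator does not depend on `n`, the estimator is its limit composed
with an affine map of the scores that tends to the identity. The map is `z ↦ z + R (F_n z - F z)`
with a generalized inverse `R` of the linear part of the limit `F`. -/
lemma exists_reparametrization (h : Tendsto S atTop (𝓝 Q)) (hQ : Q.PosDef)
    (hσlim : 0 < σlim) (hσ : Tendsto σ atTop (𝓝 σlim))
    (hψ : ∀ i : Fin P, p ≤ (i : ℕ) → Tendsto (fun n => τ n i) atTop (𝓝 (ψ i)))
    (hrange : ∀ᶠ n in atTop, ∃ x, tailCols A p *ᵥ tailVec (τ n) p =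
      tailCols A p *ᵥ tailVec ψ p + headCols A p *ᵥ x) :
    ∃ (L : ℕ → Matrix (Fin P) (Fin P) ℝ) (v : ℕ → Fin P → ℝ), Tendsto L atTop (𝓝 1) ∧
      Tendsto v atTop (𝓝 0) ∧ ∀ᶠ n in atTop, ∀ z, estMap A (S n) (σ n) (τ n) p z =
        estMap A Q σlim ψ p (L n *ᵥ z + v n) := by
  set N := estMatrix A Q σlim p with hN
  obtain ⟨R, hR⟩ := exists_generalized_inverse N
  have hsub : ∀ n z, estMap A (S n) (σ n) (τ n) p z - estMap A Q σlim ψ p z =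
      (estMatrix A (S n) (σ n) p - N) *ᵥ z + (A *ᵥ delta (S n) (τ n) p - A *ᵥ delta Q ψ p) := by
    intro n z
    rw [estMap_eq_estMatrix, estMap_eq_estMatrix, sub_mulVec]
    abel
  refine ⟨fun n => 1 + R * (estMatrix A (S n) (σ n) p - N),
    fun n => R *ᵥ (A *ᵥ delta (S n) (τ n) p - A *ᵥ delta Q ψ p), ?_, ?_, ?_⟩
  · have h1 : Continuous fun M : Matrix (Fin k) (Fin P) ℝ => 1 + R * (M - N) :=
      continuous_const.add (continuous_const.matrix_mul (continuous_id.sub continuous_const))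
    have h2 := (h1.tendsto N).comp (tendsto_estMatrix A h hQ hσ p)
    rw [sub_self, Matrix.mul_zero, add_zero] at h2
    exact h2
  · have h1 : Tendsto (fun n => A *ᵥ delta (S n) (τ n) p - A *ᵥ delta Q ψ p) atTop (𝓝 0) := by
      have := (tendsto_mulVec (tendsto_const_nhds (x := A)) (tendsto_delta h hQ p hψ)).sub_const
        (A *ᵥ delta Q ψ p)
      rwa [sub_self] at this
    have h2 := tendsto_mulVec (tendsto_const_nhds (x := R)) h1
    rwa [mulVec_zero] at h2
  · filter_upwards [hrange] with n hn z
    obtain ⟨x, hx⟩ := hn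
    obtain ⟨x1, hx1⟩ := exists_headCols_mulVec_eq A (S n) (σ n) (τ n) p z
    obtain ⟨x2, hx2⟩ := exists_headCols_mulVec_eq A Q σlim ψ p z
    obtain ⟨w, hw⟩ := exists_estMatrix_mulVec_eq A hQ hσlim.ne' p (x1 - x - x2)
    rw [← hN] at hw
    have h3 : N *ᵥ w = estMap A (S n) (σ n) (τ n) p z - estMap A Q σlim ψ p z := by
      rw [hw, hx1, hx2, hx, mulVec_sub, mulVec_sub]
      abel
    have h4 : N *ᵥ (R *ᵥ (N *ᵥ w)) = N *ᵥ w := by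
      rw [mulVec_mulVec, mulVec_mulVec, hR]
    have h5 : (1 + R * (estMatrix A (S n) (σ n) p - N)) *ᵥ z +
        R *ᵥ (A *ᵥ delta (S n) (τ n) p - A *ᵥ delta Q ψ p) = z + R *ᵥ (N *ᵥ w) := by
      rw [h3, hsub, add_mulVec, one_mulVec, ← mulVec_mulVec, mulVec_add R, add_assoc]
    rw [h5, estMap_eq_estMatrix A Q, mulVec_add, ← hN, h4, h3, estMap_eq_estMatrix A Q, ← hN]
    abel

end

/-! ### Identification of the limit -/

lemma Delta_eq_stdNormal (s a b : ℝ) :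
    Delta s a b = (gaussianReal 0 1).real {x | |s * x + a| < b} := by
  have h : gaussianReal 0 (s ^ 2).toNNReal = (gaussianReal 0 1).map fun x => -s * x := by
    rw [gaussianReal_map_const_mul]
    congr 1
    · simp
    · ext; simp [sq_nonneg]
  have hm : MeasurableSet {x : ℝ | |x - a| < b} := by
    have : Continuous fun x : ℝ => |x - a| := by fun_prop
    exact measurableSet_lt this.measurable measurable_const
  rw [Delta, h, map_measureReal_apply (by fun_prop) hm]
  congr 1
  ext x
  have : -s * x - a = -(s * x + a) := by ring
  simp only [Set.preimage_ofPred_eq, Set.mem_ofPred_eq, this, abs_neg]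

lemma ofReal_one_sub_Delta (s a b : ℝ) :
    ENNReal.ofReal (1 - Delta s a b) = gaussianReal 0 1 {x | b ≤ |s * x + a|} := by
  have hm : MeasurableSet {x : ℝ | |s * x + a| < b} := by
    have : Continuous fun x : ℝ => |s * x + a| := by fun_prop
    exact measurableSet_lt this.measurable measurable_const
  rw [Delta_eq_stdNormal, ← probReal_compl_eq_one_sub hm, ofReal_measureReal]
  congr 1
  ext x
  simp

/-- Independence of the first `p` scores and the later ones. -/
lemma stdNormal_head_tail {P : ℕ} (p : ℕ) {U : Set (Head P p → ℝ)} (hU : MeasurableSet U)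
    {T : Fin P → Set ℝ} (hT : ∀ i, MeasurableSet (T i)) :
    stdNormal (Fin P) {z | headVec z p ∈ U ∧ ∀ i : Fin P, p ≤ (i : ℕ) → z i ∈ T i} =
      stdNormal (Head P p) U * ∏ i : Tail P p, gaussianReal 0 1 (T i) := by
  have h := measurePreserving_piEquivPiSubtypeProd (fun _ : Fin P => gaussianReal 0 1)
    fun i : Fin P => (i : ℕ) < p
  have hTm : MeasurableSet (Set.univ.pi fun i : {i : Fin P // ¬ (i : ℕ) < p} => T i) :=
    MeasurableSet.univ_pi fun i => hT i
  have h1 := h.measure_preimage (hU.prod hTm).nullMeasurableSet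
  rw [Measure.prod_prod, Measure.pi_pi] at h1
  have h2 : ∏ i : Tail P p, gaussianReal 0 1 (T i) =
      ∏ i : {i : Fin P // ¬ (i : ℕ) < p}, gaussianReal 0 1 (T i) :=
    Fintype.prod_equiv (Equiv.subtypeEquivRight fun i => not_lt.symm) _ _ fun i => rfl
  rw [h2, ← h1]
  congr 1
  ext z
  simp only [Set.mem_ofPred_eq, Set.mem_preimage, Set.mem_prod, Set.mem_univ_pi, Subtype.forall,
    not_lt]
  rfl

/-- The events for the tests above order `p`, written in terms of single scores; the factor `ξ_q`
cancels. -/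
lemma tailProd_eq {P : ℕ} {Q : Matrix (Fin P) (Fin P) ℝ} (hQ : Q.PosDef) (c : ℕ → ℝ)
    (ψ : Fin P → ℝ) (σ : ℝ) (p : ℕ) :
    ENNReal.ofReal (tailProd Q c ψ σ p) =
      ∏ i : Tail P p, gaussianReal 0 1 {x | |σ * x + drift Q ψ i| < c (i + 1) * σ} := by
  have hnn : ∀ q ∈ Finset.Icc (p + 1) P,
      0 ≤ Delta (σ * xi Q q) (coord (delta Q ψ q) q + coord ψ q) (c q * σ * xi Q q) :=
    fun q _ => measureReal_nonneg
  rw [tailProd, ENNReal.ofReal_prod_of_nonneg hnn]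
  symm
  refine Finset.prod_bij (fun (i : Tail P p) _ => (i.val : ℕ) + 1) ?_ ?_ ?_ ?_
  · intro i _
    rw [Finset.mem_Icc]
    exact ⟨Nat.succ_le_succ i.2, i.val.2⟩
  · intro i _ j _ hij
    exact Subtype.ext (Fin.ext (Nat.succ_injective hij))
  · intro q hq
    rw [Finset.mem_Icc] at hq
    refine ⟨⟨⟨q - 1, by omega⟩, by simp only; omega⟩, Finset.mem_univ _, by simp only; omega⟩
  · intro i _
    rw [Delta_eq_stdNormal, ofReal_measureReal, coord_succ, coord_succ]
    congr 1
    ext x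
    have hxi := xi_pos hQ i.val
    have h1 : σ * xi Q (i + 1) * x + (delta Q ψ (i + 1) i + ψ i) =
        xi Q (i + 1) * (σ * x + drift Q ψ i) := by
      rw [drift]; field_simp
    have h2 : c (i + 1) * σ * xi Q (i + 1) = xi Q (i + 1) * (c (i + 1) * σ) := by ring
    simp only [Set.mem_ofPred_eq, h1, h2, abs_mul, abs_of_pos hxi]
    rw [mul_lt_mul_iff_right₀ hxi]

/-- Regression of a linear form `ℓ x` of a standard normal vector `x` on a linear image `N x`:
given `N x`, the form is normal with mean `b N x` and variance `ζ²`. -/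
lemma stdNormal_regression {ι κ : Type*} [Fintype ι] [Fintype κ] (N : Matrix κ ι ℝ) (l : ι → ℝ)
    (b : κ → ℝ) (hb : N *ᵥ l = N *ᵥ (Nᵀ *ᵥ b)) {ζ : ℝ} (hζ : ζ ^ 2 = l ⬝ᵥ l - b ⬝ᵥ (N *ᵥ l))
    {C : Set (κ → ℝ)} (hC : MeasurableSet C) {D : Set ℝ} (hD : MeasurableSet D) :
    stdNormal ι {x | N *ᵥ x ∈ C ∧ l ⬝ᵥ x ∈ D} =
      ∫⁻ x, C.indicator (fun g => gaussianReal 0 1 {y | b ⬝ᵥ g + ζ * y ∈ D}) (N *ᵥ x)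
        ∂(stdNormal ι) := by
  -- `(N x, l x)` and `(N x, b N x + ζ y)`, with `y` independent of `x`, have the same covariance
  set M₁ : Matrix (κ ⊕ Unit) ι ℝ := Matrix.of (Sum.elim (fun i => N i) fun _ => l) with hM₁
  set M₂ : Matrix (κ ⊕ Unit) (ι ⊕ Unit) ℝ := Matrix.of (Sum.elim
    (fun i => Sum.elim (N i) fun _ => 0) fun _ => Sum.elim (Nᵀ *ᵥ b) fun _ => ζ) with hM₂
  have hNN : ∀ i, ∑ a, N i a * l a = ∑ a, N i a * (Nᵀ *ᵥ b) a := fun i => congrFun hb i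
  have hcov : M₁ * M₁ᵀ = M₂ * M₂ᵀ := by
    ext i j
    rw [mul_apply, mul_apply, Fintype.sum_sum_type]
    rcases i with i | i <;> rcases j with j | j
    · simp [hM₁, hM₂]
    · simp [hM₁, hM₂, hNN i]
    · simp only [hM₁, hM₂, transpose_apply, Matrix.of_apply, Sum.elim_inl, Sum.elim_inr]
      simp only [mul_comm (l _), hNN j, mul_comm ((Nᵀ *ᵥ b) _)]
      simp
    · have h1 : (Nᵀ *ᵥ b) ⬝ᵥ (Nᵀ *ᵥ b) = b ⬝ᵥ (N *ᵥ l) := by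
        rw [hb, dotProduct_mulVec b, ← mulVec_transpose]
      have h2 : l ⬝ᵥ l = (Nᵀ *ᵥ b) ⬝ᵥ (Nᵀ *ᵥ b) + ζ * ζ := by
        rw [h1, ← sq, hζ]; ring
      simpa [hM₁, hM₂, dotProduct] using h2
  have hlaw := stdNormal_map_mulVec_eq M₁ M₂ hcov
  set T : Set (κ ⊕ Unit → ℝ) := {w | (fun i => w (Sum.inl i)) ∈ C ∧ w (Sum.inr ()) ∈ D} with hT
  have hTm : MeasurableSet T := by
    have h1 : Measurable fun w : κ ⊕ Unit → ℝ => fun i => w (Sum.inl i) := by fun_prop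
    exact (h1 hC).inter ((measurable_pi_apply (Sum.inr ())) hD)
  have h1 : stdNormal ι {x | N *ᵥ x ∈ C ∧ l ⬝ᵥ x ∈ D} =
      stdNormal (ι ⊕ Unit) ((fun z => M₂ *ᵥ z) ⁻¹' T) := by
    rw [← Measure.map_apply (measurable_mulVec M₂) hTm, ← hlaw,
      Measure.map_apply (measurable_mulVec M₁) hTm]
    rfl
  have hmp := measurePreserving_sumPiEquivProdPi (fun _ : ι ⊕ Unit => gaussianReal 0 1)
  set V : Set ((ι → ℝ) × (Unit → ℝ)) :=
    {w | N *ᵥ w.1 ∈ C ∧ b ⬝ᵥ (N *ᵥ w.1) + ζ * w.2 () ∈ D} with hV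
  have hVm : MeasurableSet V := by
    have h2 : Continuous fun w : (ι → ℝ) × (Unit → ℝ) => N *ᵥ w.1 :=
      (continuous_mulVec N).comp continuous_fst
    have h3 : Continuous fun w : (ι → ℝ) × (Unit → ℝ) => b ⬝ᵥ (N *ᵥ w.1) + ζ * w.2 () := by
      refine (continuous_const.dotProduct h2).add (continuous_const.mul ?_)
      exact (continuous_apply ()).comp continuous_snd
    exact (h2.measurable hC).inter (h3.measurable hD)
  have h2 : (fun z => M₂ *ᵥ z) ⁻¹' T =
      MeasurableEquiv.sumPiEquivProdPi (fun _ : ι ⊕ Unit => ℝ) ⁻¹' V := by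
    ext z
    have e1 : ∀ i, (M₂ *ᵥ z) (Sum.inl i) = (N *ᵥ fun a => z (Sum.inl a)) i := fun i => by
      simp [hM₂, mulVec, dotProduct]
    have e2 : (M₂ *ᵥ z) (Sum.inr ()) =
        b ⬝ᵥ (N *ᵥ fun a => z (Sum.inl a)) + ζ * z (Sum.inr ()) := by
      rw [dotProduct_mulVec, ← mulVec_transpose]
      simp [hM₂, mulVec, dotProduct]
    simp only [hT, hV, Set.mem_preimage, Set.mem_ofPred_eq, e1, e2]
    rfl
  rw [h1, h2, hmp.measure_preimage hVm.nullMeasurableSet, Measure.prod_apply hVm]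
  refine lintegral_congr fun x => ?_
  by_cases hx : N *ᵥ x ∈ C
  · rw [Set.indicator_of_mem hx]
    have h3 := measurePreserving_eval (fun _ : Unit => gaussianReal 0 1) ()
    have h4 : MeasurableSet {y : ℝ | b ⬝ᵥ (N *ᵥ x) + ζ * y ∈ D} := by
      have : Measurable fun y : ℝ => b ⬝ᵥ (N *ᵥ x) + ζ * y := by fun_prop
      exact this hD
    rw [← h3.measure_preimage h4.nullMeasurableSet]
    congr 1
    ext y
    simp [hV, hx]
  · rw [Set.indicator_of_notMem hx]
    have h3 : Prod.mk x ⁻¹' V = ∅ := by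
      ext y
      simp [hV, hx]
    rw [h3, measure_empty]

section
variable {P k : ℕ} (A : Matrix (Fin k) (Fin P) ℝ) {Q : Matrix (Fin P) (Fin P) ℝ} (σ : ℝ) (p : ℕ)

/-- A square root of the covariance matrix of `Φ_{∞,p}`: the matrix of `σ A[p] W[p:p]`. -/
def covRoot (A : Matrix (Fin k) (Fin P) ℝ) (Q : Matrix (Fin P) (Fin P) ℝ) (σ : ℝ) (p : ℕ) :
    Matrix (Fin k) (Head P p) ℝ :=
  σ • (headCols A p * leadBlock (whitening Q) p)

lemma asympCov_eq (hQ : Q.PosDef) : asympCov A Q p =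
    (headCols A p * leadBlock (whitening Q) p) * (headCols A p * leadBlock (whitening Q) p)ᵀ := by
  rw [asympCov, leadBlock_inv_eq hQ, transpose_mul]
  simp only [Matrix.mul_assoc]

lemma PhiInf_eq (hQ : Q.PosDef) :
    PhiInf A Q σ p = (stdNormal (Head P p)).map fun x => covRoot A Q σ p *ᵥ x := by
  rw [PhiInf]
  refine multivariateGaussian_map_ofLp_eq _ _ ?_
  rw [asympCov_eq A p hQ, covRoot, transpose_smul, smul_mul, Matrix.mul_smul, smul_smul, sq]

lemma estMap_eq_covRoot (ψ : Fin P → ℝ) (z : Fin P → ℝ) :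
    estMap A Q σ ψ p z = covRoot A Q σ p *ᵥ headVec z p + A *ᵥ delta Q ψ p := by
  rw [estMap, mulVec_add, mulVec_smul, mulVec_headCols_whitening, covRoot, smul_mulVec,
    ← mulVec_mulVec]

variable {σ p}

lemma measurableSet_limitRegion (c : ℕ → ℝ) (pst p : ℕ) (σ : ℝ) (β : Fin P → ℝ) :
    MeasurableSet (limitRegion c pst p σ β) := by
  have h : ∀ i : Fin P, Measurable fun z : Fin P → ℝ => |σ * z i + β i| := fun i => by
    have : Continuous fun z : Fin P → ℝ => |σ * z i + β i| := by fun_prop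
    exact this.measurable
  have h2 : limitRegion c pst p σ β = {z : Fin P → ℝ | pst ≤ p} ∩
      ((⋂ i : Fin P, ⋂ (_ : p ≤ (i : ℕ)), {z | |σ * z i + β i| < c (i + 1) * σ}) ∩
      ⋂ (_ : pst < p), ⋂ i : Fin P, ⋂ (_ : (i : ℕ) + 1 = p), {z | c p * σ ≤ |σ * z i + β i|}) := by
    ext z; simp [limitRegion]
  rw [h2]
  exact (MeasurableSet.const _).inter ((MeasurableSet.iInter fun i => MeasurableSet.iInter fun _ =>
      measurableSet_lt (h i) measurable_const).inter
    (MeasurableSet.iInter fun _ => MeasurableSet.iInter fun i => MeasurableSet.iInter fun _ =>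
      measurableSet_le measurable_const (h i)))

lemma measurableSet_tail (c : ℕ → ℝ) (σ : ℝ) (β : Fin P → ℝ) (i : Fin P) :
    MeasurableSet {x : ℝ | |σ * x + β i| < c (i + 1) * σ} := by
  have : Continuous fun x : ℝ => |σ * x + β i| := by fun_prop
  exact measurableSet_lt this.measurable measurable_const

/-- The limit law for `p = p_*`. -/
lemma map_restrict_limitRegion_eq_leadingTerm (hQ : Q.PosDef) (c : ℕ → ℝ) (ψ : Fin P → ℝ) :
    ((stdNormal (Fin P)).restrict (limitRegion c p p σ (drift Q ψ))).map (estMap A Q σ ψ p) =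
      leadingTerm A Q c ψ σ p := by
  have hF := (continuous_estMap A Q σ ψ p).measurable
  have hadd : Measurable fun g : Fin k → ℝ => g + A *ᵥ delta Q ψ p := by fun_prop
  ext B hB
  have hU : MeasurableSet {x : Head P p → ℝ | covRoot A Q σ p *ᵥ x + A *ᵥ delta Q ψ p ∈ B} :=
    (hadd.comp (measurable_mulVec (covRoot A Q σ p))) hB
  rw [leadingTerm, Measure.smul_apply, Measure.map_apply hadd hB, PhiInf_eq A σ p hQ,
    Measure.map_apply (measurable_mulVec _) (hadd hB), smul_eq_mul, tailProd_eq hQ, mul_comm,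
    Measure.map_apply hF hB, Measure.restrict_apply (hF hB)]
  refine Eq.trans ?_ (stdNormal_head_tail p hU (measurableSet_tail c σ (drift Q ψ)))
  congr 1
  ext z
  simp [limitRegion, estMap_eq_covRoot]

/-- The weight in the limit for `p > p_*` is the conditional probability, given the limit of the
estimator, that the test of order `p` rejects. -/
lemma stdNormal_head_eq_lintegral (hQ : Q.PosDef) {G : Matrix (Fin k) (Fin k) ℝ} (i : Fin P)
    (hG : IsGenInverse (asympCov A Q (i + 1)) G) (a d : ℝ) {C : Set (Fin k → ℝ)}
    (hC : MeasurableSet C) :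
    stdNormal (Head P (i + 1)) {x | covRoot A Q σ (i + 1) *ᵥ x ∈ C ∧
      d ≤ |σ * xi Q (i + 1) * x ⟨i, Nat.lt_succ_self _⟩ + a|} =
    ∫⁻ g in C, ENNReal.ofReal (1 - Delta (σ * zetaInf A Q G (i + 1))
      (a + bInf A Q G (i + 1) g) d) ∂(PhiInf A Q σ (i + 1)) := by
  set p := (i : ℕ) + 1 with hp
  set W := leadBlock (whitening Q) p with hW
  obtain ⟨R, hR⟩ : ∃ R, R = headCols A p * W := ⟨_, rfl⟩
  set e := lastBasisVec P p with he
  set M := asympCov A Q p with hM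
  have hMR : M = R * Rᵀ := by rw [hR]; exact asympCov_eq A p hQ
  have hinv : (leadBlock Q p)⁻¹ = W * Wᵀ := leadBlock_inv_eq hQ p
  -- transposing `M G M = M` gives `M G' M = M`, whence `(M G' R - R) (M G' R - R)' = 0`
  have hMt : Mᵀ = M := by rw [hMR, transpose_mul, transpose_transpose]
  have hG1 : M * G * M = M := hG
  have hG2 : M * Gᵀ * M = M := by
    have := congrArg transpose hG1
    simpa [transpose_mul, hMt, Matrix.mul_assoc] using this
  have hG3 : M * Gᵀ * R = R := by
    have h1 : (M * Gᵀ * R - R) * (M * Gᵀ * R - R)ᵀ = 0 := by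
      have h2 : (M * Gᵀ * R - R) * (M * Gᵀ * R - R)ᵀ =
          M * Gᵀ * (R * Rᵀ) * G * M - M * Gᵀ * (R * Rᵀ) - (R * Rᵀ) * G * M + R * Rᵀ := by
        rw [transpose_sub, transpose_mul, transpose_mul, transpose_transpose, hMt,
          Matrix.sub_mul, Matrix.mul_sub, Matrix.mul_sub]
        simp only [Matrix.mul_assoc]
        abel
      rw [h2, ← hMR, hG2, hG1]
      abel
    have h3 : (M * Gᵀ * R - R) * (M * Gᵀ * R - R)ᴴ = 0 := by simpa using h1
    exact sub_eq_zero.mp (self_mul_conjTranspose_eq_zero.mp h3)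
  have hCinf : Cinf A Q p = R *ᵥ (Wᵀ *ᵥ e) := by
    rw [Cinf, hinv, hR]
    simp only [mulVec_mulVec, Matrix.mul_assoc]
    rfl
  set b := Gᵀ *ᵥ Cinf A Q p with hb
  have hMb : M *ᵥ b = Cinf A Q p := by
    rw [hb, hCinf, mulVec_mulVec, mulVec_mulVec, hG3]
  have hbC : Cinf A Q p ⬝ᵥ (G *ᵥ Cinf A Q p) = b ⬝ᵥ Cinf A Q p := by
    rw [dotProduct_mulVec, ← mulVec_transpose]
  have hxi : (Wᵀ *ᵥ e) ⬝ᵥ (Wᵀ *ᵥ e) = xi Q p ^ 2 := by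
    rw [xi, Real.sq_sqrt (xi_arg_pos hQ i).le, hinv, ← mulVec_mulVec, dotProduct_mulVec e,
      ← mulVec_transpose]
  have hR1 : (Wᵀ *ᵥ e) ⬝ᵥ (Rᵀ *ᵥ b) = b ⬝ᵥ Cinf A Q p := by
    rw [hCinf, dotProduct_mulVec b, ← mulVec_transpose, dotProduct_comm]
  have hR2 : (Rᵀ *ᵥ b) ⬝ᵥ (Rᵀ *ᵥ b) = b ⬝ᵥ Cinf A Q p := by
    rw [← hMb, hMR, ← mulVec_mulVec, dotProduct_mulVec b, ← mulVec_transpose]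
  have hzeta : zetaInf A Q G p ^ 2 = xi Q p ^ 2 - b ⬝ᵥ Cinf A Q p := by
    rw [zetaInf, hbC, Real.sq_sqrt]
    -- the argument of the root is nonnegative, being the squared norm of the regression residual
    have h1 : 0 ≤ (Wᵀ *ᵥ e - Rᵀ *ᵥ b) ⬝ᵥ (Wᵀ *ᵥ e - Rᵀ *ᵥ b) := by
      simpa using dotProduct_star_self_nonneg (Wᵀ *ᵥ e - Rᵀ *ᵥ b)
    rw [sub_dotProduct, dotProduct_sub, dotProduct_sub, hxi, hR2, dotProduct_comm (Rᵀ *ᵥ b), hR1] at h1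
    linarith
  have hN : covRoot A Q σ p = σ • R := by rw [hR]; rfl
  have hreg := stdNormal_regression (covRoot A Q σ p) (σ • (Wᵀ *ᵥ e)) b
    (ζ := σ * zetaInf A Q G p) ?_ ?_ hC (D := {y | d ≤ |y + a|}) ?_
  rotate_left
  · rw [hN, transpose_smul, smul_mulVec, smul_mulVec, smul_mulVec, mulVec_smul, mulVec_smul,
      mulVec_mulVec b, ← hMR, hMb, hCinf]
  · rw [mul_pow, hzeta, hN, smul_mulVec, mulVec_smul, ← hCinf, smul_dotProduct, dotProduct_smul, hxi,
      dotProduct_smul, dotProduct_smul]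
    simp only [smul_eq_mul]
    ring
  · have : Continuous fun y : ℝ => |y + a| := by fun_prop
    exact measurableSet_le measurable_const this.measurable
  have hl : ∀ x : Head P p → ℝ, (σ • (Wᵀ *ᵥ e)) ⬝ᵥ x =
      σ * xi Q p * x ⟨i, Nat.lt_succ_self _⟩ := by
    intro x
    have h1 : (Wᵀ *ᵥ e) ⬝ᵥ x = e ⬝ᵥ (W *ᵥ x) := by
      rw [dotProduct_mulVec, ← mulVec_transpose]
    rw [smul_dotProduct, h1, he, dotProduct_lastBasisVec, smul_eq_mul, mul_assoc]
    congr 1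
    rw [mulVec, dotProduct, Finset.sum_eq_single ⟨i, Nat.lt_succ_self _⟩]
    · rw [← whitening_diag]; rfl
    · intro j _ hj
      have hj' : (j.val : ℕ) ≠ i := fun h => hj (Subtype.ext (Fin.ext h))
      have : j.val < i := Fin.lt_def.mpr (lt_of_le_of_ne (Nat.lt_succ_iff.mp j.2) hj')
      have h0 : W ⟨i, Nat.lt_succ_self _⟩ j = 0 := whitening_of_lt this
      rw [h0, zero_mul]
    · simp
  have hfun : ∀ g : Fin k → ℝ, ENNReal.ofReal (1 - Delta (σ * zetaInf A Q G p)
      (a + bInf A Q G p g) d) =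
      gaussianReal 0 1 {y | b ⬝ᵥ g + σ * zetaInf A Q G p * y ∈ {y | d ≤ |y + a|}} := by
    intro g
    rw [ofReal_one_sub_Delta]
    congr 1
    ext y
    have h1 : bInf A Q G p g = b ⬝ᵥ g := by
      rw [bInf, dotProduct_mulVec, ← mulVec_transpose]
    have h2 : σ * zetaInf A Q G p * y + (a + b ⬝ᵥ g) = b ⬝ᵥ g + σ * zetaInf A Q G p * y + a := by
      ring
    simp only [Set.mem_ofPred_eq, h1, h2]
  have hmeas : Measurable fun g : Fin k → ℝ =>
      gaussianReal 0 1 {y | b ⬝ᵥ g + σ * zetaInf A Q G p * y ∈ {y | d ≤ |y + a|}} := by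
    have hc : Continuous fun w : (Fin k → ℝ) × ℝ =>
        |b ⬝ᵥ w.1 + σ * zetaInf A Q G p * w.2 + a| := by
      have : Continuous fun w : (Fin k → ℝ) × ℝ => b ⬝ᵥ w.1 :=
        continuous_const.dotProduct continuous_fst
      fun_prop
    exact measurable_measure_prodMk_left (measurableSet_le measurable_const hc.measurable)
  simp_rw [hl] at hreg
  rw [PhiInf_eq A σ p hQ, ← lintegral_indicator hC, funext hfun, lintegral_map (hmeas.indicator hC) (measurable_mulVec _)]
  exact hreg

/-- The limit law for `p > p_*`. -/
lemma map_restrict_limitRegion_eq_sumTerm (hQ : Q.PosDef) (c : ℕ → ℝ) (ψ : Fin P → ℝ)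
    {G : Matrix (Fin k) (Fin k) ℝ} {pst : ℕ} (i : Fin P) (hpst : pst < i + 1)
    (hG : IsGenInverse (asympCov A Q (i + 1)) G) :
    ((stdNormal (Fin P)).restrict (limitRegion c pst (i + 1) σ (drift Q ψ))).map
      (estMap A Q σ ψ (i + 1)) = sumTerm A Q G c ψ σ (i + 1) := by
  have hF := (continuous_estMap A Q σ ψ (i + 1)).measurable
  have hadd : Measurable fun g : Fin k → ℝ => g + A *ᵥ delta Q ψ (i + 1) := by fun_prop
  have hxi := xi_pos hQ i
  ext B hB
  set a := delta Q ψ (i + 1) i + ψ i with ha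
  set d := c (i + 1) * σ * xi Q (i + 1) with hd
  have hU : MeasurableSet {x : Head P (i + 1) → ℝ | covRoot A Q σ (i + 1) *ᵥ x ∈
      (fun g => g + A *ᵥ delta Q ψ (i + 1)) ⁻¹' B ∧
      d ≤ |σ * xi Q (i + 1) * x ⟨i, Nat.lt_succ_self _⟩ + a|} := by
    have h1 : Continuous fun x : Head P (i + 1) → ℝ =>
        |σ * xi Q (i + 1) * x ⟨i, Nat.lt_succ_self _⟩ + a| := by fun_prop
    exact ((measurable_mulVec _) (hadd hB)).inter (measurableSet_le measurable_const h1.measurable)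
  rw [sumTerm, Measure.smul_apply, Measure.map_apply hadd hB, withDensity_apply _ (hadd hB),
    smul_eq_mul, tailProd_eq hQ, mul_comm, coord_succ, coord_succ, ← ha, ← hd,
    ← stdNormal_head_eq_lintegral A hQ i hG a d (hadd hB), Measure.map_apply hF hB,
    Measure.restrict_apply (hF hB)]
  refine Eq.trans ?_ (stdNormal_head_tail (i + 1) hU (measurableSet_tail c σ (drift Q ψ)))
  congr 1
  ext z
  have h1 : ∀ j : Fin P, (j : ℕ) + 1 = i + 1 ↔ j = i := fun j => by
    rw [Nat.add_right_cancel_iff, Fin.ext_iff]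
  have h2 : σ * xi Q (i + 1) * z i + a = xi Q (i + 1) * (σ * z i + drift Q ψ i) := by
    rw [ha, drift]; field_simp
  have h3 : d = xi Q (i + 1) * (c (i + 1) * σ) := by rw [hd]; ring
  have h4 : d ≤ |σ * xi Q (i + 1) * z i + a| ↔ c (i + 1) * σ ≤ |σ * z i + drift Q ψ i| := by
    rw [h2, h3, abs_mul, abs_of_pos hxi, mul_le_mul_iff_right₀ hxi]
  have h5 : z ∈ limitRegion c pst (i + 1) σ (drift Q ψ) ↔
      (∀ j : Fin P, (i : ℕ) + 1 ≤ j → |σ * z j + drift Q ψ j| < c (j + 1) * σ) ∧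
        d ≤ |σ * xi Q (i + 1) * z i + a| := by
    rw [h4]
    simp only [limitRegion, Set.mem_ofPred_eq, hpst, hpst.le, h1, true_and, true_imp_iff, forall_eq]
  rw [Set.mem_inter_iff, h5, Set.mem_preimage, estMap_eq_covRoot]
  exact ⟨fun h => ⟨⟨h.1, h.2.2⟩, h.2.1⟩, fun h => ⟨h.1.1, h.2, h.1.2⟩⟩

end

/-! ### The limit event has null boundary; densities of the weighted conditional laws -/

lemma ae_eventually_mem_limitRegion_iff {P : ℕ} (c : ℕ → ℝ) (pst p : ℕ) {σ : ℝ} (hσ : 0 < σ)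
    (β : Fin P → ℝ) : ∀ᵐ z ∂(stdNormal (Fin P)),
      ∀ᶠ y in 𝓝 z, (y ∈ limitRegion c pst p σ β ↔ z ∈ limitRegion c pst p σ β) := by
  filter_upwards [ae_abs_ne hσ β fun i => c (i + 1) * σ] with z hz
  have h1 : ∀ i : Fin P, ∀ᶠ y : Fin P → ℝ in 𝓝 z,
      (|σ * y i + β i| < c (i + 1) * σ ↔ |σ * z i + β i| < c (i + 1) * σ) := by
    intro i
    have hcont : Continuous fun y : Fin P → ℝ => |σ * y i + β i| := by fun_prop
    rcases (hz i).lt_or_gt with h | h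
    · filter_upwards [hcont.continuousAt.eventually_lt continuousAt_const h] with y hy
      exact iff_of_true hy h
    · filter_upwards [continuousAt_const.eventually_lt hcont.continuousAt h] with y hy
      exact iff_of_false hy.not_gt h.not_gt
  filter_upwards [eventually_all.mpr h1] with y hy
  have h2 : ∀ i : Fin P, (i : ℕ) + 1 = p →
      (c p * σ ≤ |σ * y i + β i| ↔ c p * σ ≤ |σ * z i + β i|) := by
    rintro i rfl
    rw [← not_lt, ← not_lt, hy i]
  simp only [limitRegion, Set.mem_ofPred_eq]
  refine and_congr_right fun _ => and_congr ?_ ?_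
  · exact forall_congr' fun i => forall_congr' fun _ => hy i
  · exact forall_congr' fun _ => forall_congr' fun i => forall_congr' fun hi => h2 i hi

lemma mulVec_surjective_of_rank_eq {k : ℕ} {m : Type*} [Fintype m] [DecidableEq m]
    {M : Matrix (Fin k) m ℝ} (hM : M.rank = k) : Function.Surjective fun x => M *ᵥ x := by
  have h : LinearMap.range M.mulVecLin = ⊤ := by
    apply Submodule.eq_top_of_finrank_eq
    rw [Module.finrank_fin_fun]
    exact hM
  exact LinearMap.range_eq_top.mp h

/-- The weighted conditional law is dominated by the image of the standard normal law of the scores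
under an affine map that is onto if `A[p]` has full row rank. -/
lemma hasLebesgueDensity_weightedCondLaw {n P k : ℕ} (A : Matrix (Fin k) (Fin P) ℝ)
    {X : Matrix (Fin n) (Fin P) ℝ} (c : ℕ → ℝ) (θ : Fin P → ℝ) {σ : ℝ}
    {s : (Fin n → ℝ) → ℝ} {O p : ℕ} (hn : 0 < n) (hS : (gram X).PosDef) (hσ : 0 < σ)
    (hs : Measurable s) (hcO : c O = 0) (hOp : O ≤ p) (hpP : p ≤ P)
    (hA : (headCols A p).rank = k) : HasLebesgueDensity (weightedCondLaw A X c θ σ s p) := by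
  have hfin := isFiniteMeasure_weightedCondLaw (X := X) A c θ (σ := σ) hs hcO hOp hpP
  set N := estMatrix A (gram X) σ p with hN
  set w := A *ᵥ delta (gram X) (√(n : ℝ) • θ) p with hw
  have hsurj : Function.Surjective N.mulVecLin := by
    intro y
    obtain ⟨x, hx⟩ := mulVec_surjective_of_rank_eq hA y
    obtain ⟨z, hz⟩ := exists_estMatrix_mulVec_eq A hS hσ.ne' p x
    exact ⟨z, hz.trans hx⟩
  have hac : weightedCondLaw A X c θ σ s p ≪ volume := by
    refine Measure.AbsolutelyContinuous.mk fun B hB hB0 => ?_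
    have hB' : MeasurableSet ((fun y => y + w) ⁻¹' B) := (measurable_add_const w) hB
    have hB1 : volume ((fun y => y + w) ⁻¹' B) = 0 := by
      rw [measure_preimage_add_right, hB0]
    have hB2 : volume (N.mulVecLin ⁻¹' ((fun y => y + w) ⁻¹' B)) = 0 := by
      have h := (ae_comp_linearMap_mem_iff N.mulVecLin volume volume hsurj hB'.compl).mpr
        (measure_eq_zero_iff_ae_notMem.mp hB1)
      exact measure_eq_zero_iff_ae_notMem.mpr h
    have hB3 : N.mulVecLin ⁻¹' ((fun y => y + w) ⁻¹' B) =
        estMap A (gram X) σ (√(n : ℝ) • θ) p ⁻¹' B := by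
      ext z
      simp only [Set.mem_preimage, estMap_eq_estMatrix]
      rfl
    rw [hB3] at hB2
    have hm := (continuous_estMap A (gram X) σ (√(n : ℝ) • θ) p).measurable
    have hms := measurable_scores X θ σ
    have hB4 : dataLaw X θ σ (scores X θ σ ⁻¹' (estMap A (gram X) σ (√(n : ℝ) • θ) p ⁻¹' B)) = 0 := by
      rw [← Measure.map_apply hms (hm hB), map_scores θ hn hS hσ]
      exact stdNormal_absolutelyContinuous (Fin P) hB2
    have h := weightedCondLaw_real A c θ hn hS hσ hs hcO hOp hpP hB
    rw [measureReal_def _ (_ ∩ _), measure_mono_null Set.inter_subset_right hB4,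
      ENNReal.toReal_zero, measureReal_eq_zero_iff] at h
    exact h
  exact ⟨_, Measure.measurable_rnDeriv _ _, (Measure.withDensity_rnDeriv_eq _ _ hac).symm⟩

end PostModelSelection

end

open PostModelSelection in
theorem corollary5p3 (P k O : ℕ) (hO : O < P) (hk : 1 ≤ k)
    -- the matrix `A` of rank `k`
    (A : Matrix (Fin k) (Fin P) ℝ) (hA : A.rank = k)
    -- the regressor matrices, of full column rank, with `X'X / n → Q` non-singular
    (X : ∀ n : ℕ, Matrix (Fin n) (Fin P) ℝ) (hX : ∀ n, P < n → (X n).rank = P)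
    (Q : Matrix (Fin P) (Fin P) ℝ) (hQ : Tendsto (fun n => gram (X n)) atTop (𝓝 Q))
    (hQdet : IsUnit Q.det)
    -- the critical values
    (c : ℕ → ℝ) (hcO : c O = 0) (hc : ∀ p, O < p → p ≤ P → 0 < c p)
    -- the parameter sequences
    (θ : ℕ → Fin P → ℝ) (ψ : Fin P → EReal)
    (hψ : ∀ i, Tendsto (fun n : ℕ => ((√(n : ℝ) * θ n i : ℝ) : EReal)) atTop (𝓝 (ψ i)))
    (σ : ℕ → ℝ) (hσ : ∀ n, P < n → 0 < σ n)
    (σlim : ℝ) (hσlim : 0 < σlim) (hσtends : Tendsto σ atTop (𝓝 σlim))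
    -- the model order, and any generalized inverse that enters the limit
    (p : ℕ) (hOp : O ≤ p) (hpP : p ≤ P)
    (Ginv : Matrix (Fin k) (Fin k) ℝ) (hGinv : IsGenInverse (asympCov A Q p) Ginv)
    -- the weighted conditional distributions, in the unknown- and in the known-variance case
    (H : ℕ → Measure (Fin k → ℝ))
    (hH : (∀ n, H n = weightedCond A (X n) c (θ n) (σ n) p) ∨
      (∀ n, H n = weightedCondStar A (X n) c (θ n) (σ n) p)) :
    (p = pStar O ψ → WeakConv H (leadingTerm A Q c (realPart ψ) σlim p)) ∧
    (pStar O ψ < p → WeakConv H (sumTerm A Q Ginv c (realPart ψ) σlim p)) ∧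
    (p < pStar O ψ → TVConv H 0) ∧
    (((0 < p ∧ (headCols A p).rank = k) ∨
        (p < P ∧ ∃ v : Fin k → ℝ, ∀ n, P < n →
          √(n : ℝ) • (tailCols A p *ᵥ tailVec (θ n) p) = v)) →
      (p = pStar O ψ → TVConv H (leadingTerm A Q c (realPart ψ) σlim p)) ∧
      (pStar O ψ < p → TVConv H (sumTerm A Q Ginv c (realPart ψ) σlim p))) ∧
    (0 < p → (headCols A p).rank = k → ∀ n, P < n → HasLebesgueDensity (H n)) := by
  have hS : ∀ n, P < n → (gram (X n)).PosDef := fun n hn => posDef_gram hn (hX n hn)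
  have hQpd : Q.PosDef := posDef_of_tendsto (fun n => posSemidef_gram (X n)) hQ hQdet
  have hc0 : ∀ q, p ≤ q → q ≤ P → 0 ≤ c q := fun q hpq hqP => by
    rcases (hOp.trans hpq).eq_or_lt with rfl | h
    · exact hcO.ge
    · exact (hc q h hqP).le
  -- the two cases differ only in the scale of the test statistics, a consistent estimator of `σlim`
  obtain ⟨s, hs, hHs, δ, hδ, hdev⟩ : ∃ s : ∀ n : ℕ, (Fin n → ℝ) → ℝ, (∀ n, Measurable (s n)) ∧
      (∀ n, H n = weightedCondLaw A (X n) c (θ n) (σ n) (s n) p) ∧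
      ∃ δ : ℕ → ℝ, Tendsto δ atTop (𝓝 0) ∧ Tendsto (fun n =>
        (dataLaw (X n) (θ n) (σ n)).real {Y | δ n < |s n Y - σlim|}) atTop (𝓝 0) := by
    rcases hH with hH | hH
    · exact ⟨fun n => sigmaHat (X n), fun n => measurable_sigmaHat (X n), hH,
        exists_sigmaHat_deviation X hS θ σ hσ hσlim hσtends⟩
    · refine ⟨fun n _ => σ n, fun n => measurable_const, hH, fun n => |σ n - σlim|, ?_, ?_⟩
      · simpa using (hσtends.sub_const σlim).abs
      · simp
  set τ : ℕ → Fin P → ℝ := fun n => √(n : ℝ) • θ n with hτ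
  set ψr := realPart ψ with hψr
  set E := limitRegion c (pStar O ψ) p σlim (drift Q ψr) with hE
  have hEm : MeasurableSet E := measurableSet_limitRegion c _ p σlim _
  obtain ⟨ε, hε, happ⟩ := exists_uniform_approximation A X hS c hcO hOp hpP hc0 θ σ hσ hσlim s hs
    hδ hdev hEm fun a b ha hb =>
      ae_eventually_mem_selRegion_iff c hcO hOp hQ hQpd (τ := τ) hψ hσlim hσtends ha hb
  have happ' : ∀ᶠ n in atTop, ∀ B, MeasurableSet B → |(H n).real B - (stdNormal (Fin P)).real
      (E ∩ estMap A (gram (X n)) (σ n) (τ n) p ⁻¹' B)| ≤ ε n := by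
    filter_upwards [happ] with n hn
    rw [hHs n]
    exact hn
  have hτlim : pStar O ψ ≤ p → ∀ i : Fin P, p ≤ (i : ℕ) →
      Tendsto (fun n => τ n i) atTop (𝓝 (ψr i)) := fun h i hi =>
    tendsto_realPart (hψ i) (ne_top_ne_bot_of_pStar_le (h.trans hi))
  set F := estMap A Q σlim ψr p with hF
  have hFm : Measurable F := (continuous_estMap A Q σlim ψr p).measurable
  have hleading : p = pStar O ψ →
      ((stdNormal (Fin P)).restrict E).map F = leadingTerm A Q c ψr σlim p := fun h => by
    rw [hE, ← h]
    exact map_restrict_limitRegion_eq_leadingTerm A hQpd c ψr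
  have hsum : pStar O ψ < p →
      ((stdNormal (Fin P)).restrict E).map F = sumTerm A Q Ginv c ψr σlim p := fun h => by
    obtain ⟨i, rfl⟩ : ∃ i : Fin P, p = i + 1 := ⟨⟨p - 1, by omega⟩, by simp only; omega⟩
    exact map_restrict_limitRegion_eq_sumTerm A hQpd c ψr i h hGinv
  have hweak : pStar O ψ ≤ p → WeakConv H (((stdNormal (Fin P)).restrict E).map F) := fun h =>
    weakConv_of_approximation (stdNormal (Fin P)) hFm
      (fun n => (continuous_estMap A (gram (X n)) (σ n) (τ n) p).measurable)
      (tendsto_estMap A hQ hQpd hσtends (hτlim h)) hε happ'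
  have htv : ((0 < p ∧ (headCols A p).rank = k) ∨ (p < P ∧ ∃ v : Fin k → ℝ, ∀ n, P < n →
      √(n : ℝ) • (tailCols A p *ᵥ tailVec (θ n) p) = v)) → pStar O ψ ≤ p →
      TVConv H (((stdNormal (Fin P)).restrict E).map F) := fun hcase h => by
    have hrange : ∀ᶠ n in atTop, ∃ x, tailCols A p *ᵥ tailVec (τ n) p =
        tailCols A p *ᵥ tailVec ψr p + headCols A p *ᵥ x := by
      rcases hcase with ⟨-, hrank⟩ | ⟨-, v, hv⟩
      · refine Eventually.of_forall fun n => ?_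
        obtain ⟨x, hx⟩ := mulVec_surjective_of_rank_eq hrank
          (tailCols A p *ᵥ tailVec (τ n) p - tailCols A p *ᵥ tailVec ψr p)
        exact ⟨x, by simp only [hx, add_sub_cancel]⟩
      · have hconst : ∀ᶠ n in atTop, tailCols A p *ᵥ tailVec (τ n) p = v := by
          filter_upwards [eventually_gt_atTop P] with n hn
          rw [← hv n hn, ← mulVec_smul]
          rfl
        have hlim : Tendsto (fun n => tailCols A p *ᵥ tailVec (τ n) p) atTop
            (𝓝 (tailCols A p *ᵥ tailVec ψr p)) :=
          tendsto_mulVec tendsto_const_nhds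
            (tendsto_pi_nhds.mpr fun i => hτlim h i.val i.2)
        have hveq : v = tailCols A p *ᵥ tailVec ψr p :=
          tendsto_nhds_unique (tendsto_const_nhds.congr' (hconst.mono fun n hn => hn.symm)) hlim
        filter_upwards [hconst] with n hn
        exact ⟨0, by rw [hn, mulVec_zero, add_zero, hveq]⟩
    obtain ⟨L, v, hL, hv, hLv⟩ :=
      exists_reparametrization A hQ hQpd hσlim hσtends (hτlim h) hrange
    obtain ⟨ε', hε', hb⟩ := exists_uniform_bound_of_reparametrization hEm
      (ae_eventually_mem_limitRegion_iff c _ p hσlim _) hFm hL hv hLv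
    refine tvConv_of_approximation (ε := fun n => ε n + ε' n) (by simpa using hε.add hε') ?_
    filter_upwards [happ', hb] with n h1 h2 B hB
    rw [map_measureReal_apply hFm hB, measureReal_restrict_apply (hFm hB), Set.inter_comm]
    exact (abs_sub_le _ _ _).trans (add_le_add (h1 B hB) (h2 B hB))
  refine ⟨fun h => hleading h ▸ hweak h.ge, fun h => hsum h ▸ hweak h.le, fun h => ?_,
    fun hcase => ⟨fun h => hleading h ▸ htv hcase h.ge, fun h => hsum h ▸ htv hcase h.le⟩,
    fun _ hrank n hn => ?_⟩
  · have hE0 : E = ∅ := Set.eq_empty_of_forall_notMem fun z hz => absurd hz.1 (not_le.mpr h)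
    refine tvConv_of_approximation hε ?_
    filter_upwards [happ'] with n hn B hB
    simpa [hE0] using hn B hB
  · rw [hHs n]
    exact hasLebesgueDensity_weightedCondLaw A c (θ n) (by omega) (hS n hn) (hσ n hn) (hs n) hcO hOp
      hpP hrank
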